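/- Let $d\ge 1$ and let $\mathbb M$ be a compact $d$-dimensional smooth Riemannian manifold without boundary, with geodesic distance $\rho$ (with $\rho=\infty$ between different components) and Riemannian volume $\mathrm{vol}$. Let $0<\beta\le 1$, $L>0$, $\sigma>0$, and let $$\Lambda(\beta,L)=\{f:\mathbb M\to\mathbb R : |f(x)-f(z)|\le L\,\rho(x,z)^\beta \text{ for all } x,z\in\mathbb M\}.$$ For each $n$ let $x_{n,1},\dots,x_{n,n}\in\mathbb M$ be design points, and suppose that one observes $$y_i=f(x_{n,i})+\varepsilon_i,\qquad i=1,\dots,n,$$ with independent $\varepsilon_i\sim N(0,\sigma^2)$ and unknown $f\in\Lambda(\beta,L)$. Assume that the design is asymptotically uniform at the scale $h_n=(\log n/n)^{1/(2\beta+d)}$: for every $c>0$, with $B_z(r)=\{x\in\mathbb M:\rho(x,z)\le r\}$, $$\sup_{z\in\mathbb M}\left|\frac{\#\{i\le n: x_{n,i}\in B_z(ch_n)\}/n}{\mathrm{vol}(B_z(ch_n))/\mathrm{vol}(\mathbb M)}-1\right|\longrightarrow 0\qquad(n\to\infty).$$ Let $w:[0,\infty)\to\mathbb R$ be continuous and nondecreasing,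 with $w(0)=0$ and $w(u)=O(u^p)$ as $u\to\infty$ for some $p$; put $w(\infty)=\sup w$. Let $$\psi_n=\left(\frac{\log n}{n}\right)^{\beta/(2\beta+d)},\qquad C_0=L^{d/(2\beta+d)}\left(\frac{\sigma^2\,\mathrm{vol}(\mathbb M)\,(\beta+d)\,d^2}{\mathrm{vol}(\mathbb S^{d-1})\,\beta^2}\right)^{\beta/(2\beta+d)},\qquad \mathrm{vol}(\mathbb S^{d-1})=\frac{2\pi^{d/2}}{\Gamma(d/2)}.$$ Then $$\lim_{n\to\infty}\ \inf_{\tilde f}\ \sup_{f\in\Lambda(\beta,L)}\mathbb E_f\, w\big(\psi_n^{-1}\|\tilde f-f\|_\infty\big)=w(C_0),$$ where $\|g\|_\infty=\sup_{x\in\mathbb M}|g(x)|$ and the infimum is over all estimators $\tilde f$, that is, all real functions $\tilde f(x)=\tilde f(y_1,\dots,y_n;x)$ of the data and of the point $x\in\mathbb M$ that are jointly measurable in $(y_1,\dots,y_n,x)$. -/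

import Mathlib

open Bundle MeasureTheory ProbabilityTheory Filter Manifold
open scoped ENNReal NNReal ContDiff Topology

noncomputable section

section RiemannianVolume

variable {d : ℕ} {M : Type*} [TopologicalSpace M] [ChartedSpace (EuclideanSpace ℝ (Fin d)) M]
  [RiemannianBundle (fun x : M => TangentSpace (𝓡 d) x)]

/-- The coordinate vector field `∂ᵢ` of the chart around `p`, at the point with coordinates `u`. -/
def coordVec (p : M) (u : EuclideanSpace ℝ (Fin d)) (i : Fin d) :
    TangentSpace (𝓡 d) ((chartAt (EuclideanSpace ℝ (Fin d)) p).symm u) :=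
  mfderiv (𝓡 d) (𝓡 d) (chartAt (EuclideanSpace ℝ (Fin d)) p).symm u
    (EuclideanSpace.single i (1 : ℝ) : EuclideanSpace ℝ (Fin d))

/-- The matrix `(gᵢⱼ)` of the metric tensor in the chart around `p`. -/
def metricMatrix (p : M) (u : EuclideanSpace ℝ (Fin d)) : Matrix (Fin d) (Fin d) ℝ :=
  Matrix.of fun i j => inner ℝ (coordVec p u i) (coordVec p u j)

/-- The measure `√(det g) du` on the domain of the chart around `p`, as a measure on `M`. -/
def chartVolume (d : ℕ) {M : Type*} [TopologicalSpace M]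
    [ChartedSpace (EuclideanSpace ℝ (Fin d)) M]
    [RiemannianBundle (fun x : M => TangentSpace (𝓡 d) x)] [MeasurableSpace M]
    (p : M) : Measure M :=
  Measure.map (chartAt (EuclideanSpace ℝ (Fin d)) p).symm
    (((volume : Measure (EuclideanSpace ℝ (Fin d))).restrict
        (chartAt (EuclideanSpace ℝ (Fin d)) p).target).withDensity
      fun u => ENNReal.ofReal (Real.sqrt (metricMatrix p u).det))

/-- The Riemannian volume measure. The measures `√(det g) du` of two charts agree on the overlap of
their domains, so that the supremum (in the lattice of measures) glues them together: it is the
measure whose restriction to each chart domain is `√(det g) du`. -/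
def riemannianVolume (d : ℕ) (M : Type*) [TopologicalSpace M]
    [ChartedSpace (EuclideanSpace ℝ (Fin d)) M]
    [RiemannianBundle (fun x : M => TangentSpace (𝓡 d) x)] [MeasurableSpace M] :
    Measure M :=
  ⨆ p : M, chartVolume d p

end RiemannianVolume

/-- The volume `2 π^(d/2) / Γ(d/2)` of the unit sphere `S^(d-1)`. -/
def sphereVolume (d : ℕ) : ℝ :=
  2 * Real.pi ^ ((d : ℝ) / 2) / Real.Gamma ((d : ℝ) / 2)

/-- The rate `ψ_n = (log n / n)^(β/(2β+d))`. -/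
def rate (d : ℕ) (β : ℝ) (n : ℕ) : ℝ :=
  (Real.log n / n) ^ (β / (2 * β + d))

/-- The length scale `ψ_n^(1/β) = (log n / n)^(1/(2β+d))`. -/
def bandwidth (d : ℕ) (β : ℝ) (n : ℕ) : ℝ :=
  (Real.log n / n) ^ (1 / (2 * β + d))

/-- The constant `C₀`, where `V` is the volume of the manifold. -/
def minimaxConst (d : ℕ) (β L σ V : ℝ) : ℝ :=
  L ^ ((d : ℝ) / (2 * β + d)) *
    (σ ^ 2 * V * (β + d) * (d : ℝ) ^ 2 / (sphereVolume d * β ^ 2)) ^ (β / (2 * β + d))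

/-- A triangular array of design points is asymptotically uniform at scale `r n` if, for each
`c > 0`, the proportion of design points in a geodesic ball of radius `c * r n` is asymptotically
the proportion of the volume that the ball occupies, uniformly in the centre of the ball. -/
def IsAsympUniform (d : ℕ) {M : Type*} [EMetricSpace M]
    [ChartedSpace (EuclideanSpace ℝ (Fin d)) M]
    [RiemannianBundle (fun x : M => TangentSpace (𝓡 d) x)] [MeasurableSpace M]
    (x : (n : ℕ) → Fin n → M) (r : ℕ → ℝ) : Prop :=
  ∀ c : ℝ, 0 < c →
    TendstoUniformly
      (fun (n : ℕ) (z : M) =>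
        (({i : Fin n | edist (x n i) z ≤ ENNReal.ofReal (c * r n)}.ncard : ℝ) / n) /
          ((riemannianVolume d M).real {p : M | edist p z ≤ ENNReal.ofReal (c * r n)} /
            (riemannianVolume d M).real Set.univ))
      (fun _ => 1) atTop

/-- The joint law of `y i = f (x i) + ε i`, with independent `ε i` of law `N(0, σ²)`. -/
def regressionLaw {M : Type*} {n : ℕ} (σ : ℝ≥0) (x : Fin n → M) (f : M → ℝ) :
    Measure (Fin n → ℝ) :=
  Measure.pi fun i => gaussianReal (f (x i)) (σ ^ 2)

/-- The sup-norm distance `‖g - f‖_∞`, which may be infinite. -/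
def supDist {M : Type*} (g f : M → ℝ) : ℝ≥0∞ :=
  ⨆ p : M, ENNReal.ofReal |g p - f p|

/-- The extension to `[0, ∞]` of a loss function `w`, nonnegative and nondecreasing on `[0, ∞)`:
it is `w t` for finite `t`, and `sup w` at `t = ∞`. -/
def extendLoss (w : ℝ → ℝ) (t : ℝ≥0∞) : ℝ≥0∞ :=
  ⨆ (u : ℝ≥0) (_ : (u : ℝ≥0∞) ≤ t), ENNReal.ofReal (w u)

/-- The estimators of the regression function from `n` observations (at known design points). -/
def Estimator (M : Type*) [MeasurableSpace M] (n : ℕ) : Set ((Fin n → ℝ) → M → ℝ) :=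
  {T | Measurable (Function.uncurry T)}

/-- The minimax risk `inf_T sup_f E w(ψ⁻¹ ‖T - f‖_∞)`, with `f` in the class of functions with
`|f p - f q| ≤ L ρ(p, q)^β`. -/
def supNormMinimaxRisk {M : Type*} [EMetricSpace M] [MeasurableSpace M] {n : ℕ}
    (w : ℝ → ℝ) (β L σ : ℝ≥0) (ψ : ℝ) (x : Fin n → M) : ℝ≥0∞ :=
  ⨅ T ∈ Estimator M n, ⨆ (f : M → ℝ) (_ : HolderWith L β f),
    ∫⁻ y, extendLoss w (ENNReal.ofReal ψ⁻¹ * supDist (T y) f) ∂(regressionLaw σ x f)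

end

/-! Put `h = bandwidth d β n`, `ψ = rate d β n`, `r = c * h`, `H = L * c ^ β` and `κ = d / (2β +
d)`. The bump `L r^β (1 - (ρ/r)^β)₊` has height `H ψ`, and it plays two parts: least detectable
signal and optimal kernel. Since `n h^d ψ² = log n`, its squared signal-to-noise ratio is about `X
log n` for a constant `X = X(c)`, while `M` contains about `h^(-d)`, that is `n^κ` up to logarithms,
separated balls of radius of order `h`.

Lower bound. Give bumps at separated centres arbitrary signs. If the estimator has the wrong sign at
one centre, its error is at least `H ψ`. The supports are disjoint, so recovery of the signs splits
into independent binary problems, each failing with probability at least `exp (-s/2 - √s) / 2` for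
signal-to-noise `s` (`sum_measure_signs_recovered_le`). If `X < 2κ`, the number of bumps times this
probability tends to infinity, so for some choice of signs an error occurs with probability tending
to one, and the risk is asymptotically at least `w H` (`le_supNormMinimaxRisk`).

Upper bound. Use the bump as the kernel of a local average, evaluated on a net of mesh `δ h`. The
bias is about `H ψ d/(d + 2β)` at most, and a union bound over about `n^κ` net points keeps the
noise below `H ψ 2β/(d + 2β)` once `c` is above the threshold (`supNormMinimaxRisk_le`). The two
fractions add up to `H ψ`; exponential moments absorb the growth of `w` on the rare event.

With `ω` the volume of the unit ball and `V` that of `M`, both thresholds are the same equation `L²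
(ω/V) β² c^(2β+d) = σ² d (d + β)`. Its root `c₀` is `criticalRadius`, and `L c₀^β` is the asserted
constant. Letting `c` tend to `c₀` from either side and using continuity of `w` finishes the proof.

Geometry enters only through sums of bumps over the design and through the size of nets. Both follow
from `vol (B_z(r)) ~ ω r^d` uniformly in `z`. No exponential map is needed: near `p`, the chart
compares the metric with the constant metric frozen at `p` up to a factor `κ > 1` (a different `κ`),
so a geodesic ball lies between two ellipsoids; compactness makes this uniform. -/

noncomputable section

/-! ### Gram determinants and volume distortion of linear maps -/

section GramDeterminant

variable {d : ℕ} {F F' : Type*} [NormedAddCommGroup F] [InnerProductSpace ℝ F]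
  [NormedAddCommGroup F'] [InnerProductSpace ℝ F']

/-- The volume distortion `√det ⟪B eᵢ, B eⱼ⟫` of a linear map `B`. -/
def gramVol (B : EuclideanSpace ℝ (Fin d) →ₗ[ℝ] F) : ℝ :=
  Real.sqrt (Matrix.of fun i j : Fin d =>
    inner ℝ (B (EuclideanSpace.single i 1)) (B (EuclideanSpace.single j 1))).det

/-- In orthonormal coordinates on `F` the Gram matrix is `mᵀ m`, with `m` the matrix of `O ∘ B`. -/
theorem gramVol_eq_abs_det (B : EuclideanSpace ℝ (Fin d) →ₗ[ℝ] F)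
    (O : F ≃ₗᵢ[ℝ] EuclideanSpace ℝ (Fin d)) :
    gramVol B = |LinearMap.det (O.toLinearEquiv.toLinearMap ∘ₗ B)| := by
  set A := O.toLinearEquiv.toLinearMap ∘ₗ B with hA
  set b := (EuclideanSpace.basisFun (Fin d) ℝ).toBasis with hb
  set m := LinearMap.toMatrix b b A with hm
  have hgram : (Matrix.of fun i j : Fin d =>
      inner ℝ (B (EuclideanSpace.single i 1)) (B (EuclideanSpace.single j 1))) = m.transpose * m := by
    ext i j
    have h1 : inner ℝ (B (EuclideanSpace.single i 1)) (B (EuclideanSpace.single j 1)) =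
        inner ℝ (A (EuclideanSpace.single i 1)) (A (EuclideanSpace.single j 1)) := by
      simp only [hA, LinearMap.comp_apply]
      exact (O.inner_map_map _ _).symm
    rw [Matrix.of_apply, h1, Matrix.mul_apply, PiLp.inner_apply]
    refine Finset.sum_congr rfl fun k _ => ?_
    simp [hm, hb, LinearMap.toMatrix_apply, mul_comm]
  rw [gramVol, hgram, Matrix.det_mul, Matrix.det_transpose, hm, LinearMap.det_toMatrix,
    Real.sqrt_mul_self_eq_abs]

/-- An isometry of a `d`-dimensional inner product space with the Euclidean space. -/
def euclideanIsometry (F : Type*) [NormedAddCommGroup F] [InnerProductSpace ℝ F]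
    [FiniteDimensional ℝ F] (h : Module.finrank ℝ F = d) : F ≃ₗᵢ[ℝ] EuclideanSpace ℝ (Fin d) :=
  (stdOrthonormalBasis ℝ F).repr.trans
    (LinearIsometryEquiv.piLpCongrLeft 2 ℝ ℝ (finCongr h))

/-- If `A` is invertible, `A' = Q A` where `Q` maps the unit ball into the ball of radius `c`, and
volumes give `|det Q| ≤ c ^ d`. If `A` is singular, its kernel lies in that of `A'`. Thus a
comparison of norms alone gives a comparison of volume densities. -/
theorem abs_det_le_of_norm_le (hd : 0 < d)
    (A A' : EuclideanSpace ℝ (Fin d) →ₗ[ℝ] EuclideanSpace ℝ (Fin d)) {c : ℝ} (hc : 0 ≤ c)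
    (h : ∀ v, ‖A' v‖ ≤ c * ‖A v‖) : |LinearMap.det A'| ≤ c ^ d * |LinearMap.det A| := by
  have : Nonempty (Fin d) := ⟨⟨0, hd⟩⟩
  by_cases h0 : LinearMap.det A = 0
  · obtain ⟨v, hv, hv0⟩ : ∃ v ∈ LinearMap.ker A, v ≠ 0 :=
      (Submodule.ne_bot_iff _).1 (LinearMap.bot_lt_ker_of_det_eq_zero h0).ne'
    have hv' : A' v = 0 := by
      have := h v
      rw [LinearMap.mem_ker.1 hv, norm_zero, mul_zero] at this
      exact norm_le_zero_iff.1 this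
    have : LinearMap.det A' = 0 := by
      by_contra hne
      exact hv0 ((LinearEquiv.ofIsUnitDet (v := (EuclideanSpace.basisFun (Fin d) ℝ).toBasis)
        (v' := (EuclideanSpace.basisFun (Fin d) ℝ).toBasis) (f := A') (by
          rw [LinearMap.det_toMatrix]; exact isUnit_iff_ne_zero.2 hne)).injective (by
            simpa using hv'))
    rw [this, abs_zero]; positivity
  · set e : EuclideanSpace ℝ (Fin d) ≃ₗ[ℝ] EuclideanSpace ℝ (Fin d) :=
      LinearEquiv.ofIsUnitDet (v := (EuclideanSpace.basisFun (Fin d) ℝ).toBasis)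
        (v' := (EuclideanSpace.basisFun (Fin d) ℝ).toBasis) (f := A) (by
          rw [LinearMap.det_toMatrix]; exact isUnit_iff_ne_zero.2 h0) with he
    have heA : ∀ v, A (e.symm v) = v := fun v => e.apply_symm_apply v
    set Q := A' ∘ₗ e.symm.toLinearMap with hQ
    have hQA : A' = Q ∘ₗ A := by
      ext1 v
      have : e.symm (A v) = v := e.symm_apply_apply v
      simp [hQ, this]
    have hQn : ∀ v, ‖Q v‖ ≤ c * ‖v‖ := fun v => by
      have := h (e.symm v); rwa [heA] at this
    have hsub : Q '' Metric.closedBall 0 1 ⊆ Metric.closedBall 0 c := by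
      rintro _ ⟨v, hv, rfl⟩
      rw [mem_closedBall_zero_iff] at hv ⊢
      exact (hQn v).trans (mul_le_of_le_one_right hc hv)
    have hvol := measure_mono (μ := (volume : Measure (EuclideanSpace ℝ (Fin d)))) hsub
    rw [Measure.addHaar_image_linearMap, Measure.addHaar_closedBall _ _ hc,
      Measure.addHaar_closedBall _ _ zero_le_one] at hvol
    simp only [one_pow, ENNReal.ofReal_one, one_mul, finrank_euclideanSpace, Fintype.card_fin]
      at hvol
    have hpos := (Metric.measure_ball_pos (volume : Measure (EuclideanSpace ℝ (Fin d))) 0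
      one_pos).ne'
    have hfin := (measure_ball_lt_top (μ := (volume : Measure (EuclideanSpace ℝ (Fin d))))
      (x := 0) (r := 1)).ne
    rw [ENNReal.mul_le_mul_iff_left hpos hfin,
      ENNReal.ofReal_le_ofReal_iff (by positivity)] at hvol
    rw [hQA, LinearMap.det_comp, abs_mul]
    gcongr

variable [FiniteDimensional ℝ F] [FiniteDimensional ℝ F']

theorem gramVol_le_of_norm_le (hd : 0 < d) (hF : Module.finrank ℝ F = d)
    (hF' : Module.finrank ℝ F' = d) (B : EuclideanSpace ℝ (Fin d) →ₗ[ℝ] F)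
    (B' : EuclideanSpace ℝ (Fin d) →ₗ[ℝ] F') {c : ℝ} (hc : 0 ≤ c)
    (h : ∀ v, ‖B' v‖ ≤ c * ‖B v‖) : gramVol B' ≤ c ^ d * gramVol B := by
  rw [gramVol_eq_abs_det B (euclideanIsometry F hF),
    gramVol_eq_abs_det B' (euclideanIsometry F' hF')]
  refine abs_det_le_of_norm_le hd _ _ hc fun v => ?_
  simpa using h v

theorem gramVol_comp (hF : Module.finrank ℝ F = d) (B : EuclideanSpace ℝ (Fin d) →ₗ[ℝ] F)
    (J : EuclideanSpace ℝ (Fin d) →ₗ[ℝ] EuclideanSpace ℝ (Fin d)) :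
    gramVol (B ∘ₗ J) = |LinearMap.det J| * gramVol B := by
  rw [gramVol_eq_abs_det _ (euclideanIsometry F hF), gramVol_eq_abs_det _ (euclideanIsometry F hF),
    ← LinearMap.comp_assoc, LinearMap.det_comp, abs_mul, mul_comm]

/-- The volume of an ellipsoid `{v | ‖B (v - a)‖ ≤ r}`. -/
theorem gramVol_mul_volume_ellipsoid (hF : Module.finrank ℝ F = d)
    (B : EuclideanSpace ℝ (Fin d) ≃ₗ[ℝ] F) (a : EuclideanSpace ℝ (Fin d)) (r : ℝ) :
    ENNReal.ofReal (gramVol B.toLinearMap) * volume {v | ‖B (v - a)‖ ≤ r} =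
      volume (Metric.closedBall (0 : EuclideanSpace ℝ (Fin d)) r) := by
  set O := euclideanIsometry F hF
  rw [gramVol_eq_abs_det _ O, ← Measure.addHaar_image_linearMap]
  set A := B.trans O.toLinearEquiv with hA
  have hset : (O.toLinearEquiv.toLinearMap ∘ₗ B.toLinearMap) '' {v | ‖B (v - a)‖ ≤ r} =
      Metric.closedBall (A a) r := by
    ext w
    simp only [Set.mem_image, Metric.mem_closedBall, dist_eq_norm]
    constructor
    · rintro ⟨v, hv, rfl⟩
      have : O.toLinearEquiv.toLinearMap (B v) - A a = O (B (v - a)) := by simp [hA]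
      simp only [LinearMap.comp_apply, LinearEquiv.coe_coe] at this ⊢
      rw [this, O.norm_map]
      exact hv
    · intro hw
      refine ⟨A.symm w, ?_, A.apply_symm_apply w⟩
      have : O (B (A.symm w - a)) = w - A a := by
        rw [← A.apply_symm_apply w]; simp [hA]
      change ‖B (A.symm w - a)‖ ≤ r
      rwa [← O.norm_map, this]
  rw [hset, Measure.addHaar_closedBall_center]

end GramDeterminant

/-! ### Chart frames and comparison of geodesic with frozen-metric distance -/

section RiemannianGeometry

variable {d : ℕ} {M : Type*}

section Frame

variable [TopologicalSpace M] [ChartedSpace (EuclideanSpace ℝ (Fin d)) M]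

instance tangentSpace_finiteDimensional (p : M) : FiniteDimensional ℝ (TangentSpace (𝓡 d) p) :=
  inferInstanceAs (FiniteDimensional ℝ (EuclideanSpace ℝ (Fin d)))

theorem finrank_tangentSpace (p : M) : Module.finrank ℝ (TangentSpace (𝓡 d) p) = d :=
  (finrank_euclideanSpace (𝕜 := ℝ) (ι := Fin d)).trans (Fintype.card_fin d)

variable [IsManifold (𝓡 d) ∞ M]

/-- The frame of `T_y M` given by the chart around `p`, as a map from the coordinate space. -/
def chartFrame (p y : M) : EuclideanSpace ℝ (Fin d) →L[ℝ] TangentSpace (𝓡 d) y :=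
  (trivializationAt (EuclideanSpace ℝ (Fin d)) (TangentSpace (𝓡 d)) p).symmL ℝ y

/-- The coordinates in the chart around `p` of a tangent vector at `y`. -/
def chartCoords (p y : M) : TangentSpace (𝓡 d) y →L[ℝ] EuclideanSpace ℝ (Fin d) :=
  (trivializationAt (EuclideanSpace ℝ (Fin d)) (TangentSpace (𝓡 d)) p).continuousLinearMapAt ℝ y

theorem chartCoords_chartFrame {p y : M} (hy : y ∈ (chartAt (EuclideanSpace ℝ (Fin d)) p).source)
    (v : EuclideanSpace ℝ (Fin d)) : chartCoords p y (chartFrame p y v) = v :=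
  Trivialization.continuousLinearMapAt_symmL _ (by simpa using hy) v

theorem chartFrame_chartCoords {p y : M} (hy : y ∈ (chartAt (EuclideanSpace ℝ (Fin d)) p).source)
    (v : TangentSpace (𝓡 d) y) : chartFrame p y (chartCoords p y v) = v :=
  Trivialization.symmL_continuousLinearMapAt _ (by simpa using hy) v

/-- The frame of the chart around `p`, as an equivalence. -/
def chartFrameEquiv {p y : M} (hy : y ∈ (chartAt (EuclideanSpace ℝ (Fin d)) p).source) :
    EuclideanSpace ℝ (Fin d) ≃ₗ[ℝ] TangentSpace (𝓡 d) y :=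
  LinearEquiv.ofLinearMap (chartFrame p y).toLinearMap (chartCoords p y).toLinearMap
    (LinearMap.ext (chartFrame_chartCoords hy)) (LinearMap.ext (chartCoords_chartFrame hy))

theorem mfderiv_chartAt_eq_chartCoords {p y : M}
    (hy : y ∈ (chartAt (EuclideanSpace ℝ (Fin d)) p).source) :
    mfderiv (𝓡 d) (𝓡 d) (chartAt (EuclideanSpace ℝ (Fin d)) p) y = chartCoords p y :=
  (TangentBundle.continuousLinearMapAt_trivializationAt (I := 𝓡 d) hy).symm

theorem mfderiv_chartAt_symm_eq_chartFrame {p : M} {u : EuclideanSpace ℝ (Fin d)}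
    (hu : u ∈ (chartAt (EuclideanSpace ℝ (Fin d)) p).target) :
    mfderiv (𝓡 d) (𝓡 d) (chartAt (EuclideanSpace ℝ (Fin d)) p).symm u =
      chartFrame p ((chartAt (EuclideanSpace ℝ (Fin d)) p).symm u) := by
  have h := TangentBundle.symmL_trivializationAt (I := 𝓡 d)
    ((chartAt (EuclideanSpace ℝ (Fin d)) p).map_target hu)
  have hu' : (extChartAt (𝓡 d) p) ((chartAt (EuclideanSpace ℝ (Fin d)) p).symm u) = u := by
    simp [hu]
  rw [hu'] at h
  have hr : Set.range (𝓡 d) = Set.univ := by simp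
  rw [hr, mfderivWithin_univ] at h
  exact h.symm

end Frame

section Distance

theorem isContinuousRiemannianBundle_tangent [TopologicalSpace M]
    [ChartedSpace (EuclideanSpace ℝ (Fin d)) M] [IsManifold (𝓡 d) ∞ M]
    [RiemannianBundle (fun x : M => TangentSpace (𝓡 d) x)]
    [h : IsContMDiffRiemannianBundle (𝓡 d) ∞ (EuclideanSpace ℝ (Fin d))
      (fun x : M => TangentSpace (𝓡 d) x)] :
    IsContinuousRiemannianBundle (EuclideanSpace ℝ (Fin d))
      (fun x : M => TangentSpace (𝓡 d) x) := by
  obtain ⟨g, hg, hg'⟩ := h.exists_contMDiff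
  exact ⟨g, hg.continuous, hg'⟩

variable [EMetricSpace M] [ChartedSpace (EuclideanSpace ℝ (Fin d)) M] [IsManifold (𝓡 d) ∞ M]
  [RiemannianBundle (fun x : M => TangentSpace (𝓡 d) x)]

/-- The chart around `p` distorts the metric by at most a factor `κ` between `p` and `y`. -/
structure NearIsometric (κ : ℝ) (p y : M) : Prop where
  mem_source : y ∈ (chartAt (EuclideanSpace ℝ (Fin d)) p).source
  coords_le : ∀ w : TangentSpace (𝓡 d) y, ‖chartFrame p p (chartCoords p y w)‖ ≤ κ * ‖w‖
  frame_le : ∀ v : EuclideanSpace ℝ (Fin d), ‖chartFrame p y v‖ ≤ κ * ‖chartFrame p p v‖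

theorem NearIsometric.le_frame {κ : ℝ} {p y : M} (h : NearIsometric (d := d) κ p y)
    (v : EuclideanSpace ℝ (Fin d)) : ‖chartFrame p p v‖ ≤ κ * ‖chartFrame p y v‖ := by
  simpa [chartCoords_chartFrame h.mem_source] using h.coords_le (chartFrame p y v)

/-- An almost shortest curve from `z` to `y` stays in the `R`-ball around `z`, where the chart
distorts lengths by at most `κ`. Its image in the chart is at least as long as the straight segment
in the metric frozen at `p`. -/
theorem chartFrame_norm_le_edist [IsRiemannianManifold (𝓡 d) M] {p z y : M} {κ : ℝ} (hκ : 0 < κ) {R : ℝ≥0∞}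
    (hnear : ∀ q, edist z q < R → NearIsometric (d := d) κ p q) (hy : edist z y < R) :
    ENNReal.ofReal ‖chartFrame p p (chartAt (EuclideanSpace ℝ (Fin d)) p y -
      chartAt (EuclideanSpace ℝ (Fin d)) p z)‖ ≤ ENNReal.ofReal κ * edist z y := by
  set φ := chartAt (EuclideanSpace ℝ (Fin d)) p with hφ
  -- The frozen norm is realised as a Euclidean norm after a fixed linear map, so that the mean
  -- value inequality applies to a curve in one normed space.
  let A := (euclideanIsometry (TangentSpace (𝓡 d) p)
    (finrank_tangentSpace p)).toContinuousLinearEquiv.toContinuousLinearMap ∘L chartFrame p p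
  have hA : ∀ v, ‖A v‖ = ‖chartFrame p p v‖ := fun v =>
    (euclideanIsometry (TangentSpace (𝓡 d) p) (finrank_tangentSpace p)).norm_map _
  rw [← hA]
  have key : ∀ r, edist z y < r → r < R →
      ENNReal.ofReal ‖A (φ y - φ z)‖ ≤ ENNReal.ofReal κ * r := by
    intro r hr hrR
    rw [IsRiemannianManifold.out (I := 𝓡 d)] at hr
    obtain ⟨γ, hγ0, hγ1, γ_smooth, hγ⟩ := exists_lt_of_riemannianEDist_lt hr
    -- Each initial piece of `γ` is no longer than `γ`, hence shorter than `R`.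
    have hγnear : ∀ t ∈ Set.Icc (0 : ℝ) 1, NearIsometric (d := d) κ p (γ t) := by
      intro t ht
      refine hnear _ (lt_of_le_of_lt ?_ (hγ.trans hrR))
      rw [IsRiemannianManifold.out (I := 𝓡 d)]
      exact (riemannianEDist_le_pathELength (γ_smooth.mono (Set.Icc_subset_Icc_right ht.2))
        hγ0 rfl ht.1).trans (pathELength_mono le_rfl ht.2)
    have hφγ : ContMDiffOn 𝓘(ℝ, ℝ) (𝓡 d) 1 (φ ∘ γ) (Set.Icc 0 1) :=
      (contMDiffOn_chart (I := 𝓡 d) (n := 1)).comp γ_smooth fun t ht => (hγnear t ht).mem_source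
    have hφγ' : ContDiffOn ℝ 1 (φ ∘ γ) (Set.Icc 0 1) := contMDiffOn_iff_contDiffOn.1 hφγ
    have hAφγ : ContDiffOn ℝ 1 (A ∘ φ ∘ γ) (Set.Icc 0 1) := A.contDiff.comp_contDiffOn hφγ'
    have hstart := enorm_sub_le_lintegral_derivWithin_Icc_of_contDiffOn_Icc hAφγ zero_le_one
    calc ENNReal.ofReal ‖A (φ y - φ z)‖
        = ‖(A ∘ φ ∘ γ) 1 - (A ∘ φ ∘ γ) 0‖ₑ := by
          rw [ofReal_norm]; simp [hγ0, hγ1]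
      _ ≤ _ := hstart
      _ ≤ ∫⁻ t in Set.Icc (0 : ℝ) 1, ENNReal.ofReal κ *
            ‖mfderivWithin 𝓘(ℝ, ℝ) (𝓡 d) γ (Set.Icc 0 1) t 1‖ₑ := by
          refine setLIntegral_mono' measurableSet_Icc fun t ht => ?_
          have hcomp : mfderivWithin 𝓘(ℝ, ℝ) (𝓡 d) (φ ∘ γ) (Set.Icc 0 1) t =
              (mfderiv (𝓡 d) (𝓡 d) φ (γ t)) ∘L
                (mfderivWithin 𝓘(ℝ, ℝ) (𝓡 d) γ (Set.Icc 0 1) t) := by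
            apply mfderiv_comp_mfderivWithin
            · exact ((contMDiffOn_chart (I := 𝓡 d) (n := 1) (x := p)).contMDiffAt
                (φ.open_source.mem_nhds (hγnear t ht).mem_source)).mdifferentiableAt one_ne_zero
            · exact γ_smooth.mdifferentiableOn one_ne_zero t ht
            · rw [uniqueMDiffWithinAt_iff_uniqueDiffWithinAt]
              exact uniqueDiffOn_Icc zero_lt_one t ht
          have hd1 : derivWithin (φ ∘ γ) (Set.Icc 0 1) t = chartCoords p (γ t)
              (mfderivWithin 𝓘(ℝ, ℝ) (𝓡 d) γ (Set.Icc 0 1) t 1) := by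
            rw [← fderivWithin_derivWithin, ← mfderivWithin_eq_fderivWithin, hcomp,
              mfderiv_chartAt_eq_chartCoords (hγnear t ht).mem_source]
            rfl
          have hd2 : derivWithin (A ∘ φ ∘ γ) (Set.Icc 0 1) t =
              A (derivWithin (φ ∘ γ) (Set.Icc 0 1) t) :=
            (A.hasFDerivAt.comp_hasDerivWithinAt t
              ((hφγ'.differentiableOn one_ne_zero t ht).hasDerivWithinAt)).derivWithin
                (uniqueDiffOn_Icc zero_lt_one t ht)
          rw [hd2, hd1, ← ofReal_norm, hA, ← ofReal_norm, ← ENNReal.ofReal_mul hκ.le]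
          exact ENNReal.ofReal_le_ofReal ((hγnear t ht).coords_le _)
      _ = ENNReal.ofReal κ * pathELength (𝓡 d) γ 0 1 := by
          rw [lintegral_const_mul' _ _ ENNReal.ofReal_ne_top,
            pathELength_eq_lintegral_mfderivWithin_Icc]
      _ ≤ ENNReal.ofReal κ * r := by gcongr
  have hκ0 : ENNReal.ofReal κ ≠ 0 := by simpa using hκ
  rw [← ENNReal.div_le_iff' hκ0 ENNReal.ofReal_ne_top]
  refine le_of_forall_gt_imp_ge_of_dense fun r hr => ?_
  rw [ENNReal.div_le_iff' hκ0 ENNReal.ofReal_ne_top]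
  obtain ⟨r', h1, h2⟩ := exists_between (lt_min hr hy)
  exact (key r' h1 (h2.trans_le (min_le_right _ _))).trans
    (by gcongr; exact h2.le.trans (min_le_left _ _))

variable [IsContMDiffRiemannianBundle (𝓡 d) ∞ (EuclideanSpace ℝ (Fin d))
  (fun x : M => TangentSpace (𝓡 d) x)]

theorem eventually_nearIsometric (p : M) {κ : ℝ} (hκ : 1 < κ) :
    ∀ᶠ y in 𝓝 p, NearIsometric (d := d) κ p y := by
  have := isContinuousRiemannianBundle_tangent (d := d) (M := M)
  filter_upwards [eventually_norm_symmL_trivializationAt_self_comp_lt (EuclideanSpace ℝ (Fin d))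
      (fun x : M => TangentSpace (𝓡 d) x) p hκ,
    eventually_norm_symmL_trivializationAt_comp_self_lt (EuclideanSpace ℝ (Fin d))
      (fun x : M => TangentSpace (𝓡 d) x) p hκ,
    chart_source_mem_nhds (EuclideanSpace ℝ (Fin d)) p] with y h1 h2 h3
  have h1' : ∀ w : TangentSpace (𝓡 d) y, ‖chartFrame p p (chartCoords p y w)‖ ≤ κ * ‖w‖ :=
    fun w => ContinuousLinearMap.le_of_opNorm_le _ h1.le w
  have h2' : ∀ w : TangentSpace (𝓡 d) p, ‖chartFrame p y (chartCoords p p w)‖ ≤ κ * ‖w‖ :=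
    fun w => ContinuousLinearMap.le_of_opNorm_le _ h2.le w
  refine ⟨h3, h1', fun v => ?_⟩
  have h := h2' (chartFrame p p v)
  rwa [chartCoords_chartFrame (mem_chart_source _ p) v] at h

variable [IsRiemannianManifold (𝓡 d) M]

/-- The straight segment between two points of a coordinate ball is an admissible curve, and its
length is at most `κ` times its frozen length. -/
theorem eventually_edist_le_chartFrame (p : M) {κ : ℝ} (hκ : 1 < κ) :
    ∃ V ∈ 𝓝 (chartAt (EuclideanSpace ℝ (Fin d)) p p),
      V ⊆ (chartAt (EuclideanSpace ℝ (Fin d)) p).target ∧ ∀ u ∈ V, ∀ v ∈ V,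
      edist ((chartAt (EuclideanSpace ℝ (Fin d)) p).symm u)
        ((chartAt (EuclideanSpace ℝ (Fin d)) p).symm v) ≤
      ENNReal.ofReal (κ * ‖chartFrame p p (v - u)‖) := by
  set φ := chartAt (EuclideanSpace ℝ (Fin d)) p with hφ
  have hp : p ∈ φ.source := mem_chart_source _ p
  have hnear : ∀ᶠ u in 𝓝 (φ p), u ∈ φ.target ∧ NearIsometric (d := d) κ p (φ.symm u) := by
    refine Eventually.and (φ.open_target.mem_nhds (φ.map_source hp)) ?_
    have := φ.continuousAt_symm (φ.map_source hp)
    rw [ContinuousAt, φ.left_inv hp] at this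
    exact this.eventually (eventually_nearIsometric p hκ)
  obtain ⟨r, hr, hball⟩ := Metric.mem_nhds_iff.1 hnear
  refine ⟨Metric.ball (φ p) r, Metric.ball_mem_nhds _ hr, fun u hu => (hball hu).1,
    fun u hu v hv => ?_⟩
  let η := ContinuousAffineMap.lineMap (R := ℝ) u v
  have hη : ∀ t ∈ Set.Icc (0 : ℝ) 1, η t ∈ Metric.ball (φ p) r := by
    intro t ht
    refine (convex_ball _ _).segment_subset hu hv ?_
    rw [segment_eq_image_lineMap]
    exact ⟨t, ht, by simp [η, ContinuousAffineMap.coe_lineMap_eq]⟩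
  have η_smooth : ContMDiffOn 𝓘(ℝ, ℝ) (𝓡 d) 1 η (Set.Icc 0 1) :=
    (contMDiff_iff_contDiff.2 (ContinuousAffineMap.contDiff _)).contMDiffOn
  have hsymm : ContMDiffOn (𝓡 d) (𝓡 d) 1 φ.symm φ.target := contMDiffOn_chart_symm
  have hlen : edist (φ.symm u) (φ.symm v) ≤ pathELength (𝓡 d) (φ.symm ∘ η) 0 1 := by
    rw [IsRiemannianManifold.out (I := 𝓡 d)]
    refine riemannianEDist_le_pathELength
      (hsymm.comp η_smooth fun t ht => (hball (hη t ht)).1) ?_ ?_ zero_le_one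
    · simp [η, ContinuousAffineMap.coe_lineMap_eq]
    · simp [η, ContinuousAffineMap.coe_lineMap_eq]
  refine hlen.trans ?_
  rw [pathELength_eq_lintegral_mfderivWithin_Icc]
  calc _ ≤ ∫⁻ t in Set.Icc (0 : ℝ) 1, ENNReal.ofReal (κ * ‖chartFrame p p (v - u)‖) := by
        refine setLIntegral_mono' measurableSet_Icc fun t ht => ?_
        have hcomp : mfderivWithin 𝓘(ℝ, ℝ) (𝓡 d) (φ.symm ∘ η) (Set.Icc 0 1) t =
            (mfderiv (𝓡 d) (𝓡 d) φ.symm (η t)) ∘L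
              (mfderivWithin 𝓘(ℝ, ℝ) (𝓡 d) η (Set.Icc 0 1) t) := by
          apply mfderiv_comp_mfderivWithin
          · exact (hsymm.contMDiffAt
              (φ.open_target.mem_nhds (hball (hη t ht)).1)).mdifferentiableAt one_ne_zero
          · exact η_smooth.mdifferentiableOn one_ne_zero t ht
          · rw [uniqueMDiffWithinAt_iff_uniqueDiffWithinAt]
            exact uniqueDiffOn_Icc zero_lt_one t ht
        have hη' : mfderivWithin 𝓘(ℝ, ℝ) (𝓡 d) η (Set.Icc 0 1) t 1 = v - u := by
          rw [mfderivWithin_eq_fderivWithin, fderivWithin_eq_fderiv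
            (uniqueDiffOn_Icc zero_lt_one t ht) (ContinuousAffineMap.differentiableAt _)]
          exact (by simp : fderiv ℝ (ContinuousAffineMap.lineMap (R := ℝ) u v) t 1 = v - u)
        have hval : mfderivWithin 𝓘(ℝ, ℝ) (𝓡 d) (φ.symm ∘ η) (Set.Icc 0 1) t 1 =
            chartFrame p (φ.symm (η t)) (v - u) := by
          rw [hcomp, mfderiv_chartAt_symm_eq_chartFrame (hball (hη t ht)).1]
          exact congrArg (chartFrame p (φ.symm (η t))) hη'
        rw [hval]
        refine (ofReal_norm _).symm.le.trans
          (ENNReal.ofReal_le_ofReal ((hball (hη t ht)).2.frame_le _))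
    _ = _ := by simp

end Distance

end RiemannianGeometry

/-! ### The Riemannian volume in a chart -/

section RiemannianVolumeMeasure

variable {d : ℕ} {M : Type*} [TopologicalSpace M] [ChartedSpace (EuclideanSpace ℝ (Fin d)) M]

section

variable [MeasurableSpace M] [BorelSpace M]

theorem measurableSet_chartAt_image {p : M} {S : Set M} (hS : MeasurableSet S)
    (hSp : S ⊆ (chartAt (EuclideanSpace ℝ (Fin d)) p).source) :
    MeasurableSet (chartAt (EuclideanSpace ℝ (Fin d)) p '' S) := by
  set φ := chartAt (EuclideanSpace ℝ (Fin d)) p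
  rw [φ.image_eq_target_inter_inv_preimage hSp]
  have h : Measurable (φ.target.domRestrict φ.symm) :=
    (continuousOn_iff_continuous_domRestrict.1 φ.continuousOn_symm).measurable
  convert φ.open_target.measurableSet.subtype_image (h hS) using 1
  ext u; simp [Set.domRestrict, and_comm]

theorem aemeasurable_chartAt_symm (p : M) (g : EuclideanSpace ℝ (Fin d) → ℝ≥0∞) :
    AEMeasurable (chartAt (EuclideanSpace ℝ (Fin d)) p).symm
      (((volume : Measure (EuclideanSpace ℝ (Fin d))).restrict
        (chartAt (EuclideanSpace ℝ (Fin d)) p).target).withDensity g) :=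
  ((chartAt (EuclideanSpace ℝ (Fin d)) p).continuousOn_symm.aemeasurable
    (chartAt (EuclideanSpace ℝ (Fin d)) p).open_target.measurableSet).mono_ac
      (withDensity_absolutelyContinuous _ _)

theorem chartVolume_compl_source [RiemannianBundle (fun x : M => TangentSpace (𝓡 d) x)] (p : M) :
    chartVolume d p (chartAt (EuclideanSpace ℝ (Fin d)) p).sourceᶜ = 0 := by
  set φ := chartAt (EuclideanSpace ℝ (Fin d)) p
  rw [chartVolume, Measure.map_apply_of_aemeasurable (aemeasurable_chartAt_symm p _)
    φ.open_source.measurableSet.compl]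
  refine withDensity_absolutelyContinuous _ _ ?_
  rw [Measure.restrict_apply' φ.open_target.measurableSet]
  convert measure_empty (μ := (volume : Measure (EuclideanSpace ℝ (Fin d))))
  ext u
  simp only [Set.mem_inter_iff, Set.mem_preimage, Set.mem_compl_iff, Set.mem_empty_iff_false,
    iff_false, not_and]
  exact fun h hu => h (φ.map_target hu)

end

variable [IsManifold (𝓡 d) ∞ M] [RiemannianBundle (fun x : M => TangentSpace (𝓡 d) x)]

/-- The density of the Riemannian volume at `y` in the chart around `p`. -/
def frameVol (d : ℕ) {M : Type*} [TopologicalSpace M] [ChartedSpace (EuclideanSpace ℝ (Fin d)) M]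
    [IsManifold (𝓡 d) ∞ M] [RiemannianBundle (fun x : M => TangentSpace (𝓡 d) x)] (p y : M) : ℝ :=
  gramVol (F := TangentSpace (𝓡 d) y) (chartFrame (d := d) p y).toLinearMap

theorem frameVol_eq_abs_det_mul {p q y : M}
    (hq : y ∈ (chartAt (EuclideanSpace ℝ (Fin d)) q).source) :
    frameVol d p y = |(chartCoords (d := d) q y ∘L chartFrame p y).det| * frameVol d q y := by
  have hcomp : (chartFrame (d := d) p y).toLinearMap = (chartFrame q y).toLinearMap ∘ₗ
      (chartCoords (d := d) q y ∘L chartFrame p y).toLinearMap :=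
    LinearMap.ext fun v => (chartFrame_chartCoords hq (chartFrame p y v)).symm
  have h := gramVol_comp (F := TangentSpace (𝓡 d) y) (finrank_tangentSpace y)
    (chartFrame (d := d) q y).toLinearMap
    (chartCoords (d := d) q y ∘L chartFrame p y).toLinearMap
  rw [← hcomp] at h
  exact h

theorem sqrt_det_metricMatrix {p : M} {u : EuclideanSpace ℝ (Fin d)}
    (hu : u ∈ (chartAt (EuclideanSpace ℝ (Fin d)) p).target) :
    Real.sqrt (metricMatrix p u).det =
      frameVol d p ((chartAt (EuclideanSpace ℝ (Fin d)) p).symm u) := by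
  unfold metricMatrix coordVec frameVol gramVol
  rw [mfderiv_chartAt_symm_eq_chartFrame hu]
  rfl

variable [MeasurableSpace M] [BorelSpace M]

theorem chartVolume_apply {p : M} {S : Set M} (hS : MeasurableSet S)
    (hSp : S ⊆ (chartAt (EuclideanSpace ℝ (Fin d)) p).source) :
    chartVolume d p S = ∫⁻ u in chartAt (EuclideanSpace ℝ (Fin d)) p '' S, ENNReal.ofReal
      (frameVol d p ((chartAt (EuclideanSpace ℝ (Fin d)) p).symm u)) := by
  rw [chartVolume, Measure.map_apply_of_aemeasurable (aemeasurable_chartAt_symm p _) hS,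
    withDensity_apply', Measure.restrict_restrict'
      (chartAt (EuclideanSpace ℝ (Fin d)) p).open_target.measurableSet, Set.inter_comm,
    ← (chartAt (EuclideanSpace ℝ (Fin d)) p).image_eq_target_inter_inv_preimage hSp]
  refine setLIntegral_congr_fun (measurableSet_chartAt_image hS hSp) ?_
  rintro _ ⟨y, hy, rfl⟩
  simp only
  rw [sqrt_det_metricMatrix ((chartAt (EuclideanSpace ℝ (Fin d)) p).map_source (hSp hy))]

/-- Change of variables along the transition map: its Jacobian is exactly the factor by which the
two densities differ. -/
theorem chartVolume_eq_chartVolume {p q : M} {S : Set M} (hS : MeasurableSet S)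
    (hSp : S ⊆ (chartAt (EuclideanSpace ℝ (Fin d)) p).source)
    (hSq : S ⊆ (chartAt (EuclideanSpace ℝ (Fin d)) q).source) :
    chartVolume d q S = chartVolume d p S := by
  rw [chartVolume_apply hS hSp, chartVolume_apply hS hSq]
  set φ := chartAt (EuclideanSpace ℝ (Fin d)) p with hφ
  set χ := chartAt (EuclideanSpace ℝ (Fin d)) q with hχ
  have himage : χ '' S = (χ ∘ φ.symm) '' (φ '' S) := by
    rw [Set.image_comp]
    exact congrArg _ (φ.symm_image_image_of_subset_source hSp).symm
  let J : EuclideanSpace ℝ (Fin d) → EuclideanSpace ℝ (Fin d) →L[ℝ] EuclideanSpace ℝ (Fin d) :=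
    fun u => chartCoords q (φ.symm u) ∘L chartFrame p (φ.symm u)
  have hJ : ∀ u ∈ φ '' S, HasFDerivWithinAt (χ ∘ φ.symm) (J u) (φ '' S) u := by
    rintro u ⟨y, hy, rfl⟩
    have hu : φ y ∈ φ.target := φ.map_source (hSp hy)
    have hyq : φ.symm (φ y) ∈ χ.source := by rw [φ.left_inv (hSp hy)]; exact hSq hy
    have h1 : HasMFDerivAt (𝓡 d) (𝓡 d) φ.symm (φ y) (chartFrame p (φ.symm (φ y))) := by
      rw [← mfderiv_chartAt_symm_eq_chartFrame hu]
      exact (((contMDiffOn_chart_symm (I := 𝓡 d) (n := 1) (x := p)).contMDiffAt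
        (φ.open_target.mem_nhds hu)).mdifferentiableAt one_ne_zero).hasMFDerivAt
    have h2 : HasMFDerivAt (𝓡 d) (𝓡 d) χ (φ.symm (φ y)) (chartCoords q (φ.symm (φ y))) := by
      rw [← mfderiv_chartAt_eq_chartCoords hyq]
      exact (((contMDiffOn_chart (I := 𝓡 d) (n := 1) (x := q)).contMDiffAt
        (χ.open_source.mem_nhds hyq)).mdifferentiableAt one_ne_zero).hasMFDerivAt
    exact (hasMFDerivAt_iff_hasFDerivAt.1 (h2.comp (φ y) h1)).hasFDerivWithinAt
  have hinj : Set.InjOn (χ ∘ φ.symm) (φ '' S) := by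
    rintro _ ⟨y, hy, rfl⟩ _ ⟨z, hz, rfl⟩ h
    simp only [Function.comp_apply, φ.left_inv (hSp hy), φ.left_inv (hSp hz)] at h
    rw [χ.injOn (hSq hy) (hSq hz) h]
  rw [himage, lintegral_image_eq_lintegral_abs_det_fderiv_mul volume
    (measurableSet_chartAt_image hS hSp) hJ hinj]
  refine setLIntegral_congr_fun (measurableSet_chartAt_image hS hSp) ?_
  rintro _ ⟨y, hy, rfl⟩
  have hz : χ.symm ((χ ∘ φ.symm) (φ y)) = φ.symm (φ y) := by
    simp [φ.left_inv (hSp hy), χ.left_inv (hSq hy)]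
  have hyq : φ.symm (φ y) ∈ χ.source := by rw [φ.left_inv (hSp hy)]; exact hSq hy
  simp only
  rw [hz, ← ENNReal.ofReal_mul (abs_nonneg _), frameVol_eq_abs_det_mul (p := p) hyq]

/-- A supremum of measures is hard to evaluate on a set, so it is bounded by one measure that
dominates every chart volume and equals that of `p` on the chart domain. -/
theorem riemannianVolume_eq_chartVolume {p : M} {S : Set M} (hS : MeasurableSet S)
    (hSp : S ⊆ (chartAt (EuclideanSpace ℝ (Fin d)) p).source) :
    riemannianVolume d M S = chartVolume d p S := by
  refine le_antisymm ?_ (Measure.le_iff'.1 (le_iSup (chartVolume d) p) S)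
  set U := (chartAt (EuclideanSpace ℝ (Fin d)) p).source with hU
  have hUm : MeasurableSet U :=
    (chartAt (EuclideanSpace ℝ (Fin d)) p).open_source.measurableSet
  -- Outside the domain of the chart at `p` nothing needs to be controlled, so the largest measure
  -- `⊤` is added there.
  have hle : riemannianVolume d M ≤ chartVolume d p + (⊤ : Measure M).restrict Uᶜ := by
    refine iSup_le fun q => Measure.le_iff.2 fun s hs => ?_
    set W := (chartAt (EuclideanSpace ℝ (Fin d)) q).source with hW
    have hWm : MeasurableSet W :=
      (chartAt (EuclideanSpace ℝ (Fin d)) q).open_source.measurableSet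
    rw [← measure_inter_add_sdiff s hUm, Measure.add_apply]
    refine add_le_add ?_ ?_
    · rw [← measure_inter_add_sdiff (s ∩ U) hWm,
        chartVolume_eq_chartVolume (p := p) ((hs.inter hUm).inter hWm)
          (fun x hx => hx.1.2) (fun x hx => hx.2),
        measure_mono_null (fun x (hx : x ∈ (s ∩ U) \ W) => (hx.2 : x ∈ Wᶜ))
          (chartVolume_compl_source q), add_zero]
      exact measure_mono fun x hx => hx.1.1
    · rw [Set.sdiff_eq, ← Measure.restrict_apply hs]
      exact Measure.le_iff'.1 (Measure.restrict_mono le_rfl le_top) s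
  refine (Measure.le_iff'.1 hle S).trans ?_
  rw [Measure.add_apply, Measure.restrict_apply hS,
    Set.disjoint_iff_inter_eq_empty.1 (Set.disjoint_compl_right_iff_subset.2 hSp), measure_empty,
    add_zero]

end RiemannianVolumeMeasure

/-! ### Volume of small balls near a point -/

section BallVolume

variable {d : ℕ} {M : Type*} [EMetricSpace M] [ChartedSpace (EuclideanSpace ℝ (Fin d)) M]
  [IsManifold (𝓡 d) ∞ M] [RiemannianBundle (fun x : M => TangentSpace (𝓡 d) x)]

theorem NearIsometric.frameVol_le (hd : 0 < d) {κ : ℝ} (hκ : 0 ≤ κ) {p y : M}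
    (h : NearIsometric (d := d) κ p y) : frameVol d p y ≤ κ ^ d * frameVol d p p :=
  gramVol_le_of_norm_le (F := TangentSpace (𝓡 d) p) (F' := TangentSpace (𝓡 d) y) hd
    (finrank_tangentSpace p) (finrank_tangentSpace y) (chartFrame p p).toLinearMap
    (chartFrame p y).toLinearMap hκ h.frame_le

theorem NearIsometric.le_frameVol (hd : 0 < d) {κ : ℝ} (hκ : 0 ≤ κ) {p y : M}
    (h : NearIsometric (d := d) κ p y) : frameVol d p p ≤ κ ^ d * frameVol d p y :=
  gramVol_le_of_norm_le (F := TangentSpace (𝓡 d) y) (F' := TangentSpace (𝓡 d) p) hd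
    (finrank_tangentSpace y) (finrank_tangentSpace p) (chartFrame p y).toLinearMap
    (chartFrame p p).toLinearMap hκ h.le_frame

theorem frameVol_self_mul_volume (p : M) (a : EuclideanSpace ℝ (Fin d)) (r : ℝ) :
    ENNReal.ofReal (frameVol d p p) * volume {v | ‖chartFrame p p (v - a)‖ ≤ r} =
      volume (Metric.closedBall (0 : EuclideanSpace ℝ (Fin d)) r) :=
  gramVol_mul_volume_ellipsoid (F := TangentSpace (𝓡 d) p) (finrank_tangentSpace p)
    (chartFrameEquiv (d := d) (mem_chart_source _ p)) a r

variable [IsContMDiffRiemannianBundle (𝓡 d) ∞ (EuclideanSpace ℝ (Fin d))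
    (fun x : M => TangentSpace (𝓡 d) x)] [IsRiemannianManifold (𝓡 d) M]
  [MeasurableSpace M] [BorelSpace M]

/-- In the chart at `p` the ball lies between the ellipsoids of the frozen metric with radii `r / κ`
and `κ * r`, and the volume density differs from its value at `p` by at most `κ ^ d`. Ellipsoids
weighted by that density have Euclidean ball volume. -/
theorem exists_nhds_volume_closedBall (hd : 0 < d) (p : M) {κ : ℝ} (hκ : 1 < κ) :
    ∃ V ∈ 𝓝 p, ∀ᶠ r in 𝓝[>] (0 : ℝ), ∀ z ∈ V,
      riemannianVolume d M {y | edist y z ≤ ENNReal.ofReal r} ≤ ENNReal.ofReal (κ ^ d) *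
        volume (Metric.closedBall (0 : EuclideanSpace ℝ (Fin d)) (κ * r)) ∧
      volume (Metric.closedBall (0 : EuclideanSpace ℝ (Fin d)) (r / κ)) ≤ ENNReal.ofReal (κ ^ d) *
        riemannianVolume d M {y | edist y z ≤ ENNReal.ofReal r} := by
  have hκ0 : 0 < κ := one_pos.trans hκ
  set φ := chartAt (EuclideanSpace ℝ (Fin d)) p with hφ
  have hp : p ∈ φ.source := mem_chart_source _ p
  obtain ⟨R, hR, hRnear⟩ := EMetric.mem_nhds_iff.1 (eventually_nearIsometric (d := d) p hκ)
  obtain ⟨V₀, hV₀, hV₀t, hV₀le⟩ := eventually_edist_le_chartFrame (d := d) p hκ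
  obtain ⟨ρ, hρ, hρV⟩ := Metric.mem_nhds_iff.1 hV₀
  have hR2 : 0 < R / 2 := ENNReal.half_pos hR.ne'
  set C := ‖chartCoords (d := d) p p‖ with hC
  -- The radii are halved so that small balls around every `z` in this neighbourhood, and ellipsoids
  -- around `φ z`, remain where the estimates at `p` hold.
  refine ⟨Metric.eball p (R / 2) ∩ φ ⁻¹' Metric.ball (φ p) (ρ / 2), inter_mem
    (Metric.eball_mem_nhds p hR2)
    ((φ.continuousAt hp).preimage_mem_nhds (Metric.ball_mem_nhds _ (half_pos hρ))), ?_⟩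
  have h1 : ∀ᶠ r in 𝓝[>] (0 : ℝ), ENNReal.ofReal r < R / 2 := by
    have : Tendsto ENNReal.ofReal (𝓝[>] (0 : ℝ)) (𝓝 (ENNReal.ofReal 0)) :=
      (ENNReal.continuous_ofReal.tendsto 0).mono_left nhdsWithin_le_nhds
    rw [ENNReal.ofReal_zero] at this
    exact this.eventually_lt_const hR2
  have h2 : ∀ᶠ r in 𝓝[>] (0 : ℝ), C * (r / κ) < ρ / 2 := by
    have : Tendsto (fun r : ℝ => C * (r / κ)) (𝓝[>] (0 : ℝ)) (𝓝 (C * (0 / κ))) :=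
      (Continuous.tendsto (by fun_prop) 0).mono_left nhdsWithin_le_nhds
    rw [zero_div, mul_zero] at this
    exact this.eventually_lt_const (half_pos hρ)
  filter_upwards [h1, h2, self_mem_nhdsWithin] with r hr1 hr2 hr0 z hz
  have hr0 : 0 < r := hr0
  have hnear : ∀ q, edist z q < R / 2 → NearIsometric (d := d) κ p q := fun q hq => by
    refine hRnear ?_
    rw [Metric.mem_eball]
    calc edist q p ≤ edist q z + edist z p := edist_triangle _ _ _
      _ < R / 2 + R / 2 := by
        rw [edist_comm q z]
        exact ENNReal.add_lt_add hq hz.1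
      _ = R := ENNReal.add_halves R
  set S : Set M := {y | edist y z ≤ ENNReal.ofReal r} with hS
  have hSnear : ∀ y ∈ S, NearIsometric (d := d) κ p y := fun y hy =>
    hnear y ((edist_comm z y).le.trans_lt (lt_of_le_of_lt hy hr1))
  have hSm : MeasurableSet S :=
    (isClosed_le (continuous_id.edist continuous_const) continuous_const).measurableSet
  have hSsub : S ⊆ φ.source := fun y hy => (hSnear y hy).mem_source
  have hzS : z ∈ S := by simp [hS]
  rw [riemannianVolume_eq_chartVolume hSm hSsub, chartVolume_apply hSm hSsub]
  have hSφm := measurableSet_chartAt_image hSm hSsub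
  rw [← frameVol_self_mul_volume p (φ z) (κ * r), ← frameVol_self_mul_volume p (φ z) (r / κ)]
  have hκd : (0 : ℝ) ≤ κ ^ d := by positivity
  constructor
  · calc _ ≤ ∫⁻ u in φ '' S, ENNReal.ofReal (κ ^ d * frameVol d p p) := by
          refine setLIntegral_mono' hSφm ?_
          rintro _ ⟨y, hy, rfl⟩
          refine ENNReal.ofReal_le_ofReal ?_
          rw [φ.left_inv (hSsub hy)]
          exact (hSnear y hy).frameVol_le hd hκ0.le
      _ = ENNReal.ofReal (κ ^ d) * (ENNReal.ofReal (frameVol d p p) * volume (φ '' S)) := by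
          rw [setLIntegral_const, ENNReal.ofReal_mul hκd, mul_assoc]
      _ ≤ _ := by
          gcongr
          rintro _ ⟨y, hy, rfl⟩
          have h := chartFrame_norm_le_edist (d := d) hκ0 hnear
            ((edist_comm z y).le.trans_lt (lt_of_le_of_lt hy hr1))
          have h' := h.trans (mul_le_mul_right ((edist_comm z y).le.trans hy) _)
          rw [← ENNReal.ofReal_mul hκ0.le, ENNReal.ofReal_le_ofReal_iff (by positivity)] at h'
          exact h'
  · have hsub : {v | ‖chartFrame p p (v - φ z)‖ ≤ r / κ} ⊆ φ '' S := by
      intro u hu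
      have hzV : φ z ∈ Metric.ball (φ p) ρ :=
        Metric.ball_subset_ball (half_le_self hρ.le) hz.2
      have hu' : ‖u - φ z‖ < ρ / 2 := by
        calc ‖u - φ z‖ = ‖chartCoords p p (chartFrame p p (u - φ z))‖ := by
              rw [chartCoords_chartFrame hp]
          _ ≤ C * ‖chartFrame p p (u - φ z)‖ := ContinuousLinearMap.le_opNorm _ _
          _ ≤ C * (r / κ) := by gcongr; exact hu
          _ < ρ / 2 := hr2
      have huV : u ∈ Metric.ball (φ p) ρ := by
        rw [Metric.mem_ball]
        calc dist u (φ p) ≤ dist u (φ z) + dist (φ z) (φ p) := dist_triangle _ _ _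
          _ < ρ / 2 + ρ / 2 := add_lt_add (by rwa [dist_eq_norm]) hz.2
          _ = ρ := add_halves ρ
      have h := hV₀le (φ z) (hρV hzV) u (hρV huV)
      rw [φ.left_inv (hSsub hzS)] at h
      refine ⟨φ.symm u, ?_, φ.right_inv (hV₀t (hρV huV))⟩
      refine (edist_comm _ _).le.trans (h.trans (ENNReal.ofReal_le_ofReal ?_))
      calc κ * ‖chartFrame p p (u - φ z)‖ ≤ κ * (r / κ) := by gcongr; exact hu
        _ = r := by field_simp
    calc _ ≤ ENNReal.ofReal (frameVol d p p) * volume (φ '' S) := by gcongr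
      _ = ∫⁻ u in φ '' S, ENNReal.ofReal (frameVol d p p) := by rw [setLIntegral_const]
      _ ≤ ∫⁻ u in φ '' S, ENNReal.ofReal (κ ^ d) *
            ENNReal.ofReal (frameVol d p (φ.symm u)) := by
          refine setLIntegral_mono' hSφm ?_
          rintro _ ⟨y, hy, rfl⟩
          rw [← ENNReal.ofReal_mul hκd, φ.left_inv (hSsub hy)]
          exact ENNReal.ofReal_le_ofReal ((hSnear y hy).le_frameVol hd hκ0.le)
      _ = _ := lintegral_const_mul' _ _ ENNReal.ofReal_ne_top

end BallVolume

/-! ### Uniform ball volumes, nets, and counts of design points -/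

section UniformBallVolume

/-- The volume of the Euclidean unit ball. -/
def unitBallVol (d : ℕ) : ℝ :=
  (volume : Measure (EuclideanSpace ℝ (Fin d))).real (Metric.closedBall 0 1)

theorem unitBallVol_pos (d : ℕ) : 0 < unitBallVol d :=
  ENNReal.toReal_pos (Metric.measure_closedBall_pos _ _ one_pos).ne' measure_closedBall_lt_top.ne

theorem volume_closedBall_zero {d : ℕ} {r : ℝ} (hr : 0 ≤ r) :
    volume (Metric.closedBall (0 : EuclideanSpace ℝ (Fin d)) r) =
      ENNReal.ofReal (unitBallVol d * r ^ d) := by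
  rw [Measure.addHaar_closedBall' _ _ hr, mul_comm, ENNReal.ofReal_mul (unitBallVol_pos d).le,
    unitBallVol, Measure.real, ENNReal.ofReal_toReal measure_closedBall_lt_top.ne]
  simp

theorem unitBallVol_eq {d : ℕ} (hd : 0 < d) : unitBallVol d = sphereVolume d / d := by
  have : Nonempty (Fin d) := ⟨⟨0, hd⟩⟩
  have hd' : (0 : ℝ) < d := by exact_mod_cast hd
  have hG : Real.Gamma ((d : ℝ) / 2 + 1) = (d : ℝ) / 2 * Real.Gamma ((d : ℝ) / 2) :=
    Real.Gamma_add_one (by positivity)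
  have hGpos : 0 < Real.Gamma ((d : ℝ) / 2) := Real.Gamma_pos_of_pos (by positivity)
  have hpi : Real.sqrt Real.pi ^ d = Real.pi ^ ((d : ℝ) / 2) := by
    rw [Real.sqrt_eq_rpow, ← Real.rpow_natCast, ← Real.rpow_mul Real.pi_pos.le]
    congr 1; ring
  rw [unitBallVol, Measure.real, EuclideanSpace.volume_closedBall, Fintype.card_fin, hG, hpi,
    ENNReal.ofReal_one, one_pow, one_mul, ENNReal.toReal_ofReal (by positivity), sphereVolume]
  field_simp

variable {d : ℕ} {M : Type*} [EMetricSpace M] [CompactSpace M]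
  [ChartedSpace (EuclideanSpace ℝ (Fin d)) M]
  [IsManifold (𝓡 d) ∞ M] [RiemannianBundle (fun x : M => TangentSpace (𝓡 d) x)]
  [IsContMDiffRiemannianBundle (𝓡 d) ∞ (EuclideanSpace ℝ (Fin d))
    (fun x : M => TangentSpace (𝓡 d) x)] [IsRiemannianManifold (𝓡 d) M]
  [MeasurableSpace M] [BorelSpace M]

/-- The local estimate is applied with `κ ^ (2d) < K`, one factor `κ ^ d` from the density and one
from the radius, and finitely many neighbourhoods cover `M`. -/
theorem eventually_forall_volume_closedBall (hd : 0 < d) {K : ℝ} (hK : 1 < K) :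
    ∀ᶠ r in 𝓝[>] (0 : ℝ), ∀ z : M,
      riemannianVolume d M {y | edist y z ≤ ENNReal.ofReal r} ≤
        ENNReal.ofReal (K * (unitBallVol d * r ^ d)) ∧
      ENNReal.ofReal (unitBallVol d * r ^ d) ≤ ENNReal.ofReal K *
        riemannianVolume d M {y | edist y z ≤ ENNReal.ofReal r} := by
  obtain ⟨κ, hκK, hκ⟩ : ∃ κ : ℝ, κ ^ d * κ ^ d < K ∧ 1 < κ := by
    have h : Tendsto (fun κ : ℝ => κ ^ d * κ ^ d) (𝓝[>] 1) (𝓝 (1 ^ d * 1 ^ d)) :=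
      (Continuous.tendsto (by fun_prop) 1).mono_left nhdsWithin_le_nhds
    rw [one_pow, one_mul] at h
    exact ((h.eventually_lt_const hK).and self_mem_nhdsWithin).exists
  have hκ0 : 0 < κ := one_pos.trans hκ
  suffices ∀ᶠ r in 𝓝[>] (0 : ℝ), ∀ z ∈ (Set.univ : Set M),
      riemannianVolume d M {y | edist y z ≤ ENNReal.ofReal r} ≤
        ENNReal.ofReal (K * (unitBallVol d * r ^ d)) ∧
      ENNReal.ofReal (unitBallVol d * r ^ d) ≤ ENNReal.ofReal K *
        riemannianVolume d M {y | edist y z ≤ ENNReal.ofReal r} by simpa using this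
  refine isCompact_univ.induction_on (p := fun s : Set M => ∀ᶠ r in 𝓝[>] (0 : ℝ), ∀ z ∈ s,
      riemannianVolume d M {y | edist y z ≤ ENNReal.ofReal r} ≤
        ENNReal.ofReal (K * (unitBallVol d * r ^ d)) ∧
      ENNReal.ofReal (unitBallVol d * r ^ d) ≤ ENNReal.ofReal K *
        riemannianVolume d M {y | edist y z ≤ ENNReal.ofReal r}) (by simp) ?_ ?_ ?_
  · exact fun s t hst ht => ht.mono fun r h z hz => h z (hst hz)
  · intro s t hs ht
    filter_upwards [hs, ht] with r h1 h2 z hz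
    exact hz.elim (h1 z) (h2 z)
  · intro p _
    obtain ⟨V, hV, hV'⟩ := exists_nhds_volume_closedBall hd p hκ
    refine ⟨V, mem_nhdsWithin_of_mem_nhds hV, ?_⟩
    filter_upwards [hV', self_mem_nhdsWithin] with r hr hr0 z hz
    have hr0 : 0 < r := hr0
    have hω := unitBallVol_pos d
    obtain ⟨h1, h2⟩ := hr z hz
    constructor
    · refine h1.trans ?_
      rw [volume_closedBall_zero (by positivity), ← ENNReal.ofReal_mul (by positivity)]
      refine ENNReal.ofReal_le_ofReal ?_
      calc κ ^ d * (unitBallVol d * (κ * r) ^ d)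
          = κ ^ d * κ ^ d * (unitBallVol d * r ^ d) := by rw [mul_pow]; ring
        _ ≤ _ := by gcongr
    · rw [volume_closedBall_zero (by positivity)] at h2
      calc ENNReal.ofReal (unitBallVol d * r ^ d)
          = ENNReal.ofReal (κ ^ d) * ENNReal.ofReal (unitBallVol d * (r / κ) ^ d) := by
            rw [← ENNReal.ofReal_mul (by positivity), div_pow]
            congr 1; field_simp
        _ ≤ ENNReal.ofReal (κ ^ d) * (ENNReal.ofReal (κ ^ d) * _) := by gcongr
        _ = ENNReal.ofReal (κ ^ d * κ ^ d) * _ := by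
            rw [← mul_assoc, ← ENNReal.ofReal_mul (by positivity)]
        _ ≤ _ := by gcongr

theorem isFiniteMeasure_riemannianVolume (hd : 0 < d) :
    IsFiniteMeasure (riemannianVolume d M) := by
  obtain ⟨r, hr, hr0⟩ := ((eventually_forall_volume_closedBall (M := M) hd one_lt_two).and
    self_mem_nhdsWithin).exists
  refine ⟨isCompact_univ.measure_lt_top_of_nhdsWithin fun p _ => ?_⟩
  refine ⟨{y | edist y p ≤ ENNReal.ofReal r}, mem_nhdsWithin_of_mem_nhds ?_,
    (hr p).1.trans_lt ENNReal.ofReal_lt_top⟩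
  exact Metric.closedEBall_mem_nhds p (ENNReal.ofReal_pos.2 hr0)

theorem eventually_forall_volumeReal_closedBall (hd : 0 < d) {K : ℝ} (hK : 1 < K) :
    ∀ᶠ r in 𝓝[>] (0 : ℝ), ∀ z : M,
      (riemannianVolume d M).real {y | edist y z ≤ ENNReal.ofReal r} ≤
        K * (unitBallVol d * r ^ d) ∧
      unitBallVol d * r ^ d ≤
        K * (riemannianVolume d M).real {y | edist y z ≤ ENNReal.ofReal r} := by
  have := isFiniteMeasure_riemannianVolume (M := M) hd
  filter_upwards [eventually_forall_volume_closedBall (M := M) hd hK, self_mem_nhdsWithin]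
    with r hr hr0 z
  have hr0 : 0 < r := hr0
  have hω := unitBallVol_pos d
  obtain ⟨h1, h2⟩ := hr z
  have hK0 : 0 < K := one_pos.trans hK
  refine ⟨ENNReal.toReal_le_of_le_ofReal (by positivity) h1, ?_⟩
  rw [← ofReal_measureReal, ← ENNReal.ofReal_mul hK0.le,
    ENNReal.ofReal_le_ofReal_iff (by positivity)] at h2
  exact h2

theorem riemannianVolume_real_univ_pos [Nonempty M] (hd : 0 < d) :
    0 < (riemannianVolume d M).real Set.univ := by
  have := isFiniteMeasure_riemannianVolume (M := M) hd
  obtain ⟨r, hr, hr0⟩ := ((eventually_forall_volumeReal_closedBall (M := M) hd one_lt_two).and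
    self_mem_nhdsWithin).exists
  have hr0 : 0 < r := hr0
  obtain ⟨z⟩ := ‹Nonempty M›
  have h1 := (hr z).2
  have h2 := measureReal_mono (μ := riemannianVolume d M)
    (Set.subset_univ {y | edist y z ≤ ENNReal.ofReal r})
  have h3 : 0 < unitBallVol d * r ^ d := mul_pos (unitBallVol_pos d) (by positivity)
  linarith

/-- Finite sets that are `s`-separated and `s`-dense, with about `s⁻ᵈ` points. -/
theorem exists_net (hd : 0 < d) [Nonempty M] : ∃ c > 0, ∃ C > 0, ∀ᶠ s in 𝓝[>] (0 : ℝ),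
    ∃ Z : Finset M, (∀ z ∈ Z, ∀ z' ∈ Z, z ≠ z' → ENNReal.ofReal s < edist z z') ∧
      (∀ y, ∃ z ∈ Z, edist y z ≤ ENNReal.ofReal s) ∧
      c ≤ Z.card * s ^ d ∧ Z.card * s ^ d ≤ C := by
  classical
  have := isFiniteMeasure_riemannianVolume (M := M) hd
  set μ := riemannianVolume d M
  have hV : 0 < μ.real Set.univ := riemannianVolume_real_univ_pos hd
  have hω := unitBallVol_pos d
  refine ⟨μ.real Set.univ / (2 * unitBallVol d), by positivity,
    2 * 2 ^ d * μ.real Set.univ / unitBallVol d, by positivity, ?_⟩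
  have hvol := eventually_forall_volumeReal_closedBall (M := M) hd one_lt_two
  have hhalf : Tendsto (fun s : ℝ => s / 2) (𝓝[>] 0) (𝓝[>] 0) := by
    refine tendsto_nhdsWithin_iff.2 ⟨?_, ?_⟩
    · have : Tendsto (fun s : ℝ => s / 2) (𝓝[>] 0) (𝓝 (0 / 2)) :=
        (Continuous.tendsto (by fun_prop) 0).mono_left nhdsWithin_le_nhds
      rwa [zero_div] at this
    · filter_upwards [self_mem_nhdsWithin] with s hs using half_pos (Set.mem_Ioi.1 hs)
  filter_upwards [hvol, hhalf.eventually hvol, self_mem_nhdsWithin] with s hs hs2 hs0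
  have hs0 : 0 < s := hs0
  have hm : ∀ (z : M) (r : ℝ), MeasurableSet {y | edist y z ≤ ENNReal.ofReal r} := fun z r =>
    (isClosed_le (continuous_id.edist continuous_const) continuous_const).measurableSet
  -- Balls of radius `s / 2` around separated points are disjoint, so their volumes add up to at
  -- most the total volume.
  have hcard : ∀ Z : Finset M, (∀ z ∈ Z, ∀ z' ∈ Z, z ≠ z' → ENNReal.ofReal s < edist z z') →
      Z.card * s ^ d ≤ 2 * 2 ^ d * μ.real Set.univ / unitBallVol d := by
    intro Z hZ
    have hdisj : (Z : Set M).PairwiseDisjoint fun z => {y | edist y z ≤ ENNReal.ofReal (s / 2)} := by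
      intro z hz z' hz' hne
      refine Set.disjoint_left.2 fun y hy hy' => (hZ z hz z' hz' hne).not_ge ?_
      calc edist z z' ≤ edist z y + edist y z' := edist_triangle _ _ _
        _ ≤ ENNReal.ofReal (s / 2) + ENNReal.ofReal (s / 2) :=
            add_le_add ((edist_comm z y).le.trans hy) hy'
        _ = ENNReal.ofReal s := by
            rw [← ENNReal.ofReal_add (by positivity) (by positivity), add_halves]
    have h1 := measureReal_biUnion_finset (μ := μ) hdisj fun z _ => hm z (s / 2)
    have h2 := measureReal_mono (μ := μ)
      (Set.subset_univ (⋃ z ∈ Z, {y | edist y z ≤ ENNReal.ofReal (s / 2)}))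
    have h3 : (Z.card : ℝ) * (unitBallVol d * (s / 2) ^ d) ≤ ∑ z ∈ Z,
        2 * μ.real {y | edist y z ≤ ENNReal.ofReal (s / 2)} := by
      rw [← nsmul_eq_mul]
      exact Finset.card_nsmul_le_sum _ _ _ fun z _ => (hs2 z).2
    rw [← Finset.mul_sum, ← h1] at h3
    rw [le_div_iff₀ hω]
    calc (Z.card : ℝ) * s ^ d * unitBallVol d
        = 2 ^ d * (Z.card * (unitBallVol d * (s / 2) ^ d)) := by
          rw [div_pow]; field_simp
      _ ≤ 2 ^ d * (2 * μ.real Set.univ) :=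
          mul_le_mul_of_nonneg_left (h3.trans (by gcongr)) (by positivity)
      _ = _ := by ring
  obtain ⟨Z, hZ, hcov⟩ : ∃ Z : Finset M,
      (∀ z ∈ Z, ∀ z' ∈ Z, z ≠ z' → ENNReal.ofReal s < edist z z') ∧
      (∀ y, ∃ z ∈ Z, edist y z ≤ ENNReal.ofReal s) := by
    -- If no separated set were dense, it could always be enlarged by an uncovered point, against
    -- the cardinality bound.
    by_contra! hcon
    have hall : ∀ k : ℕ, ∃ Z : Finset M,
        (∀ z ∈ Z, ∀ z' ∈ Z, z ≠ z' → ENNReal.ofReal s < edist z z') ∧ Z.card = k := by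
      intro k
      induction k with
      | zero => exact ⟨∅, by simp, rfl⟩
      | succ k ih =>
        obtain ⟨Z, hZ, rfl⟩ := ih
        obtain ⟨y, hy⟩ := hcon Z hZ
        have hyZ : y ∉ Z := fun h => by simpa using hy y h
        refine ⟨insert y Z, ?_, Finset.card_insert_of_notMem hyZ⟩
        intro z hz z' hz' hne
        rcases Finset.mem_insert.1 hz with rfl | hzZ <;>
          rcases Finset.mem_insert.1 hz' with rfl | hzZ'
        · exact absurd rfl hne
        · exact hy z' hzZ'
        · rw [edist_comm]; exact hy z hzZ
        · exact hZ z hzZ z' hzZ' hne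
    obtain ⟨k, hk⟩ := exists_nat_gt (2 * 2 ^ d * μ.real Set.univ / unitBallVol d / s ^ d)
    obtain ⟨Z, hZ, rfl⟩ := hall k
    rw [div_lt_iff₀ (by positivity)] at hk
    exact (hcard Z hZ).not_gt hk
  refine ⟨Z, hZ, hcov, ?_, hcard Z hZ⟩
  have h1 : μ.real Set.univ ≤ ∑ z ∈ Z, μ.real {y | edist y z ≤ ENNReal.ofReal s} := by
    refine (measureReal_mono (μ := μ) (fun y _ => ?_) (measure_ne_top _ _)).trans
      (measureReal_biUnion_finset_le Z fun z => {y | edist y z ≤ ENNReal.ofReal s})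
    obtain ⟨z, hz, hyz⟩ := hcov y
    exact Set.mem_biUnion (Finset.mem_coe.2 hz) hyz
  have h2 : ∑ z ∈ Z, μ.real {y | edist y z ≤ ENNReal.ofReal s} ≤
      (Z.card : ℝ) * (2 * (unitBallVol d * s ^ d)) := by
    rw [← nsmul_eq_mul]
    exact Finset.sum_le_card_nsmul _ _ _ fun z _ => (hs z).1
  rw [div_le_iff₀ (by positivity)]
  linarith

/-- The design condition compares counts with ball volumes; replacing these volumes by `ω (c r)^d`
leaves an explicit density, the only trace of the geometry in the later sums. -/
theorem IsAsympUniform.tendstoUniformly_ncard (hd : 0 < d) [Nonempty M]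
    {x : (n : ℕ) → Fin n → M} {r : ℕ → ℝ} (hx : IsAsympUniform d x r)
    (hr : Tendsto r atTop (𝓝[>] 0)) {c : ℝ} (hc : 0 < c) :
    TendstoUniformly
      (fun (n : ℕ) (z : M) =>
        ({i : Fin n | edist (x n i) z ≤ ENNReal.ofReal (c * r n)}.ncard : ℝ) / (n * r n ^ d))
      (fun _ => unitBallVol d / (riemannianVolume d M).real Set.univ * c ^ d) atTop := by
  set V := (riemannianVolume d M).real Set.univ with hVdef
  have hV : 0 < V := riemannianVolume_real_univ_pos hd
  have hω := unitBallVol_pos d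
  set A := unitBallVol d / V * c ^ d with hA
  have hApos : 0 < A := by positivity
  rw [Metric.tendstoUniformly_iff]
  intro ε hε
  -- The count and the volume each contribute a relative error `η`; for `η ≤ 1` together at most `3
  -- * η`.
  set η := min 1 (ε / (4 * A)) with hη
  have hη0 : 0 < η := by positivity
  have hη1 : η ≤ 1 := min_le_left _ _
  have hηε : η * (4 * A) ≤ ε := by
    rw [← le_div_iff₀ (by positivity)]; exact min_le_right _ _
  have hcr : Tendsto (fun n => c * r n) atTop (𝓝[>] 0) := by
    refine tendsto_nhdsWithin_iff.2 ⟨?_, ?_⟩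
    · simpa using (tendsto_nhdsWithin_iff.1 hr).1.const_mul c
    · filter_upwards [(tendsto_nhdsWithin_iff.1 hr).2] with n hn using mul_pos hc hn
  filter_upwards [Metric.tendstoUniformly_iff.1 (hx c hc) η hη0,
    hcr.eventually (eventually_forall_volumeReal_closedBall (M := M) hd
      (K := 1 + η) (by linarith)), (tendsto_nhdsWithin_iff.1 hr).2, eventually_gt_atTop 0]
    with n h1 h2 h3 hn z
  have h3 : 0 < r n := h3
  have hn' : (0 : ℝ) < n := by exact_mod_cast hn
  obtain ⟨h4, h5⟩ := h2 z
  have h1 := h1 z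
  set N := ({i : Fin n | edist (x n i) z ≤ ENNReal.ofReal (c * r n)}.ncard : ℝ)
  set v := (riemannianVolume d M).real {p : M | edist p z ≤ ENNReal.ofReal (c * r n)}
  set w := unitBallVol d * (c * r n) ^ d with hw
  have hwpos : 0 < w := by positivity
  have hv : 0 < v := by
    by_contra hcon
    have : (1 + η) * v ≤ 0 := mul_nonpos_of_nonneg_of_nonpos (by linarith) (not_lt.1 hcon)
    linarith
  set q := N / n / (v / V) with hq
  have hN : N / (n * r n ^ d) = q * (v / w) * A := by
    rw [hq, hw, hA, mul_pow]; field_simp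
  have hvw1 : v / w ≤ 1 + η := (div_le_iff₀ hwpos).2 h4
  have hvw2 : 1 ≤ (1 + η) * (v / w) := by
    rw [← mul_div_assoc, le_div_iff₀ hwpos, one_mul]; exact h5
  have hvw0 : 0 < v / w := by positivity
  rw [Real.dist_eq, abs_lt] at h1
  rw [hN, Real.dist_eq, show A - q * (v / w) * A = (1 - q * (v / w)) * A by ring, abs_mul,
    abs_of_pos hApos]
  have hb : |1 - q * (v / w)| ≤ 3 * η := by
    rw [abs_le]; constructor <;> nlinarith
  calc |1 - q * (v / w)| * A ≤ 3 * η * A := by gcongr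
    _ < η * (4 * A) := by nlinarith [mul_pos hη0 hApos]
    _ ≤ ε := hηε

end UniformBallVolume

/-! ### Sums of bumps over the design -/

section RadialSums

/-- The function `(1 - (t / r) ^ γ)₊` of a distance `t`. -/
def bump (γ r : ℝ) (t : ℝ≥0∞) : ℝ :=
  if t ≤ ENNReal.ofReal r then 1 - (t.toReal / r) ^ γ else 0

theorem measurable_bump (γ r : ℝ) : Measurable (bump γ r) := by
  unfold bump
  exact Measurable.ite measurableSet_Iic (by fun_prop) measurable_const

theorem sum_indicator_eq_ncard {ι : Type*} [Fintype ι] (p : ι → Prop) [DecidablePred p] :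
    ∑ i, (if p i then (1 : ℝ) else 0) = {i | p i}.ncard := by
  rw [Finset.sum_boole, Set.ncard_eq_toFinset_card']
  congr 2
  ext i; simp

/-- Layer-cake formula in discrete form: the bump is the average over levels `v ∈ (0, 1)` of the
indicator of the ball of radius `v^(1/γ) r`, here sampled at `v = k / N` with an error of at most
one level. -/
theorem bump_layers {γ r : ℝ} (hγ : 0 < γ) (hr : 0 < r) {N : ℕ} (hN : 0 < N) (t : ℝ≥0∞) :
    N * bump γ r t ≤ ∑ k ∈ Finset.Icc 1 N,
      (if t ≤ ENNReal.ofReal (((k : ℝ) / N) ^ (1 / γ) * r) then (1 : ℝ) else 0) ∧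
    ∑ k ∈ Finset.Icc 1 N,
      (if t ≤ ENNReal.ofReal (((k : ℝ) / N) ^ (1 / γ) * r) then (1 : ℝ) else 0) ≤
      N * bump γ r t + if t ≤ ENNReal.ofReal r then (1 : ℝ) else 0 := by
  have hN' : (0 : ℝ) < N := by exact_mod_cast hN
  by_cases ht : t ≤ ENNReal.ofReal r
  · have htop : t ≠ ⊤ := (ht.trans_lt ENNReal.ofReal_lt_top).ne
    set u := t.toReal with hu
    have hu0 : 0 ≤ u := ENNReal.toReal_nonneg
    have hur : u ≤ r := ENNReal.toReal_le_of_le_ofReal hr.le ht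
    set s := (u / r) ^ γ with hs
    have hs0 : 0 ≤ s := by positivity
    have hs1 : s ≤ 1 := Real.rpow_le_one (by positivity) ((div_le_one hr).2 hur) hγ.le
    have hiff : ∀ k : ℕ, t ≤ ENNReal.ofReal (((k : ℝ) / N) ^ (1 / γ) * r) ↔ ⌈s * N⌉₊ ≤ k := by
      intro k
      rw [Nat.ceil_le, ← le_div_iff₀ hN', ENNReal.le_ofReal_iff_toReal_le htop (by positivity),
        ← div_le_iff₀ hr, hs, one_div]
      exact Real.le_rpow_inv_iff_of_pos (by positivity) (by positivity) hγ
    simp only [hiff, bump, if_pos ht, Finset.sum_boole]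
    -- The maximum with `1` matters at `t = 0`, where the ceiling is `0` but levels start at `1`.
    have hfil : (Finset.Icc 1 N).filter (fun k => ⌈s * N⌉₊ ≤ k) =
        Finset.Icc (max 1 ⌈s * N⌉₊) N := by
      ext k; simp only [Finset.mem_filter, Finset.mem_Icc, max_le_iff]; tauto
    have hceil : ⌈s * N⌉₊ ≤ N := Nat.ceil_le.2 (by nlinarith)
    have h1 : s * N ≤ (⌈s * N⌉₊ : ℝ) := Nat.le_ceil _
    have h2 : (⌈s * N⌉₊ : ℝ) < s * N + 1 := Nat.ceil_lt_add_one (by positivity)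
    have hm1 : max 1 ⌈s * N⌉₊ ≤ N + 1 := by omega
    rw [hfil, Nat.card_Icc, Nat.cast_sub hm1]
    push_cast
    have hsN : 0 ≤ s * N := by positivity
    constructor
    · have : max (1 : ℝ) (⌈s * N⌉₊ : ℝ) ≤ s * N + 1 := max_le (by linarith) h2.le
      linarith
    · have : s * N ≤ max (1 : ℝ) (⌈s * N⌉₊ : ℝ) := h1.trans (le_max_right _ _)
      linarith
  · have hz : ∀ k ∈ Finset.Icc 1 N,
        (if t ≤ ENNReal.ofReal (((k : ℝ) / N) ^ (1 / γ) * r) then (1 : ℝ) else 0) = 0 := by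
      intro k hk
      refine if_neg fun h => ht (h.trans (ENNReal.ofReal_le_ofReal ?_))
      have hkN : ((k : ℝ) / N) ≤ 1 :=
        (div_le_one hN').2 (by exact_mod_cast (Finset.mem_Icc.1 hk).2)
      exact mul_le_of_le_one_left hr.le
        (Real.rpow_le_one (by positivity) hkN (by positivity))
    rw [Finset.sum_eq_zero hz]
    simp [bump, ht]

theorem riemann_sum_rpow {q : ℝ} (hq : 0 ≤ q) {N : ℕ} (hN : 0 < N) :
    1 / (q + 1) ≤ (∑ k ∈ Finset.Icc 1 N, ((k : ℝ) / N) ^ q) / N ∧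
    (∑ k ∈ Finset.Icc 1 N, ((k : ℝ) / N) ^ q) / N ≤ 1 / (q + 1) + 1 / N := by
  have hN' : (0 : ℝ) < N := by exact_mod_cast hN
  have hmono : MonotoneOn (fun t : ℝ => t ^ q) (Set.Icc (0 : ℝ) (0 + N)) :=
    fun a ha b _ hab => Real.rpow_le_rpow ha.1 hab hq
  have hintegral : ∫ t in (0 : ℝ)..(0 + N), t ^ q = (N : ℝ) ^ q * N / (q + 1) := by
    rw [zero_add, integral_rpow (Or.inl (by linarith)), Real.zero_rpow (by linarith), sub_zero,
      Real.rpow_add_one hN'.ne']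
  have h1 := hmono.integral_le_sum
  have h2 := hmono.sum_le_integral
  rw [hintegral] at h1 h2
  have hsum : ∑ k ∈ Finset.Icc 1 N, ((k : ℝ) / N) ^ q =
      (∑ i ∈ Finset.range N, (0 + ((i + 1 : ℕ) : ℝ)) ^ q) / (N : ℝ) ^ q := by
    rw [Finset.sum_div, Finset.range_eq_Ico,
      Finset.sum_Ico_add' (fun k : ℕ => (0 + (k : ℝ)) ^ q / (N : ℝ) ^ q) 0 N 1]
    refine Finset.sum_congr (by ext k; simp) fun k hk => ?_
    rw [zero_add, Real.div_rpow (by positivity) hN'.le]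
  have hstep : ∑ i ∈ Finset.range N, (0 + ((i + 1 : ℕ) : ℝ)) ^ q ≤
      ∑ i ∈ Finset.range N, (0 + (i : ℝ)) ^ q + (N : ℝ) ^ q := by
    have := Finset.sum_range_succ (fun i : ℕ => (0 + (i : ℝ)) ^ q) N
    rw [Finset.sum_range_succ'] at this
    have h0 : 0 ≤ (0 + ((0 : ℕ) : ℝ)) ^ q := by positivity
    rw [zero_add (N : ℝ)] at this
    linarith
  have hNq : 0 < (N : ℝ) ^ q := by positivity
  rw [hsum, div_div]
  constructor
  · rw [le_div_iff₀ (by positivity)]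
    calc 1 / (q + 1) * ((N : ℝ) ^ q * N) = (N : ℝ) ^ q * N / (q + 1) := by ring
      _ ≤ _ := h1
  · rw [div_le_iff₀ (by positivity)]
    calc _ ≤ _ := hstep
      _ ≤ (N : ℝ) ^ q * N / (q + 1) + (N : ℝ) ^ q := by gcongr
      _ = _ := by field_simp

/-- Bumps are averages of ball indicators with radii `v^(1/γ) c h`, so the limit is `a c^d` times
`∫₀¹ v^(d/γ) dv = γ/(d + γ)`. Only finitely many radii occur for given `N`, hence uniformity in `z`
survives. -/
theorem tendstoUniformly_sum_bump {M : Type*} [EMetricSpace M] {d : ℕ} {a : ℝ} (ha : 0 ≤ a)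
    {x : (n : ℕ) → Fin n → M} {h : ℕ → ℝ} (hh : ∀ᶠ n in atTop, 0 < h n)
    (hx : ∀ c : ℝ, 0 < c → TendstoUniformly
      (fun (n : ℕ) (z : M) =>
        ({i : Fin n | edist (x n i) z ≤ ENNReal.ofReal (c * h n)}.ncard : ℝ) / (n * h n ^ d))
      (fun _ => a * c ^ d) atTop)
    {γ c : ℝ} (hγ : 0 < γ) (hc : 0 < c) :
    TendstoUniformly
      (fun (n : ℕ) (z : M) => (∑ i, bump γ (c * h n) (edist (x n i) z)) / (n * h n ^ d))
      (fun _ => a * c ^ d * (γ / (d + γ))) atTop := by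
  rw [Metric.tendstoUniformly_iff]
  intro ε hε
  set A := a * c ^ d with hA
  have hA0 : 0 ≤ A := by positivity
  -- With `4 * A / ε < N` the discretisation error `A / N` is below `ε / 4`.
  obtain ⟨N, hNgt⟩ := exists_nat_gt (max 1 (4 * A / ε))
  have hN1 : (1 : ℝ) < N := (le_max_left _ _).trans_lt hNgt
  have hN0 : 0 < N := by exact_mod_cast one_pos.trans hN1
  have hN' : (0 : ℝ) < N := by exact_mod_cast hN0
  have hNA : A / N ≤ ε / 4 := by
    have := (le_max_right _ _).trans_lt hNgt
    rw [div_lt_iff₀ hε] at this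
    rw [div_le_iff₀ hN']; linarith
  set q := (d : ℝ) / γ with hq
  have hq0 : 0 ≤ q := by positivity
  have hlim : ∀ k ∈ Finset.Icc 1 N, ∀ᶠ n in atTop, ∀ z : M,
      |({i : Fin n | edist (x n i) z ≤
        ENNReal.ofReal (((k : ℝ) / N) ^ (1 / γ) * (c * h n))}.ncard : ℝ) / (n * h n ^ d) -
        A * ((k : ℝ) / N) ^ q| < ε / 4 := by
    intro k hk
    have hk0 : (0 : ℝ) < k := by exact_mod_cast (Finset.mem_Icc.1 hk).1
    have hck : 0 < ((k : ℝ) / N) ^ (1 / γ) * c := by positivity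
    filter_upwards [Metric.tendstoUniformly_iff.1 (hx _ hck) (ε / 4) (by positivity)] with n hn z
    have := hn z
    rw [dist_comm, Real.dist_eq, mul_pow, ← Real.rpow_natCast (((k : ℝ) / N) ^ (1 / γ)) d,
      ← Real.rpow_mul (by positivity), show 1 / γ * (d : ℝ) = q by rw [hq]; ring] at this
    rw [hA, show a * c ^ d * ((k : ℝ) / N) ^ q = a * (((k : ℝ) / N) ^ q * c ^ d) by ring,
      ← mul_assoc]
    exact this
  rw [← Finset.eventually_all] at hlim
  filter_upwards [hlim, hh, eventually_gt_atTop 0] with n hn hhn hn0 z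
  have hn' : (0 : ℝ) < n := by exact_mod_cast hn0
  set D := (n : ℝ) * h n ^ d with hD
  have hD0 : 0 < D := by positivity
  set P : ℕ → ℝ := fun k => ({i : Fin n | edist (x n i) z ≤
        ENNReal.ofReal (((k : ℝ) / N) ^ (1 / γ) * (c * h n))}.ncard : ℝ) / D with hP
  set S := (∑ i, bump γ (c * h n) (edist (x n i) z)) / D with hS
  have hPsum : ∀ k, P k = (∑ i, if edist (x n i) z ≤
        ENNReal.ofReal (((k : ℝ) / N) ^ (1 / γ) * (c * h n)) then (1 : ℝ) else 0) / D := by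
    intro k; rw [sum_indicator_eq_ncard]
  have hPN : P N = (∑ i, if edist (x n i) z ≤
        ENNReal.ofReal (c * h n) then (1 : ℝ) else 0) / D := by
    rw [hPsum]; simp [div_self hN'.ne']
  have hlow : N * S ≤ ∑ k ∈ Finset.Icc 1 N, P k := by
    simp only [hPsum]
    rw [← Finset.sum_div, Finset.sum_comm, hS, ← mul_div_assoc, Finset.mul_sum]
    gcongr
    exact (bump_layers hγ (by positivity) hN0 _).1
  have hup : ∑ k ∈ Finset.Icc 1 N, P k ≤ N * S + P N := by
    rw [hPN]
    simp only [hPsum]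
    rw [← Finset.sum_div, Finset.sum_comm, hS, ← mul_div_assoc, Finset.mul_sum, ← add_div,
      ← Finset.sum_add_distrib]
    gcongr
    exact (bump_layers hγ (by positivity) hN0 _).2
  have hn1 : ∀ k ∈ Finset.Icc 1 N, |P k - A * ((k : ℝ) / N) ^ q| < ε / 4 :=
    fun k hk => hn k hk z
  obtain ⟨hr1, hr2⟩ := riemann_sum_rpow hq0 hN0
  set T := ∑ k ∈ Finset.Icc 1 N, ((k : ℝ) / N) ^ q with hT
  have hsumP : |∑ k ∈ Finset.Icc 1 N, P k - A * T| ≤ N * (ε / 4) := by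
    rw [hT, Finset.mul_sum, ← Finset.sum_sub_distrib]
    refine (Finset.abs_sum_le_sum_abs _ _).trans ?_
    refine (Finset.sum_le_card_nsmul _ _ _ fun k hk => (hn1 k hk).le).trans ?_
    simp
  have hPN' : P N ≤ A + ε / 4 := by
    have := (abs_lt.1 (hn1 N (Finset.mem_Icc.2 ⟨hN0, le_rfl⟩))).2
    rw [div_self hN'.ne', Real.one_rpow, mul_one] at this
    linarith
  have hq' : γ / (d + γ) = 1 / (q + 1) := by rw [hq]; field_simp
  rw [hq', dist_comm, Real.dist_eq]
  obtain ⟨hs1, hs2⟩ := abs_le.1 hsumP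
  rw [le_div_iff₀ hN'] at hr1
  rw [div_le_iff₀ hN'] at hr2
  have hNA' : A ≤ ε / 4 * N := by rwa [div_le_iff₀ hN'] at hNA
  have hr1' := mul_le_mul_of_nonneg_left hr1 hA0
  have hr2' := mul_le_mul_of_nonneg_left hr2 hA0
  have e1 : A * ((1 / (q + 1) + 1 / N) * N) = A * (1 / (q + 1)) * N + A := by field_simp
  rw [abs_lt]
  constructor
  · have : N * (A * (1 / (q + 1)) - ε) < N * S := by
      nlinarith
    have := lt_of_mul_lt_mul_left this hN'.le
    linarith
  · have : N * S < N * (A * (1 / (q + 1)) + ε) := by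
      nlinarith
    have := lt_of_mul_lt_mul_left this hN'.le
    linarith

end RadialSums

/-! ### Gaussian linear forms, exponential moments and likelihood ratios -/

section Gaussian

theorem measurable_linear_form {n : ℕ} (w : Fin n → ℝ) (s : Finset (Fin n)) :
    Measurable fun y : Fin n → ℝ => ∑ i ∈ s, w i * y i :=
  Finset.measurable_sum _ fun i _ => (measurable_pi_apply i).const_mul _

/-- A linear form of independent Gaussian variables is Gaussian. -/
theorem map_sum_mul_pi_gaussianReal {n : ℕ} (w m : Fin n → ℝ) (v v' : ℝ≥0)
    (hv' : (v' : ℝ) = ∑ i, w i ^ 2 * v) :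
    Measure.map (fun y : Fin n → ℝ => ∑ i, w i * y i)
      (Measure.pi fun i => gaussianReal (m i) v) = gaussianReal (∑ i, w i * m i) v' := by
  have hind : iIndepFun (fun (i : Fin n) (y : Fin n → ℝ) => w i * y i)
      (Measure.pi fun i => gaussianReal (m i) v) :=
    iIndepFun_pi (X := fun i t => w i * t) fun i => by fun_prop
  have key : ∀ s : Finset (Fin n), Measure.map (fun y : Fin n → ℝ => ∑ i ∈ s, w i * y i)
      (Measure.pi fun i => gaussianReal (m i) v) =
      gaussianReal (∑ i ∈ s, w i * m i) (∑ i ∈ s, NNReal.mk (w i ^ 2) (sq_nonneg _) * v) := by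
    intro s
    induction s using Finset.cons_induction with
    | empty => simp [gaussianReal_zero_var]
    | cons j s hj ih =>
      have hi := (hind.indepFun_finsetSum_of_notMem (fun i => by fun_prop) hj).symm
      have hj' : Measure.map (fun y : Fin n → ℝ => w j * y j)
          (Measure.pi fun i => gaussianReal (m i) v) =
          gaussianReal (w j * m j) (NNReal.mk (w j ^ 2) (sq_nonneg _) * v) := by
        rw [← gaussianReal_map_const_mul,
          ← (measurePreserving_eval (fun i => gaussianReal (m i) v) j).map_eq,
          Measure.map_map (by fun_prop) (by fun_prop)]
        rfl
      have h := gaussianReal_add_gaussianReal_of_indepFun hi hj' (by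
        convert ih using 2
        ext y; simp)
      rw [Finset.sum_cons, Finset.sum_cons, ← h]
      congr 1
      ext y
      simp only [Finset.sum_cons, Pi.add_apply, Finset.sum_apply]
  rw [key Finset.univ]
  congr 1
  apply NNReal.eq
  rw [hv']
  push_cast
  rfl

theorem integral_exp_mul_gaussianReal_zero (v : ℝ≥0) (t : ℝ) :
    ∫ x, Real.exp (t * x) ∂gaussianReal 0 v = Real.exp (v * t ^ 2 / 2) := by
  have h := congrFun (mgf_id_gaussianReal (μ := 0) (v := v)) t
  simpa [mgf] using h

theorem lintegral_exp_mul_abs_gaussianReal_le (v : ℝ≥0) (t : ℝ) :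
    ∫⁻ x, ENNReal.ofReal (Real.exp (t * |x|)) ∂gaussianReal 0 v ≤
      ENNReal.ofReal (2 * Real.exp (v * t ^ 2 / 2)) := by
  have hi : ∀ t, Integrable (fun x => Real.exp (t * x)) (gaussianReal 0 v) :=
    fun t => integrable_exp_mul_gaussianReal t
  calc _ ≤ ∫⁻ x, ENNReal.ofReal (Real.exp (t * x) + Real.exp (-t * x)) ∂gaussianReal 0 v := by
        refine lintegral_mono fun x => ENNReal.ofReal_le_ofReal ?_
        rcases abs_cases x with ⟨h, _⟩ | ⟨h, _⟩ <;> rw [h]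
        · linarith [Real.exp_pos (-t * x)]
        · rw [show t * -x = -t * x by ring]; linarith [Real.exp_pos (t * x)]
    _ = ENNReal.ofReal (∫ x, (Real.exp (t * x) + Real.exp (-t * x)) ∂gaussianReal 0 v) :=
        (ofReal_integral_eq_lintegral_ofReal ((hi t).add (hi (-t)))
          (Eventually.of_forall fun x => (add_pos (Real.exp_pos _) (Real.exp_pos _)).le)).symm
    _ = _ := by
        rw [integral_add (hi t) (hi (-t)), integral_exp_mul_gaussianReal_zero,
          integral_exp_mul_gaussianReal_zero, neg_sq]
        congr 1; ring

/-- In essence Jensen: `E exp (-|x|) ≥ exp (-E|x|)` and `E|x| ≤ √v`. Both are combined into one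
quadratic minorant, the tangent of `exp` at `-√v` together with `|x| ≤ a/2 + x²/(2a)`, `a = √v`. -/
theorem exp_neg_sqrt_le_integral_exp_neg_abs (v : ℝ≥0) :
    Real.exp (-Real.sqrt v) ≤ ∫ x, Real.exp (-|x|) ∂gaussianReal 0 v := by
  rcases eq_or_ne v 0 with rfl | hv
  · simp [gaussianReal_zero_var]
  have hv' : (0 : ℝ) < v := by exact_mod_cast pos_iff_ne_zero.2 hv
  set a := Real.sqrt v with ha
  have ha0 : 0 < a := Real.sqrt_pos.2 hv'
  have ha2 : a ^ 2 = v := Real.sq_sqrt hv'.le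
  have hsq : Integrable (fun x : ℝ => x ^ 2) (gaussianReal 0 v) :=
    (memLp_id_gaussianReal 2).integrable_sq
  have hsqint : ∫ x, x ^ 2 ∂gaussianReal 0 v = v := by
    have h := variance_fun_id_gaussianReal (μ := 0) (v := v)
    rw [variance_of_integral_eq_zero (by fun_prop) integral_id_gaussianReal] at h
    exact h
  have hintegral : Integrable (fun x : ℝ => Real.exp (-|x|)) (gaussianReal 0 v) :=
    Integrable.of_bound (C := 1) (by fun_prop) (Eventually.of_forall fun x => by
      rw [Real.norm_eq_abs, abs_of_pos (Real.exp_pos _)]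
      exact Real.exp_le_one_iff.2 (by simp))
  calc Real.exp (-a)
      = ∫ x, Real.exp (-a) * (1 + a / 2 - x ^ 2 / (2 * a)) ∂gaussianReal 0 v := by
        rw [integral_const_mul, integral_sub (by fun_prop) (hsq.div_const _), integral_div,
          hsqint, ← ha2]
        simp
        field_simp
        ring
    _ ≤ _ := by
        refine integral_mono (((integrable_const _).sub (hsq.div_const _)).const_mul _) hintegral
          fun x => ?_
        have h1 : |x| ≤ a / 2 + x ^ 2 / (2 * a) := by
          rw [← sq_abs x]
          have : a / 2 + |x| ^ 2 / (2 * a) - |x| = (|x| - a) ^ 2 / (2 * a) := by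
            field_simp; ring
          have h2 : 0 ≤ (|x| - a) ^ 2 / (2 * a) := by positivity
          linarith
        have h2 : 1 + (a - |x|) ≤ Real.exp (a - |x|) := by
          linarith [Real.add_one_le_exp (a - |x|)]
        calc Real.exp (-a) * (1 + a / 2 - x ^ 2 / (2 * a))
            ≤ Real.exp (-a) * Real.exp (a - |x|) := by gcongr; linarith
          _ = Real.exp (-|x|) := by rw [← Real.exp_add]; congr 1; ring

/-- Because `e^|x| = e^x + e^(-x) - e^(-|x|)`, and each of the first two terms has normalised mean
one. The subtracted term measures the unavoidable confusion between two signs. -/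
theorem lintegral_exp_abs_sub_gaussianReal_le (v : ℝ≥0) :
    ∫⁻ x, ENNReal.ofReal (Real.exp (|x| - v / 2)) ∂gaussianReal 0 v ≤
      ENNReal.ofReal (2 - Real.exp (-v / 2 - Real.sqrt v)) := by
  have hi : ∀ t, Integrable (fun x => Real.exp (t * x)) (gaussianReal 0 v) :=
    fun t => integrable_exp_mul_gaussianReal t
  have hintegral : Integrable (fun x : ℝ => Real.exp (-|x|)) (gaussianReal 0 v) :=
    Integrable.of_bound (C := 1) (by fun_prop) (Eventually.of_forall fun x => by
      rw [Real.norm_eq_abs, abs_of_pos (Real.exp_pos _)]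
      exact Real.exp_le_one_iff.2 (by simp))
  have heq : ∀ x : ℝ, Real.exp (|x| - v / 2) = Real.exp (-v / 2) *
      (Real.exp (1 * x) + Real.exp (-1 * x) - Real.exp (-|x|)) := by
    intro x
    rw [show |x| - v / 2 = -v / 2 + |x| by ring, Real.exp_add]
    congr 1
    rcases abs_cases x with ⟨h, _⟩ | ⟨h, _⟩ <;> rw [h] <;> ring_nf
  simp only [heq]
  have hint2 : Integrable (fun x => Real.exp (-v / 2) *
      (Real.exp (1 * x) + Real.exp (-1 * x) - Real.exp (-|x|))) (gaussianReal 0 v) :=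
    (((hi 1).add (hi (-1))).sub hintegral).const_mul _
  rw [← ofReal_integral_eq_lintegral_ofReal hint2
    (Eventually.of_forall fun x => by simp only [Pi.zero_apply]; rw [← heq]; positivity)]
  refine ENNReal.ofReal_le_ofReal ?_
  have hadd : Integrable (fun x => Real.exp (1 * x) + Real.exp (-1 * x)) (gaussianReal 0 v) :=
    (hi 1).add (hi (-1))
  rw [integral_const_mul, integral_sub hadd hintegral, integral_add (hi 1) (hi (-1)),
    integral_exp_mul_gaussianReal_zero, integral_exp_mul_gaussianReal_zero]
  have h1 := exp_neg_sqrt_le_integral_exp_neg_abs v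
  have h2 : Real.exp (-v / 2) * Real.exp (v / 2) = 1 := by
    rw [← Real.exp_add]; ring_nf; simp
  have h3 : Real.exp (-v / 2 - Real.sqrt v) = Real.exp (-v / 2) * Real.exp (-Real.sqrt v) := by
    rw [← Real.exp_add]; rfl
  have h4 := mul_le_mul_of_nonneg_left h1 (Real.exp_pos (-v / 2)).le
  rw [h3]
  norm_num
  linarith

theorem gaussianReal_eq_withDensity {v : ℝ≥0} (hv : v ≠ 0) (m : ℝ) :
    gaussianReal m v = (gaussianReal 0 v).withDensity
      fun y => ENNReal.ofReal (Real.exp (m * y / v - m ^ 2 / (2 * v))) := by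
  have hv' : (v : ℝ) ≠ 0 := by exact_mod_cast hv
  rw [gaussianReal_of_var_ne_zero _ hv, gaussianReal_of_var_ne_zero _ hv,
    ← withDensity_mul _ (measurable_gaussianPDF _ _) (by fun_prop)]
  congr 1
  ext y
  rw [Pi.mul_apply, gaussianPDF, gaussianPDF, ← ENNReal.ofReal_mul (gaussianPDFReal_nonneg _ _ _),
    gaussianPDFReal, gaussianPDFReal, mul_assoc _ (Real.exp _), ← Real.exp_add]
  congr 3
  field_simp
  ring

theorem pi_gaussianReal_eq_withDensity {n : ℕ} {v : ℝ≥0} (hv : v ≠ 0) (m : Fin n → ℝ) :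
    (Measure.pi fun i => gaussianReal (m i) v) =
      (Measure.pi fun _ : Fin n => gaussianReal 0 v).withDensity fun y =>
        ∏ i, ENNReal.ofReal (Real.exp (m i * y i / v - m i ^ 2 / (2 * v))) := by
  refine Measure.pi_eq fun s hs => ?_
  rw [withDensity_apply _ (MeasurableSet.univ_pi hs), ← lintegral_indicator (MeasurableSet.univ_pi hs)]
  set g : Fin n → ℝ → ℝ≥0∞ := fun i => (s i).indicator fun t =>
    ENNReal.ofReal (Real.exp (m i * t / v - m i ^ 2 / (2 * v))) with hg
  have hgm : ∀ i, Measurable (g i) := fun i => Measurable.indicator (by fun_prop) (hs i)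
  have hprod : ∀ y : Fin n → ℝ, (Set.univ.pi s).indicator (fun y : Fin n → ℝ =>
      ∏ i, ENNReal.ofReal (Real.exp (m i * y i / v - m i ^ 2 / (2 * v)))) y = ∏ i, g i (y i) := by
    intro y
    by_cases hy : y ∈ Set.univ.pi s
    · rw [Set.indicator_of_mem hy]
      exact Finset.prod_congr rfl fun i _ => by simp only [hg, Set.indicator_of_mem (hy i trivial)]
    · rw [Set.indicator_of_notMem hy]
      simp only [Set.mem_univ_pi, not_forall] at hy
      obtain ⟨i, hi⟩ := hy
      exact (Finset.prod_eq_zero (Finset.mem_univ i) (Set.indicator_of_notMem hi _)).symm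
  simp only [hprod]
  rw [lintegral_prod_eq_prod_lintegral_of_indepFun Finset.univ
    (fun i (y : Fin n → ℝ) => g i (y i)) (iIndepFun_pi fun i => (hgm i).aemeasurable)
    fun i => (hgm i).comp (measurable_pi_apply i)]
  refine Finset.prod_congr rfl fun i _ => ?_
  rw [(measurePreserving_eval (fun _ : Fin n => gaussianReal 0 v) i).lintegral_comp (hgm i),
    lintegral_indicator (hs i), gaussianReal_eq_withDensity hv (m i), withDensity_apply _ (hs i)]

end Gaussian

/-! ### Recovery of random signs in Gaussian noise -/

section SignRecovery

variable {n : ℕ} {ι : Type*}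

/-- The sign `±1` coded by a Boolean. -/
def boolSign (b : Bool) : ℝ := if b then 1 else -1

theorem boolSign_sq (b : Bool) : boolSign b ^ 2 = 1 := by cases b <;> simp [boolSign]

theorem boolSign_mul_le (b : Bool) (t : ℝ) : boolSign b * t ≤ |t| := by
  cases b
  · simp [boolSign, neg_le_abs]
  · simp [boolSign, le_abs_self]

theorem sum_sq_eq_sq_sum_of_disjoint [Fintype ι] (θ u : ι → ℝ)
    (hdisj : ∀ j k, u j ≠ 0 → u k ≠ 0 → j = k) :
    (∑ j, θ j * u j) ^ 2 = ∑ j, θ j ^ 2 * u j ^ 2 := by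
  by_cases h : ∃ j, u j ≠ 0
  · obtain ⟨j, hj⟩ := h
    have h0 : ∀ k, k ≠ j → u k = 0 := fun k hk => by_contra fun hk' => hk (hdisj k j hk' hj)
    rw [Finset.sum_eq_single_of_mem j (Finset.mem_univ j) (fun k _ hk => by simp [h0 k hk]),
      Finset.sum_eq_single_of_mem j (Finset.mem_univ j) (fun k _ hk => by simp [h0 k hk]), mul_pow]
  · push Not at h
    simp [h]

/-- Linear forms with disjoint supports read disjoint blocks of independent coordinates. -/
theorem lintegral_prod_of_disjoint_supports (P : Fin n → Measure ℝ)
    [∀ i, IsProbabilityMeasure (P i)] (u : ι → Fin n → ℝ)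
    (hdisj : ∀ i j k, u j i ≠ 0 → u k i ≠ 0 → j = k) (g : ι → ℝ → ℝ≥0∞)
    (hg : ∀ j, Measurable (g j)) (s : Finset ι) :
    ∫⁻ y, ∏ j ∈ s, g j (∑ i, u j i * y i) ∂Measure.pi P =
      ∏ j ∈ s, ∫⁻ y, g j (∑ i, u j i * y i) ∂Measure.pi P := by
  classical
  induction s using Finset.cons_induction with
  | empty => simp
  | cons k s hk ih =>
    simp only [Finset.prod_cons]
    rw [← ih]
    let supp : ι → Finset (Fin n) := fun j => Finset.univ.filter fun i => u j i ≠ 0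
    have hform : ∀ (j : ι) (U : Finset (Fin n)), supp j ⊆ U → ∀ y : Fin n → ℝ,
        ∑ i, u j i * y i = ∑ i : U, u j i * y i := by
      intro j U hU y
      rw [Finset.sum_coe_sort U fun i => u j i * y i]
      refine (Finset.sum_subset (Finset.subset_univ U) fun i _ hi => ?_).symm
      have : u j i = 0 := by
        by_contra h
        exact hi (hU (by simp [supp, h]))
      simp [this]
    have hdisjoint : Disjoint (supp k) (s.biUnion supp) := by
      rw [Finset.disjoint_biUnion_right]
      intro j hj
      rw [Finset.disjoint_left]
      intro i hi hi'
      simp only [supp, Finset.mem_filter, Finset.mem_univ, true_and] at hi hi'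
      exact hk (hdisj i j k hi' hi ▸ hj)
    have hcoord : iIndepFun (fun (i : Fin n) (y : Fin n → ℝ) => y i) (Measure.pi P) :=
      iIndepFun_pi (X := fun _ t => t) fun i => aemeasurable_id
    have hind := hcoord.indepFun_finset (supp k) (s.biUnion supp) hdisjoint
      fun i => measurable_pi_apply i
    have hm1 : Measurable fun r : supp k → ℝ => g k (∑ i : supp k, u k i * r i) :=
      (hg k).comp (Finset.measurable_sum _ fun i _ => (measurable_pi_apply i).const_mul _)
    have hm2 : Measurable fun r : s.biUnion supp → ℝ =>
        ∏ j ∈ s, g j (∑ i : s.biUnion supp, u j i * r i) :=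
      Finset.measurable_prod _ fun j _ => (hg j).comp
        (Finset.measurable_sum _ fun i _ => (measurable_pi_apply i).const_mul _)
    have hind' := hind.comp hm1 hm2
    have e1 : ((fun r : supp k → ℝ => g k (∑ i : supp k, u k i * r i)) ∘
        fun (y : Fin n → ℝ) (i : supp k) => y i) = fun y => g k (∑ i, u k i * y i) := by
      ext y; simp only [Function.comp_apply]; rw [hform k _ subset_rfl y]
    have e2 : ((fun r : s.biUnion supp → ℝ =>
        ∏ j ∈ s, g j (∑ i : s.biUnion supp, u j i * r i)) ∘
        fun (y : Fin n → ℝ) (i : s.biUnion supp) => y i) =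
        fun y => ∏ j ∈ s, g j (∑ i, u j i * y i) := by
      ext y
      simp only [Function.comp_apply]
      refine Finset.prod_congr rfl fun j hj => ?_
      rw [hform j _ (Finset.subset_biUnion_of_mem supp hj) y]
    rw [e1, e2] at hind'
    exact lintegral_mul_eq_lintegral_mul_lintegral_of_indepFun
      ((hg k).comp (measurable_linear_form _ _))
      (Finset.measurable_prod _ fun j _ => (hg j).comp (measurable_linear_form _ _)) hind'

/-- For independent random signs `θ j` of signals `u j` with disjoint supports, observed in Gaussian
noise, a bound for the probability that all signs are recovered. -/
theorem sum_measure_signs_recovered_le [Fintype ι] [DecidableEq ι] {v : ℝ≥0} (hv : v ≠ 0)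
    (u : ι → Fin n → ℝ) (hdisj : ∀ i j k, u j i ≠ 0 → u k i ≠ 0 → j = k)
    (A : ι → Set (Fin n → ℝ)) (hA : ∀ j, MeasurableSet (A j)) (s : ι → ℝ≥0)
    (hs : ∀ j, (s j : ℝ) = ∑ i, u j i ^ 2 / v) :
    ∑ θ : ι → Bool, (Measure.pi fun i => gaussianReal (∑ j, boolSign (θ j) * u j i) v)
        {y | ∀ j, y ∈ A j ↔ θ j = true} ≤
      ∏ j, ENNReal.ofReal (2 - Real.exp (-s j / 2 - Real.sqrt (s j))) := by
  have hv' : (v : ℝ) ≠ 0 := by exact_mod_cast hv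
  set P₀ := Measure.pi fun _ : Fin n => gaussianReal 0 v
  set S : ι → (Fin n → ℝ) → ℝ := fun j y => ∑ i, u j i / v * y i with hS
  -- The likelihood ratio of the signs `θ` to pure noise is `∏ exp (±S j - s j / 2)`; `G` is its
  -- maximum over `θ`.
  set G : (Fin n → ℝ) → ℝ≥0∞ := fun y => ∏ j, ENNReal.ofReal (Real.exp (|S j y| - s j / 2))
    with hG
  set C : (ι → Bool) → Set (Fin n → ℝ) := fun θ => {y | ∀ j, y ∈ A j ↔ θ j = true} with hC
  have hCm : ∀ θ, MeasurableSet (C θ) := by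
    intro θ
    have : C θ = ⋂ j, {y | y ∈ A j ↔ θ j = true} := by ext y; simp [hC]
    rw [this]
    refine MeasurableSet.iInter fun j => ?_
    cases θ j
    · convert (hA j).compl using 1
      ext y; simp
    · simpa using hA j
  have hdens : ∀ θ : ι → Bool,
      (Measure.pi fun i => gaussianReal (∑ j, boolSign (θ j) * u j i) v) (C θ) ≤
        P₀.withDensity G (C θ) := by
    intro θ
    rw [pi_gaussianReal_eq_withDensity hv, withDensity_apply _ (hCm θ), withDensity_apply _ (hCm θ)]
    refine lintegral_mono fun y => ?_
    rw [hG]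
    simp only
    rw [← ENNReal.ofReal_prod_of_nonneg fun i _ => (Real.exp_pos _).le,
      ← ENNReal.ofReal_prod_of_nonneg fun i _ => (Real.exp_pos _).le, ← Real.exp_sum,
      ← Real.exp_sum]
    refine ENNReal.ofReal_le_ofReal (Real.exp_le_exp.2 ?_)
    have e1 : ∑ i, ((∑ j, boolSign (θ j) * u j i) * y i / v -
        (∑ j, boolSign (θ j) * u j i) ^ 2 / (2 * v)) =
        ∑ j, (boolSign (θ j) * S j y - s j / 2) := by
      rw [Finset.sum_sub_distrib, Finset.sum_sub_distrib]
      congr 1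
      · simp only [hS, Finset.mul_sum, Finset.sum_mul, Finset.sum_div]
        rw [Finset.sum_comm]
        exact Finset.sum_congr rfl fun j _ => Finset.sum_congr rfl fun i _ => by ring
      · have : ∀ i, (∑ j, boolSign (θ j) * u j i) ^ 2 = ∑ j, u j i ^ 2 := fun i => by
          rw [sum_sq_eq_sq_sum_of_disjoint _ _ (hdisj i)]
          simp [boolSign_sq]
        simp only [this, hs, Finset.sum_div]
        rw [Finset.sum_comm]
        exact Finset.sum_congr rfl fun j _ => Finset.sum_congr rfl fun i _ => by
          field_simp
    rw [e1]
    exact Finset.sum_le_sum fun j _ => sub_le_sub_right (boolSign_mul_le _ _) _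
  have hdisjC : Pairwise (Function.onFun Disjoint C) := by
    intro θ θ' hne
    refine Set.disjoint_left.2 fun y hy hy' => hne ?_
    ext j
    have := (hy j).symm.trans (hy' j)
    cases h1 : θ j <;> cases h2 : θ' j <;> simp_all
  -- The events of recovering `θ` are disjoint for different `θ`, so the sum is at most the integral
  -- of the maximal likelihood ratio, which factorises over the bumps.
  calc _ ≤ ∑ θ : ι → Bool, P₀.withDensity G (C θ) := Finset.sum_le_sum fun θ _ => hdens θ
    _ ≤ P₀.withDensity G Set.univ :=
        sum_measure_le_measure_univ (fun θ _ => (hCm θ).nullMeasurableSet)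
          fun θ _ θ' _ hne => (hdisjC hne).aedisjoint
    _ = ∫⁻ y, G y ∂P₀ := by rw [withDensity_apply _ MeasurableSet.univ, setLIntegral_univ]
    _ = ∏ j, ∫⁻ y, ENNReal.ofReal (Real.exp (|S j y| - s j / 2)) ∂P₀ :=
        lintegral_prod_of_disjoint_supports (fun _ => gaussianReal 0 v) (fun j i => u j i / v)
          (fun i j k hj hk => hdisj i j k (fun h => hj (by simp [h])) fun h => hk (by simp [h]))
          (fun j t => ENNReal.ofReal (Real.exp (|t| - s j / 2))) (fun j => by fun_prop) Finset.univ
    _ ≤ _ := by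
        refine Finset.prod_le_prod' fun j _ => ?_
        have hlaw := map_sum_mul_pi_gaussianReal (fun i => u j i / v) (fun _ => 0) v (s j) (by
          rw [hs]
          exact Finset.sum_congr rfl fun i _ => by field_simp)
        simp only [mul_zero, Finset.sum_const_zero] at hlaw
        rw [← lintegral_map (f := fun t => ENNReal.ofReal (Real.exp (|t| - s j / 2)))
          (by fun_prop) (measurable_linear_form _ _), hlaw]
        exact lintegral_exp_abs_sub_gaussianReal_le (s j)

end SignRecovery

/-! ### The extended loss -/

section Loss

theorem extendLoss_le {w : ℝ → ℝ} (hw : MonotoneOn w (Set.Ici 0)) {t : ℝ≥0∞} {r : ℝ} (hr : 0 ≤ r)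
    (h : t ≤ ENNReal.ofReal r) : extendLoss w t ≤ ENNReal.ofReal (w r) := by
  refine iSup₂_le fun u hu => ENNReal.ofReal_le_ofReal (hw u.2 hr ?_)
  have := hu.trans h
  rwa [ENNReal.ofReal, ENNReal.coe_le_coe, ← NNReal.coe_le_coe, Real.coe_toNNReal r hr] at this

theorem le_extendLoss {w : ℝ → ℝ} {t : ℝ≥0∞} {r : ℝ} (hr : 0 ≤ r)
    (h : ENNReal.ofReal r ≤ t) : ENNReal.ofReal (w r) ≤ extendLoss w t := by
  have := le_iSup₂_of_le (f := fun (u : ℝ≥0) (_ : (u : ℝ≥0∞) ≤ t) => ENNReal.ofReal (w u))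
    r.toNNReal h le_rfl
  rwa [Real.coe_toNNReal r hr] at this

end Loss

/-! ### Hölder perturbations with prescribed signs -/

section Perturbations

theorem bump_nonneg {γ r : ℝ} (hγ : 0 ≤ γ) (hr : 0 < r) (t : ℝ≥0∞) : 0 ≤ bump γ r t := by
  unfold bump
  split_ifs with h
  · have h1 : t.toReal / r ≤ 1 := (div_le_one hr).2 (ENNReal.toReal_le_of_le_ofReal hr.le h)
    linarith [Real.rpow_le_one (by positivity) h1 hγ]
  · exact le_rfl

theorem bump_le_one {γ r : ℝ} (hr : 0 < r) (t : ℝ≥0∞) : bump γ r t ≤ 1 := by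
  unfold bump
  split_ifs with h
  · have : 0 ≤ (t.toReal / r) ^ γ := by positivity
    linarith
  · exact zero_le_one

theorem bump_zero {γ r : ℝ} (hγ : γ ≠ 0) : bump γ r 0 = 1 := by
  simp [bump, Real.zero_rpow hγ]

theorem le_of_bump_ne_zero {γ r : ℝ} {t : ℝ≥0∞} (h : bump γ r t ≠ 0) : t ≤ ENNReal.ofReal r := by
  by_contra hcon
  exact h (if_neg hcon)

/-- Subadditivity of `t ↦ t ^ β`, which is where `β ≤ 1` enters. -/
theorem rpow_mul_bump_le {β r δ : ℝ} (hβ : 0 < β) (hβ1 : β ≤ 1) (hr : 0 < r) (hδ : 0 ≤ δ)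
    {s t : ℝ≥0∞} (h : t ≤ s + ENNReal.ofReal δ) :
    r ^ β * bump β r s ≤ r ^ β * bump β r t + δ ^ β := by
  have hδβ : 0 ≤ δ ^ β := by positivity
  have hval : ∀ t : ℝ≥0∞, t ≤ ENNReal.ofReal r → r ^ β * bump β r t = r ^ β - t.toReal ^ β := by
    intro t ht
    rw [bump, if_pos ht, Real.div_rpow ENNReal.toReal_nonneg hr.le]
    field_simp
  by_cases hs : s ≤ ENNReal.ofReal r
  · have hs_ne_top : s ≠ ⊤ := (hs.trans_lt ENNReal.ofReal_lt_top).ne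
    have hadd : (s.toReal + δ) ^ β ≤ s.toReal ^ β + δ ^ β :=
      Real.rpow_add_le_add_rpow ENNReal.toReal_nonneg hδ hβ.le hβ1
    have hsd : s + ENNReal.ofReal δ = ENNReal.ofReal (s.toReal + δ) := by
      rw [ENNReal.ofReal_add ENNReal.toReal_nonneg hδ, ENNReal.ofReal_toReal hs_ne_top]
    rw [hsd] at h
    rw [hval s hs]
    by_cases ht : t ≤ ENNReal.ofReal r
    · rw [hval t ht]
      have : t.toReal ^ β ≤ (s.toReal + δ) ^ β :=
        Real.rpow_le_rpow ENNReal.toReal_nonneg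
          (ENNReal.toReal_le_of_le_ofReal (by positivity) h) hβ.le
      linarith
    · have h1 := (not_le.1 ht).trans_le h
      rw [ENNReal.ofReal_lt_ofReal_iff_of_nonneg hr.le] at h1
      have : r ^ β ≤ (s.toReal + δ) ^ β := Real.rpow_le_rpow hr.le h1.le hβ.le
      rw [bump, if_neg ht]
      linarith
  · rw [bump, if_neg hs, mul_zero]
    have := bump_nonneg hβ.le hr t
    positivity

variable {M : Type*} [EMetricSpace M] {ι : Type*} [Fintype ι]

/-- The sum of the bumps of radius `r` and Hölder constant `L` around the points `c j`, with
signs `θ j`. -/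
def bumpSum (β L r : ℝ) (c : ι → M) (θ : ι → Bool) (p : M) : ℝ :=
  ∑ j, boolSign (θ j) * (L * r ^ β * bump β r (edist p (c j)))

theorem abs_boolSign (b : Bool) : |boolSign b| = 1 := by cases b <;> simp [boolSign]

/-- Within one bump this is the Hölder bound of a single bump. Points in two different bumps may
have values `L r^β` and `-L r^β`; the separation forces their distance above `2^(1/β) r`, which is
just enough to allow the jump `2 L r^β`. -/
theorem abs_bumpSum_sub_le {β L r δ : ℝ} (hβ : 0 < β) (hβ1 : β ≤ 1) (hL : 0 ≤ L) (hr : 0 < r)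
    (hδ : 0 ≤ δ) {c : ι → M}
    (hc : ∀ j k, j ≠ k → ENNReal.ofReal ((2 + 2 ^ (1 / β)) * r) < edist (c j) (c k))
    (θ : ι → Bool) {p q : M} (hpq : edist p q ≤ ENNReal.ofReal δ) :
    |bumpSum β L r c θ p - bumpSum β L r c θ q| ≤ L * δ ^ β := by
  have hrβ : 0 < r ^ β := by positivity
  have h2β : (0 : ℝ) < 2 ^ (1 / β) := by positivity
  have hdiff : ∀ j, |r ^ β * bump β r (edist p (c j)) - r ^ β * bump β r (edist q (c j))| ≤
      δ ^ β := by
    intro j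
    have h1 : edist q (c j) ≤ edist p (c j) + ENNReal.ofReal δ := by
      rw [add_comm]
      exact (edist_triangle q p (c j)).trans (by gcongr; rwa [edist_comm])
    have h2 : edist p (c j) ≤ edist q (c j) + ENNReal.ofReal δ := by
      rw [add_comm]
      exact (edist_triangle p q (c j)).trans (by gcongr)
    rw [abs_le]
    constructor
    · linarith [rpow_mul_bump_le hβ hβ1 hr hδ h2]
    · linarith [rpow_mul_bump_le hβ hβ1 hr hδ h1]
  have hone : ∀ p : M, ∀ j k, bump β r (edist p (c j)) ≠ 0 → bump β r (edist p (c k)) ≠ 0 →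
      j = k := by
    intro p j k hj hk
    by_contra hne
    refine (hc j k hne).not_ge ?_
    calc edist (c j) (c k) ≤ edist (c j) p + edist p (c k) := edist_triangle _ _ _
      _ ≤ ENNReal.ofReal r + ENNReal.ofReal r := by
          rw [edist_comm (c j) p]
          exact add_le_add (le_of_bump_ne_zero hj) (le_of_bump_ne_zero hk)
      _ = ENNReal.ofReal (r + r) := (ENNReal.ofReal_add hr.le hr.le).symm
      _ ≤ _ := ENNReal.ofReal_le_ofReal (by nlinarith)
  by_cases hA : ∃ j k, j ≠ k ∧ bump β r (edist p (c j)) ≠ 0 ∧ bump β r (edist q (c k)) ≠ 0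
  · obtain ⟨j, k, hjk, hj, hk⟩ := hA
    have hbig : 2 * r ^ β ≤ δ ^ β := by
      have h1 : ENNReal.ofReal ((2 + 2 ^ (1 / β)) * r) < ENNReal.ofReal (r + δ + r) := by
        refine (hc j k hjk).trans_le ?_
        calc edist (c j) (c k) ≤ edist (c j) p + edist p q + edist q (c k) :=
              edist_triangle4 _ _ _ _
          _ ≤ ENNReal.ofReal r + ENNReal.ofReal δ + ENNReal.ofReal r := by
              rw [edist_comm (c j) p]
              exact add_le_add (add_le_add (le_of_bump_ne_zero hj) hpq) (le_of_bump_ne_zero hk)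
          _ = _ := by
              rw [ENNReal.ofReal_add (by positivity) hr.le, ENNReal.ofReal_add hr.le hδ]
      rw [ENNReal.ofReal_lt_ofReal_iff_of_nonneg (by positivity)] at h1
      have h2 : 2 ^ (1 / β) * r ≤ δ := by linarith
      calc 2 * r ^ β = (2 ^ (1 / β) * r) ^ β := by
            rw [Real.mul_rpow h2β.le hr.le, ← Real.rpow_mul (by norm_num),
              one_div_mul_cancel hβ.ne', Real.rpow_one]
        _ ≤ δ ^ β := Real.rpow_le_rpow (by positivity) h2 hβ.le
    have hsize : ∀ (p : M) j, bump β r (edist p (c j)) ≠ 0 →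
        |bumpSum β L r c θ p| ≤ L * r ^ β := by
      intro p j hj
      rw [bumpSum, Finset.sum_eq_single_of_mem j (Finset.mem_univ j), abs_mul, abs_boolSign,
        one_mul, abs_of_nonneg (mul_nonneg (by positivity) (bump_nonneg hβ.le hr _))]
      · exact mul_le_of_le_one_right (by positivity) (bump_le_one hr _)
      · intro k _ hk
        rw [not_not.1 fun h => hk (hone p k j h hj)]
        ring
    calc _ ≤ |bumpSum β L r c θ p| + |bumpSum β L r c θ q| := abs_sub _ _
      _ ≤ L * r ^ β + L * r ^ β := add_le_add (hsize p j hj) (hsize q k hk)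
      _ = L * (2 * r ^ β) := by ring
      _ ≤ _ := by gcongr
  · push Not at hA
    by_cases hB : ∃ j, bump β r (edist p (c j)) ≠ 0 ∨ bump β r (edist q (c j)) ≠ 0
    · obtain ⟨j, hj⟩ := hB
      have hzero : ∀ k, k ≠ j → bump β r (edist p (c k)) = 0 ∧ bump β r (edist q (c k)) = 0 := by
        intro k hk
        rcases hj with hj | hj
        · exact ⟨not_not.1 fun h => hk (hone p k j h hj), hA j k hk.symm hj⟩
        · exact ⟨not_not.1 fun h => hj (hA k j hk h), not_not.1 fun h => hk (hone q k j h hj)⟩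
      rw [bumpSum, bumpSum, ← Finset.sum_sub_distrib,
        Finset.sum_eq_single_of_mem j (Finset.mem_univ j) fun k _ hk => by
          rw [(hzero k hk).1, (hzero k hk).2]; ring,
        ← mul_sub, abs_mul, abs_boolSign, one_mul, mul_assoc, mul_assoc, ← mul_sub, abs_mul,
        abs_of_nonneg hL]
      exact mul_le_mul_of_nonneg_left (hdiff j) hL
    · push Not at hB
      have : bumpSum β L r c θ p - bumpSum β L r c θ q = 0 := by
        simp [bumpSum, hB]
      rw [this, abs_zero]
      positivity

theorem holderWith_bumpSum {β L : ℝ≥0} {r : ℝ} (hβ : 0 < β) (hβ1 : β ≤ 1) (hL : 0 < L)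
    (hr : 0 < r) {c : ι → M}
    (hc : ∀ j k, j ≠ k → ENNReal.ofReal ((2 + 2 ^ (1 / (β : ℝ))) * r) < edist (c j) (c k))
    (θ : ι → Bool) : HolderWith L β (bumpSum β L r c θ) := by
  intro p q
  rcases eq_or_ne (edist p q) ⊤ with h | h
  · rw [h, ENNReal.top_rpow_of_pos (by exact_mod_cast hβ),
      ENNReal.mul_top (by exact_mod_cast hL.ne')]
    exact le_top
  · rw [edist_dist, Real.dist_eq]
    have := abs_bumpSum_sub_le (β := β) (L := L) (by exact_mod_cast hβ) (by exact_mod_cast hβ1)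
      L.2 hr (ENNReal.toReal_nonneg (a := edist p q)) hc θ (ENNReal.ofReal_toReal h).ge
    refine (ENNReal.ofReal_le_ofReal this).trans_eq ?_
    rw [ENNReal.ofReal_mul L.coe_nonneg, ENNReal.ofReal_coe_nnreal,
      ← ENNReal.ofReal_rpow_of_nonneg ENNReal.toReal_nonneg β.coe_nonneg, ENNReal.ofReal_toReal h]

theorem bumpSum_center {β L r : ℝ} (hβ : 0 < β) (hr : 0 < r) {c : ι → M}
    (hc : ∀ j k, j ≠ k → ENNReal.ofReal ((2 + 2 ^ (1 / β)) * r) < edist (c j) (c k))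
    (θ : ι → Bool) (j : ι) : bumpSum β L r c θ (c j) = boolSign (θ j) * (L * r ^ β) := by
  have h2β : (0 : ℝ) < 2 ^ (1 / β) := by positivity
  rw [bumpSum, Finset.sum_eq_single_of_mem j (Finset.mem_univ j)]
  · rw [edist_self, bump_zero hβ.ne', mul_one]
  · intro k _ hk
    have : bump β r (edist (c j) (c k)) = 0 := by
      by_contra h
      refine (hc j k hk.symm).not_ge ((le_of_bump_ne_zero h).trans
        (ENNReal.ofReal_le_ofReal ?_))
      nlinarith
    rw [this]; ring

end Perturbations

/-! ### Lower bound for the risk with finitely many observations -/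

section LowerBound

theorem ofReal_mul_le_lintegral_of_subset {Ω : Type*} [MeasurableSpace Ω] {P : Measure Ω}
    {C : Set Ω} (hC : MeasurableSet C) {W : ℝ≥0∞} {F : Ω → ℝ≥0∞} (h : ∀ y ∈ C, W ≤ F y) :
    W * P C ≤ ∫⁻ y, F y ∂P := by
  rw [← setLIntegral_const]
  exact (setLIntegral_mono' hC h).trans (setLIntegral_le_lintegral _ _)

/-- The average over all signs of the probability that the estimator has every sign right is small,
so some function in the class defeats it. Here `s` bounds the squared signal-to-noise ratio of each
bump. -/
theorem le_supNormMinimaxRisk {M : Type*} [EMetricSpace M] [MeasurableSpace M] {n : ℕ}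
    {w : ℝ → ℝ} {β L σ : ℝ≥0} (hβ : 0 < β) (hβ1 : β ≤ 1) (hL : 0 < L) (hσ : 0 < σ) {ψ r : ℝ}
    (hψ : 0 < ψ) (hr : 0 < r) (x : Fin n → M) {Z : Finset M}
    (hZ : ∀ z ∈ Z, ∀ z' ∈ Z, z ≠ z' →
      ENNReal.ofReal ((2 + 2 ^ (1 / (β : ℝ))) * r) < edist z z')
    {s : ℝ} (hs : ∀ z ∈ Z, ∑ i, (L * r ^ (β : ℝ) * bump β r (edist (x i) z)) ^ 2 / σ ^ 2 ≤ s) :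
    ENNReal.ofReal (w (ψ⁻¹ * (L * r ^ (β : ℝ)))) *
      ENNReal.ofReal (1 - Real.exp (-(Z.card / 2 * Real.exp (-s / 2 - Real.sqrt s)))) ≤
      supNormMinimaxRisk w β L σ ψ x := by
  classical
  refine le_iInf₂ fun T hT => ?_
  set W := ENNReal.ofReal (w (ψ⁻¹ * (L * r ^ (β : ℝ)))) with hW
  have hβ' : (0 : ℝ) < β := by exact_mod_cast hβ
  have hrβ : 0 < r ^ (β : ℝ) := by positivity
  have hL' : (0 : ℝ) < L := by exact_mod_cast hL
  have h2β : (0 : ℝ) < 2 ^ (1 / (β : ℝ)) := by positivity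
  have hσ2 : σ ^ 2 ≠ 0 := pow_ne_zero 2 hσ.ne'
  let c : Z → M := fun z => z
  have hc : ∀ j k, j ≠ k → ENNReal.ofReal ((2 + 2 ^ (1 / (β : ℝ))) * r) < edist (c j) (c k) :=
    fun j k hjk => hZ j j.2 k k.2 fun h => hjk (Subtype.ext h)
  let u : Z → Fin n → ℝ := fun j i => L * r ^ (β : ℝ) * bump β r (edist (x i) (c j))
  have hu : ∀ i j k, u j i ≠ 0 → u k i ≠ 0 → j = k := by
    intro i j k hj hk
    by_contra hne
    have hj' : bump β r (edist (x i) (c j)) ≠ 0 := fun h => hj (by simp [u, h])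
    have hk' : bump β r (edist (x i) (c k)) ≠ 0 := fun h => hk (by simp [u, h])
    refine (hc j k hne).not_ge ?_
    calc edist (c j) (c k) ≤ edist (c j) (x i) + edist (x i) (c k) := edist_triangle _ _ _
      _ ≤ ENNReal.ofReal r + ENNReal.ofReal r := by
          rw [edist_comm (c j)]
          exact add_le_add (le_of_bump_ne_zero hj') (le_of_bump_ne_zero hk')
      _ = ENNReal.ofReal (r + r) := (ENNReal.ofReal_add hr.le hr.le).symm
      _ ≤ _ := ENNReal.ofReal_le_ofReal (by nlinarith)
  -- The estimator decides the sign `+` at a centre when its value there is nonnegative.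
  let A : Z → Set (Fin n → ℝ) := fun j => {y | 0 ≤ T y (c j)}
  have hTm : ∀ p, Measurable fun y => T y p := fun p =>
    Measurable.comp (g := Function.uncurry T) hT measurable_prodMk_right
  have hA : ∀ j, MeasurableSet (A j) := fun j => measurableSet_le measurable_const (hTm _)
  let v : Z → ℝ≥0 := fun j => Real.toNNReal (∑ i, u j i ^ 2 / (σ ^ 2 : ℝ≥0))
  have hv : ∀ j, (v j : ℝ) = ∑ i, u j i ^ 2 / (σ ^ 2 : ℝ≥0) := fun j =>
    Real.coe_toNNReal _ (Finset.sum_nonneg fun i _ => by positivity)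
  have hvs : ∀ j, (v j : ℝ) ≤ s := fun j => by
    rw [hv]; push_cast; exact hs j j.2
  have hlaw : ∀ θ : Z → Bool, regressionLaw σ x (bumpSum β L r c θ) =
      Measure.pi fun i => gaussianReal (∑ j, boolSign (θ j) * u j i) (σ ^ 2) := fun θ => rfl
  have hsum := sum_measure_signs_recovered_le hσ2 u hu A hA v hv
  set e := Real.exp (-s / 2 - Real.sqrt s) with he
  have he0 : 0 < e := Real.exp_pos _
  set τ := Real.exp (-(Z.card / 2 * e)) with hτ
  -- Each factor is at most `2 - e ≤ 2 exp (-e/2)`; the powers of two count the sign patterns, so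
  -- `τ` bounds the average recovery probability.
  have hprod : ∏ j : Z, ENNReal.ofReal (2 - Real.exp (-v j / 2 - Real.sqrt (v j))) ≤
      ∑ _θ : Z → Bool, ENNReal.ofReal τ := by
    calc _ ≤ ∏ j : Z, ENNReal.ofReal (2 * Real.exp (-e / 2)) := by
          refine Finset.prod_le_prod' fun j _ => ENNReal.ofReal_le_ofReal ?_
          have h1 : e ≤ Real.exp (-v j / 2 - Real.sqrt (v j)) := by
            refine Real.exp_le_exp.2 ?_
            have := Real.sqrt_le_sqrt (hvs j)
            linarith [hvs j]
          linarith [Real.add_one_le_exp (-e / 2)]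
      _ = _ := by
          rw [Finset.prod_const, Finset.sum_const, Finset.card_univ, Finset.card_univ,
            Fintype.card_fun, Fintype.card_bool, Fintype.card_coe,
            ENNReal.ofReal_mul (by norm_num), mul_pow, nsmul_eq_mul,
            ← ENNReal.ofReal_pow (Real.exp_pos _).le, ← Real.exp_nat_mul, hτ]
          congr 2
          · simp
          · congr 1; ring
  obtain ⟨θ, hθ⟩ : ∃ θ : Z → Bool,
      (Measure.pi fun i => gaussianReal (∑ j, boolSign (θ j) * u j i) (σ ^ 2))
        {y | ∀ j, y ∈ A j ↔ θ j = true} ≤ ENNReal.ofReal τ := by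
    by_contra! hcon
    exact (hsum.trans hprod).not_gt
      (ENNReal.sum_lt_sum_of_nonempty Finset.univ_nonempty fun θ _ => hcon θ)
  refine le_trans ?_ (le_iSup₂_of_le (bumpSum β L r c θ)
    (holderWith_bumpSum hβ hβ1 hL hr hc θ) le_rfl)
  rw [hlaw]
  set P := Measure.pi fun i => gaussianReal (∑ j, boolSign (θ j) * u j i) (σ ^ 2)
  set C := {y | ∀ j, y ∈ A j ↔ θ j = true} with hC
  have hCm : MeasurableSet C := by
    have : C = ⋂ j, {y | y ∈ A j ↔ θ j = true} := by ext y; simp [hC]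
    rw [this]
    refine MeasurableSet.iInter fun j => ?_
    cases θ j
    · convert (hA j).compl using 1
      ext y; simp
    · simpa using hA j
  refine le_trans ?_ (ofReal_mul_le_lintegral_of_subset (W := W) hCm.compl fun y hy => ?_)
  · gcongr
    rw [prob_compl_eq_one_sub hCm, ENNReal.ofReal_sub _ (Real.exp_pos _).le, ENNReal.ofReal_one]
    exact tsub_le_tsub_left hθ _
  · refine le_extendLoss (by positivity) ?_
    rw [ENNReal.ofReal_mul (by positivity)]
    gcongr
    simp only [hC, Set.mem_compl_iff, Set.mem_ofPred_eq, not_forall] at hy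
    obtain ⟨j, hj⟩ := hy
    refine le_iSup_of_le (c j) (ENNReal.ofReal_le_ofReal ?_)
    rw [bumpSum_center hβ' hr hc]
    have hpos : 0 < (L : ℝ) * r ^ (β : ℝ) := by positivity
    -- With a wrong sign, the estimate and the value `±L r^β` lie on opposite sides of zero.
    cases h : θ j
    · have h0 : 0 ≤ T y (c j) := by
        by_contra h0
        exact hj (by simp [h, A, h0])
      simp only [boolSign, Bool.false_eq_true, if_false]
      exact le_trans (by linarith) (le_abs_self _)
    · have h0 : T y (c j) < 0 := by
        by_contra h0
        exact hj (by simp [h, A, not_lt.1 h0])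
      simp only [boolSign, if_true]
      exact le_trans (by linarith) (neg_le_abs _)

end LowerBound

/-! ### Risk bound for the kernel estimator -/

section UpperBound

/-- Assigns net points measurably, so that the estimator extended from the net to `M` is jointly
measurable. -/
theorem exists_measurable_selection {M : Type*} [EMetricSpace M] [MeasurableSpace M] [BorelSpace M]
    (δ : ℝ≥0∞) (Z : Finset M) : ∃ g : M → M, Measurable g ∧
      ∀ p, (∃ z ∈ Z, edist p z ≤ δ) → g p ∈ Z ∧ edist p (g p) ≤ δ := by
  classical
  induction Z using Finset.induction_on with
  | empty => exact ⟨id, measurable_id, by simp⟩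
  | insert z Z hz ih =>
    obtain ⟨g, hg, hg'⟩ := ih
    have hm : MeasurableSet {p : M | edist p z ≤ δ} :=
      (isClosed_le (continuous_id.edist continuous_const) continuous_const).measurableSet
    refine ⟨fun p => if edist p z ≤ δ then z else g p, Measurable.ite hm measurable_const hg, ?_⟩
    rintro p ⟨z', hz', hpz'⟩
    by_cases h : edist p z ≤ δ
    · simp [h]
    · have hz'Z : z' ∈ Z := by
        rcases Finset.mem_insert.1 hz' with rfl | h'
        · exact absurd hpz' h
        · exact h'
      have := hg' p ⟨z', hz'Z, hpz'⟩
      simp only [if_neg h]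
      exact ⟨Finset.mem_insert_of_mem this.1, this.2⟩

theorem HolderWith.abs_sub_le {M : Type*} [EMetricSpace M] {L β : ℝ≥0} {f : M → ℝ}
    (hf : HolderWith L β f) {p q : M} {δ : ℝ} (hδ : 0 ≤ δ) (h : edist p q ≤ ENNReal.ofReal δ) :
    |f p - f q| ≤ L * δ ^ (β : ℝ) := by
  have h1 := hf p q
  rw [edist_dist, Real.dist_eq] at h1
  have h2 : ENNReal.ofReal |f p - f q| ≤ ENNReal.ofReal (L * δ ^ (β : ℝ)) := by
    refine h1.trans ?_
    rw [ENNReal.ofReal_mul L.coe_nonneg, ENNReal.ofReal_coe_nnreal,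
      ← ENNReal.ofReal_rpow_of_nonneg hδ β.coe_nonneg]
    gcongr
  rwa [ENNReal.ofReal_le_ofReal_iff (by positivity)] at h2

/-- With `s = (t/r)^β` this is `(1 - s) s = (1 - s²) - (1 - s)`. It expresses the bias of the kernel
through two bump sums, as `bump_sq` does for the variance. -/
theorem bump_mul_rpow {β r : ℝ} (hr : 0 < r) {t : ℝ≥0∞} (ht : t ≤ ENNReal.ofReal r) :
    bump β r t * t.toReal ^ β = r ^ β * (bump (2 * β) r t - bump β r t) := by
  have h0 : 0 ≤ t.toReal / r := by positivity
  rw [bump, bump, if_pos ht, if_pos ht, mul_comm 2 β, Real.rpow_mul h0, Real.rpow_two,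
    Real.div_rpow ENNReal.toReal_nonneg hr.le]
  have : 0 < r ^ β := by positivity
  field_simp
  ring

theorem abs_bump_weighted_sub_le {M : Type*} [EMetricSpace M] {n : ℕ} {L β : ℝ≥0} {f : M → ℝ}
    (hf : HolderWith L β f) {r : ℝ} (hr : 0 < r) (x : Fin n → M) {z : M}
    (hpos : 0 < ∑ i, bump β r (edist (x i) z)) :
    |∑ i, bump β r (edist (x i) z) / (∑ i, bump β r (edist (x i) z)) * f (x i) - f z| ≤
      L * r ^ (β : ℝ) * ((∑ i, (bump (2 * β) r (edist (x i) z) - bump β r (edist (x i) z))) /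
        ∑ i, bump β r (edist (x i) z)) := by
  set B := ∑ i, bump β r (edist (x i) z) with hB
  have h1 : ∑ i, bump β r (edist (x i) z) / B * f (x i) - f z =
      (∑ i, bump β r (edist (x i) z) * (f (x i) - f z)) / B := by
    simp only [mul_sub, Finset.sum_sub_distrib]
    rw [← Finset.sum_mul, ← hB, sub_div, mul_div_assoc, mul_div_cancel₀ _ hpos.ne', Finset.sum_div]
    congr 1
    exact Finset.sum_congr rfl fun i _ => by ring
  rw [h1, abs_div, abs_of_pos hpos, ← mul_div_assoc]
  gcongr
  rw [Finset.mul_sum]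
  refine (Finset.abs_sum_le_sum_abs _ _).trans (Finset.sum_le_sum fun i _ => ?_)
  by_cases h : edist (x i) z ≤ ENNReal.ofReal r
  · have hb := bump_nonneg β.coe_nonneg hr (edist (x i) z)
    have htop : edist (x i) z ≠ ⊤ := (h.trans_lt ENNReal.ofReal_lt_top).ne
    rw [abs_mul, abs_of_nonneg hb, mul_assoc, ← bump_mul_rpow hr h]
    have := hf.abs_sub_le (p := x i) (q := z) ENNReal.toReal_nonneg (ENNReal.ofReal_toReal htop).ge
    calc _ ≤ bump β r (edist (x i) z) * (L * (edist (x i) z).toReal ^ (β : ℝ)) := by gcongr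
      _ = _ := by ring
  · simp [bump, h]

/-- Risk bound for the kernel estimator with kernel `bump β r`, evaluated at the points of a
`δ`-dense set `Z`. -/
theorem supNormMinimaxRisk_le {M : Type*} [EMetricSpace M] [MeasurableSpace M] [BorelSpace M]
    {n : ℕ} {w : ℝ → ℝ} (hw : MonotoneOn w (Set.Ici 0)) {β L σ : ℝ≥0}
    {ψ r δ t b s A : ℝ} (hψ : 0 < ψ) (hr : 0 < r) (hδ : 0 ≤ δ) (ht : 0 ≤ t) (hs : 0 < s)
    (hst : s ≤ t) (hb : 0 ≤ b) (x : Fin n → M) {Z : Finset M} (hZne : Z.Nonempty)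
    (hcov : ∀ y, ∃ z ∈ Z, edist y z ≤ ENNReal.ofReal δ)
    (hpos : ∀ z ∈ Z, 0 < ∑ i, bump β r (edist (x i) z))
    (hbias : ∀ z ∈ Z, ψ⁻¹ * (L * r ^ (β : ℝ) *
      ((∑ i, (bump (2 * β) r (edist (x i) z) - bump β r (edist (x i) z))) /
        ∑ i, bump β r (edist (x i) z)) + L * δ ^ (β : ℝ)) ≤ b)
    (hvar : ∀ z ∈ Z, (∑ i, bump β r (edist (x i) z) ^ 2) * σ ^ 2 /
      (ψ * ∑ i, bump β r (edist (x i) z)) ^ 2 ≤ s)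
    (hA : ∀ u, 0 ≤ u → w (b + u) ≤ A * Real.exp u) :
    supNormMinimaxRisk w β L σ ψ x ≤ ENNReal.ofReal (w (b + t)) +
      ENNReal.ofReal (Z.card * (2 * (max A 0) * Real.exp (t - t ^ 2 / (2 * s)))) := by
  classical
  obtain ⟨g, hgm, hg⟩ := exists_measurable_selection (ENNReal.ofReal δ) Z
  set A' := max A 0 with hA'
  have hA'0 : 0 ≤ A' := le_max_right _ _
  let W : M → Fin n → ℝ := fun z i =>
    bump β r (edist (x i) z) / ∑ i, bump β r (edist (x i) z)
  let T : (Fin n → ℝ) → M → ℝ := fun y p => ∑ i, W (g p) i * y i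
  have hbm : ∀ i, Measurable fun z => bump β r (edist (x i) z) := fun i =>
    (measurable_bump _ _).comp (continuous_const.edist continuous_id).measurable
  have hWm : ∀ i, Measurable fun z => W z i := fun i =>
    (hbm i).div (Finset.measurable_sum _ fun i _ => hbm i)
  have hT : T ∈ Estimator M n := by
    change Measurable (Function.uncurry T)
    refine Finset.measurable_sum _ fun i _ => ?_
    exact ((hWm i).comp (hgm.comp measurable_snd)).mul
      ((measurable_pi_apply i).comp measurable_fst)
  refine (iInf₂_le T hT).trans (iSup₂_le fun f hf => ?_)
  set P := regressionLaw σ x f with hP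
  have hPprob : IsProbabilityMeasure P := by
    rw [hP, regressionLaw]; infer_instance
  let ζ : M → (Fin n → ℝ) → ℝ := fun z y => ∑ i, ψ⁻¹ * W z i * y i - ∑ i, ψ⁻¹ * W z i * f (x i)
  have hζm : ∀ z, Measurable (ζ z) := fun z => (measurable_linear_form _ _).sub_const _
  -- `q = t / s` minimises `s q² / 2 - q t`, the exponent in Chernoff's bound for variance at most
  -- `s`.
  set q := t / s with hq
  have hq1 : 1 ≤ q := (one_le_div hs).2 hst
  have hdet : ∀ (y : Fin n → ℝ) (R : ℝ), 0 ≤ R → (∀ z ∈ Z, |ζ z y| ≤ R) →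
      ENNReal.ofReal ψ⁻¹ * supDist (T y) f ≤ ENNReal.ofReal (b + R) := by
    intro y R hR hy
    rw [supDist, ENNReal.mul_iSup]
    refine iSup_le fun p => ?_
    rw [← ENNReal.ofReal_mul (by positivity)]
    refine ENNReal.ofReal_le_ofReal ?_
    obtain ⟨hgZ, hgp⟩ := hg p (hcov p)
    have h1 := abs_bump_weighted_sub_le hf hr x (hpos (g p) hgZ)
    have h2 := hf.abs_sub_le hδ hgp
    have h3 := hbias (g p) hgZ
    have h4 := hy (g p) hgZ
    have e1 : ψ⁻¹ * (T y p - f p) = ζ (g p) y + ψ⁻¹ * ((∑ i, W (g p) i * f (x i) - f (g p)) -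
        (f p - f (g p))) := by
      simp only [T, ζ, Finset.mul_sum, mul_sub, mul_assoc]
      ring
    calc ψ⁻¹ * |T y p - f p| = |ψ⁻¹ * (T y p - f p)| := by
          rw [abs_mul, abs_of_pos (inv_pos.2 hψ)]
      _ ≤ |ζ (g p) y| + ψ⁻¹ * (|∑ i, W (g p) i * f (x i) - f (g p)| + |f p - f (g p)|) := by
          rw [e1]
          refine (abs_add_le _ _).trans ?_
          rw [abs_mul, abs_of_pos (inv_pos.2 hψ)]
          gcongr
          exact abs_sub _ _
      _ ≤ R + ψ⁻¹ * _ := add_le_add h4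
          (mul_le_mul_of_nonneg_left (add_le_add h1 h2) (by positivity))
      _ ≤ b + R := by linarith
  -- When the largest noise exceeds `t`, the loss is at most `A' e^u` with `u > t`, and `e^u ≤ exp
  -- (-(q-1) t) exp (q u)` since `q ≥ 1`. The maximum over the net is then replaced by the sum.
  have hptw : ∀ y, extendLoss w (ENNReal.ofReal ψ⁻¹ * supDist (T y) f) ≤
      ENNReal.ofReal (w (b + t)) + ∑ z ∈ Z, ENNReal.ofReal (A' * Real.exp (-((q - 1) * t))) *
        ENNReal.ofReal (Real.exp (q * |ζ z y|)) := by
    intro y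
    obtain ⟨z, hz, hmax⟩ := Finset.exists_max_image Z (fun z => |ζ z y|) hZne
    by_cases hzt : |ζ z y| ≤ t
    · exact (extendLoss_le hw (by positivity)
        (hdet y t ht fun z' hz' => (hmax z' hz').trans hzt)).trans le_self_add
    · refine le_add_left ?_
      refine (extendLoss_le hw (by positivity) (hdet y |ζ z y| (abs_nonneg _) hmax)).trans ?_
      refine le_trans ?_ (Finset.single_le_sum (f := fun z =>
        ENNReal.ofReal (A' * Real.exp (-((q - 1) * t))) *
        ENNReal.ofReal (Real.exp (q * |ζ z y|))) (fun _ _ => zero_le) hz)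
      rw [← ENNReal.ofReal_mul (by positivity)]
      refine ENNReal.ofReal_le_ofReal ((hA _ (abs_nonneg _)).trans ?_)
      rw [mul_assoc, ← Real.exp_add]
      refine mul_le_mul (le_max_left _ _) (Real.exp_le_exp.2 ?_) (Real.exp_pos _).le hA'0
      nlinarith [not_le.1 hzt]
  have hterm : ∀ z ∈ Z, ∫⁻ y, ENNReal.ofReal (A' * Real.exp (-((q - 1) * t))) *
      ENNReal.ofReal (Real.exp (q * |ζ z y|)) ∂P ≤
      ENNReal.ofReal (2 * A' * Real.exp (t - t ^ 2 / (2 * s))) := by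
    intro z hz
    set v := Real.toNNReal ((∑ i, bump β r (edist (x i) z) ^ 2) * σ ^ 2 /
      (ψ * ∑ i, bump β r (edist (x i) z)) ^ 2) with hv
    have hv' : (v : ℝ) = (∑ i, bump β r (edist (x i) z) ^ 2) * σ ^ 2 /
      (ψ * ∑ i, bump β r (edist (x i) z)) ^ 2 := Real.coe_toNNReal _ (by
        have : 0 ≤ ∑ i, bump β r (edist (x i) z) ^ 2 :=
          Finset.sum_nonneg fun i _ => sq_nonneg _
        positivity)
    have hlaw := map_sum_mul_pi_gaussianReal (fun i => ψ⁻¹ * W z i) (fun i => f (x i)) (σ ^ 2) v (by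
      rw [hv', Finset.sum_mul, Finset.sum_div]
      refine Finset.sum_congr rfl fun i _ => ?_
      simp only [W]
      have := hpos z hz
      push_cast
      field_simp)
    have hlaw' : Measure.map (ζ z) P = gaussianReal 0 v := by
      have h := gaussianReal_map_sub_const (μ := ∑ i, ψ⁻¹ * W z i * f (x i)) (v := v)
        (∑ i, ψ⁻¹ * W z i * f (x i))
      rw [← hlaw, Measure.map_map (by fun_prop) (measurable_linear_form _ _), sub_self] at h
      rw [← h, hP, regressionLaw]
      rfl
    rw [lintegral_const_mul' _ _ ENNReal.ofReal_ne_top,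
      ← lintegral_map (f := fun u => ENNReal.ofReal (Real.exp (q * |u|))) (by fun_prop) (hζm z),
      hlaw']
    refine (mul_le_mul_right (lintegral_exp_mul_abs_gaussianReal_le v q) _).trans ?_
    rw [← ENNReal.ofReal_mul (by positivity)]
    refine ENNReal.ofReal_le_ofReal ?_
    calc A' * Real.exp (-((q - 1) * t)) * (2 * Real.exp (v * q ^ 2 / 2))
        = 2 * A' * Real.exp (-((q - 1) * t) + v * q ^ 2 / 2) := by rw [Real.exp_add]; ring
      _ ≤ _ := by
        gcongr
        have h1 : (v : ℝ) * q ^ 2 / 2 ≤ s * q ^ 2 / 2 := by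
          have := hvar z hz
          rw [← hv'] at this
          gcongr
        have h2 : -((q - 1) * t) + s * q ^ 2 / 2 = t - t ^ 2 / (2 * s) := by
          rw [hq]; field_simp; ring
        linarith
  calc _ ≤ ∫⁻ y, (ENNReal.ofReal (w (b + t)) +
        ∑ z ∈ Z, ENNReal.ofReal (A' * Real.exp (-((q - 1) * t))) *
          ENNReal.ofReal (Real.exp (q * |ζ z y|))) ∂P := lintegral_mono hptw
    _ = ENNReal.ofReal (w (b + t)) + ∑ z ∈ Z,
        ∫⁻ y, ENNReal.ofReal (A' * Real.exp (-((q - 1) * t))) *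
          ENNReal.ofReal (Real.exp (q * |ζ z y|)) ∂P := by
        rw [lintegral_add_left measurable_const, lintegral_const, measure_univ, mul_one,
          lintegral_finsetSum]
        intro z _
        have := hζm z
        fun_prop
    _ ≤ _ := by
        gcongr
        refine (Finset.sum_le_card_nsmul _ _ _ hterm).trans_eq ?_
        rw [nsmul_eq_mul, ENNReal.ofReal_mul (Nat.cast_nonneg Z.card), ENNReal.ofReal_natCast]

end UpperBound

/-! ### Rate, bandwidth and elementary asymptotics -/

section Scales

theorem bandwidth_pos {d : ℕ} {β : ℝ} {n : ℕ} (hn : 2 ≤ n) : 0 < bandwidth d β n := by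
  have hn' : (1 : ℝ) < n := by exact_mod_cast hn
  have := Real.log_pos hn'
  unfold bandwidth
  positivity

theorem rate_eq_bandwidth_rpow {d : ℕ} {β : ℝ} {n : ℕ} (hn : 2 ≤ n) :
    rate d β n = bandwidth d β n ^ β := by
  have hn' : (1 : ℝ) < n := by exact_mod_cast hn
  have := Real.log_pos hn'
  rw [rate, bandwidth, ← Real.rpow_mul (by positivity)]
  congr 1; ring

theorem bandwidth_pow_eq_exp {d : ℕ} {β : ℝ} {n : ℕ} (hn : 2 ≤ n) :
    bandwidth d β n ^ d =
      Real.exp (-(d / (2 * β + d) * (Real.log n - Real.log (Real.log n)))) := by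
  have hn' : (1 : ℝ) < n := by exact_mod_cast hn
  have hl := Real.log_pos hn'
  have hn0 : (0 : ℝ) < n := by linarith
  rw [bandwidth, ← Real.rpow_natCast, ← Real.rpow_mul (by positivity),
    Real.rpow_def_of_pos (by positivity), Real.log_div hl.ne' hn0.ne']
  congr 1; ring

/-- This identity fixes the rate: of order `n h^d` observations in a ball, with signal `ψ`, give a
signal-to-noise ratio comparable to the logarithm of the number of balls. -/
theorem mul_bandwidth_pow_mul_rate_sq {d : ℕ} {β : ℝ} (hβ : 0 < β) {n : ℕ} (hn : 2 ≤ n) :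
    n * bandwidth d β n ^ d * rate d β n ^ 2 = Real.log n := by
  have hn' : (1 : ℝ) < n := by exact_mod_cast hn
  have hl := Real.log_pos hn'
  have hn0 : (0 : ℝ) < n := by linarith
  have hb : 0 < 2 * β + d := by positivity
  rw [bandwidth, rate, ← Real.rpow_natCast, ← Real.rpow_natCast, ← Real.rpow_mul (by positivity),
    ← Real.rpow_mul (by positivity), mul_assoc, ← Real.rpow_add (by positivity),
    show 1 / (2 * β + d) * (d : ℝ) + β / (2 * β + d) * ((2 : ℕ) : ℝ) = 1 by
      push_cast; field_simp; ring, Real.rpow_one]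
  field_simp

theorem tendsto_log_natCast_atTop : Tendsto (fun n : ℕ => Real.log n) atTop atTop :=
  Real.tendsto_log_atTop.comp tendsto_natCast_atTop_atTop

theorem tendsto_bandwidth {d : ℕ} {β : ℝ} (hβ : 0 < β) :
    Tendsto (bandwidth d β) atTop (𝓝[>] 0) := by
  refine tendsto_nhdsWithin_iff.2 ⟨?_, ?_⟩
  · have h1 : Tendsto (fun n : ℕ => Real.log n / n) atTop (𝓝 0) :=
      (Real.isLittleO_log_id_atTop.tendsto_div_nhds_zero).comp tendsto_natCast_atTop_atTop
    have hp : 0 < 1 / (2 * β + d) := by positivity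
    have h2 := h1.rpow_const (p := 1 / (2 * β + d)) (Or.inr hp.le)
    rwa [Real.zero_rpow hp.ne'] at h2
  · filter_upwards [eventually_ge_atTop 2] with n hn using bandwidth_pos hn

/-- For `l = log n` this is the logarithm, up to a constant, of the number of bumps times the
probability of a wrong sign. The linear gain `(κ - X/2) l` beats the logarithm and the square root,
each of which costs at most a quarter of it. -/
theorem tendsto_linear_sub_log_sub_sqrt {κ X : ℝ} (hX : X < 2 * κ) :
    Tendsto (fun l : ℝ => κ * (l - Real.log l) + (-(X * l) / 2 - Real.sqrt (X * l)))
      atTop atTop := by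
  set γ := κ - X / 2 with hγ
  have hγ0 : 0 < γ := by rw [hγ]; linarith
  have h1 : ∀ᶠ l : ℝ in atTop, κ * Real.log l ≤ γ / 4 * l := by
    have := (Real.isLittleO_log_id_atTop.const_mul_left κ).def (c := γ / 4) (by positivity)
    filter_upwards [this, eventually_ge_atTop 0] with l hl hl0
    simp only [id, Real.norm_eq_abs, abs_of_nonneg hl0] at hl
    exact (le_abs_self _).trans hl
  have h2 : ∀ᶠ l : ℝ in atTop, Real.sqrt (X * l) ≤ γ / 4 * l := by
    filter_upwards [eventually_ge_atTop (|X| * 16 / γ ^ 2), eventually_ge_atTop 0] with l hl hl0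
    refine Real.sqrt_le_iff.2 ⟨by positivity, ?_⟩
    rw [div_le_iff₀ (by positivity)] at hl
    have := le_abs_self X
    nlinarith
  refine tendsto_atTop_mono' _ (f₁ := fun l => γ / 2 * l) ?_
    (tendsto_id.const_mul_atTop (by positivity))
  filter_upwards [h1, h2] with l h1 h2
  rw [hγ] at *
  nlinarith

theorem TendstoUniformly.eventually_forall_pair {α : Type*} {F G : ℕ → α → ℝ} {A B : ℝ}
    (hF : TendstoUniformly F (fun _ => A) atTop) (hG : TendstoUniformly G (fun _ => B) atTop)
    {p : ℝ × ℝ → Prop} (hp : ∀ᶠ q in 𝓝 (A, B), p q) : ∀ᶠ n in atTop, ∀ z, p (F n z, G n z) := by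
  obtain ⟨ε, hε, hball⟩ := Metric.eventually_nhds_iff.1 hp
  filter_upwards [Metric.tendstoUniformly_iff.1 hF ε hε, Metric.tendstoUniformly_iff.1 hG ε hε]
    with n h1 h2 z
  refine hball ?_
  rw [Prod.dist_eq]
  exact max_lt (by rw [dist_comm]; exact h1 z) (by rw [dist_comm]; exact h2 z)

theorem bump_sq {β r : ℝ} (hr : 0 < r) (t : ℝ≥0∞) :
    bump β r t ^ 2 = 2 * bump β r t - bump (2 * β) r t := by
  by_cases ht : t ≤ ENNReal.ofReal r
  · rw [bump, bump, if_pos ht, if_pos ht, mul_comm 2 β, Real.rpow_mul (by positivity),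
      Real.rpow_two]
    ring
  · simp [bump, ht]

/-- Polynomial growth is dominated by the exponential for large arguments; monotonicity bounds `w`
on the remaining bounded interval. -/
theorem exists_exp_bound {w : ℝ → ℝ} (hw_mono : MonotoneOn w (Set.Ici 0))
    (hw_growth : ∃ p : ℝ, w =O[atTop] fun u : ℝ => u ^ p) {b : ℝ} (hb : 0 ≤ b) :
    ∃ A, ∀ u, 0 ≤ u → w (b + u) ≤ A * Real.exp u := by
  obtain ⟨p, hp⟩ := hw_growth
  obtain ⟨C, hC⟩ := (hp.trans_isLittleO (isLittleO_rpow_exp_atTop p)).isBigO.bound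
  obtain ⟨v, hv⟩ := eventually_atTop.1 hC
  set v' := max v 0 with hv'
  refine ⟨|C| * Real.exp b + |w v'|, fun u hu => ?_⟩
  have he : 1 ≤ Real.exp u := Real.one_le_exp hu
  rw [add_mul]
  by_cases h : v ≤ b + u
  · have h1 := hv _ h
    rw [Real.norm_eq_abs, Real.norm_eq_abs, abs_of_pos (Real.exp_pos _), Real.exp_add] at h1
    have h2 : C * (Real.exp b * Real.exp u) ≤ |C| * Real.exp b * Real.exp u := by
      rw [mul_assoc]; gcongr; exact le_abs_self C
    have h3 : 0 ≤ |w v'| * Real.exp u := by positivity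
    linarith [le_abs_self (w (b + u))]
  · have h1 : w (b + u) ≤ w v' :=
      hw_mono (Set.mem_Ici.2 (by positivity)) (Set.mem_Ici.2 (le_max_right _ _))
        ((not_le.1 h).le.trans (le_max_left _ _))
    have h2 : |w v'| ≤ |w v'| * Real.exp u := le_mul_of_one_le_right (abs_nonneg _) he
    have h3 : 0 ≤ |C| * Real.exp b * Real.exp u := by positivity
    linarith [le_abs_self (w v')]

end Scales

/-! ### Asymptotic bounds below and above the critical radius -/

section Asymptotics

variable {M : Type*} [EMetricSpace M] [MeasurableSpace M] {d : ℕ} {β L σ : ℝ≥0} {a : ℝ}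
  {x : (n : ℕ) → Fin n → M} {w : ℝ → ℝ}

/-- Below the critical radius, the risk is asymptotically at least the loss of a bump's height. -/
theorem eventually_lt_supNormMinimaxRisk (hd : 0 < d) (hβ : 0 < β) (hβ1 : β ≤ 1) (hL : 0 < L)
    (hσ : 0 < σ) (ha : 0 < a)
    (hx : ∀ c : ℝ, 0 < c → TendstoUniformly
      (fun (n : ℕ) (z : M) =>
        ({i : Fin n | edist (x n i) z ≤ ENNReal.ofReal (c * bandwidth d β n)}.ncard : ℝ) /
          (n * bandwidth d β n ^ d)) (fun _ => a * c ^ d) atTop)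
    {k : ℝ} (hk : 0 < k) (hnet : ∀ᶠ s in 𝓝[>] (0 : ℝ), ∃ Z : Finset M,
      (∀ z ∈ Z, ∀ z' ∈ Z, z ≠ z' → ENNReal.ofReal s < edist z z') ∧ k ≤ Z.card * s ^ d)
    {c : ℝ} (hc : 0 < c)
    (hcrit : L ^ 2 * a * β ^ 2 * ((c ^ (β : ℝ)) ^ 2 * c ^ d) < σ ^ 2 * d * (d + β))
    {y : ℝ≥0∞} (hy : y < ENNReal.ofReal (w (L * c ^ (β : ℝ)))) :
    ∀ᶠ n in atTop, y < supNormMinimaxRisk w β L σ (rate d β n) (x n) := by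
  have hβ' : (0 : ℝ) < β := by exact_mod_cast hβ
  have hL' : (0 : ℝ) < L := by exact_mod_cast hL
  have hσ' : (0 : ℝ) < σ := by exact_mod_cast hσ
  have hd' : (0 : ℝ) < d := by exact_mod_cast hd
  have hh := tendsto_bandwidth (d := d) hβ'
  have hhpos := (tendsto_nhdsWithin_iff.1 hh).2
  set κ : ℝ := d / (2 * β + d) with hκ
  set B := a * c ^ d with hB
  set K := L ^ 2 * (c ^ (β : ℝ)) ^ 2 / σ ^ 2 with hK
  have h1 := tendstoUniformly_sum_bump ha.le hhpos hx hβ' hc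
  have h2 := tendstoUniformly_sum_bump ha.le hhpos hx (γ := 2 * β) (by positivity) hc
  -- The left side is the limit of the squared signal-to-noise ratio divided by `log n`; being below
  -- `2 * κ` is equivalent to `hcrit`.
  have hlim : K * (2 * (B * (β / (d + β))) - B * (2 * β / (d + 2 * β))) < 2 * κ := by
    have e : K * (2 * (B * (β / (d + β))) - B * (2 * β / (d + 2 * β))) =
        L ^ 2 * a * β ^ 2 * ((c ^ (β : ℝ)) ^ 2 * c ^ d) / (σ ^ 2 * d * (d + β)) * (2 * κ) := by
      rw [hK, hB, hκ]; field_simp; ring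
    rw [e]
    exact mul_lt_of_lt_one_left (by positivity) ((div_lt_one (by positivity)).2 hcrit)
  obtain ⟨X, hX1, hX2⟩ := exists_between hlim
  have hs := h1.eventually_forall_pair h2 (p := fun q => K * (2 * q.1 - q.2) < X)
    ((Continuous.tendsto (by fun_prop : Continuous fun q : ℝ × ℝ => K * (2 * q.1 - q.2))
      _).eventually_lt_const hX1)
  set D : ℝ := 2 + 2 ^ (1 / (β : ℝ)) with hD
  have hD0 : 0 < D := by positivity
  have hscale : Tendsto (fun n => D * (c * bandwidth d β n)) atTop (𝓝[>] 0) := by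
    refine tendsto_nhdsWithin_iff.2 ⟨?_, ?_⟩
    · simpa using ((tendsto_nhdsWithin_iff.1 hh).1.const_mul c).const_mul D
    · filter_upwards [hhpos] with n hn using mul_pos hD0 (mul_pos hc hn)
  have hgrow := (tendsto_linear_sub_log_sub_sqrt hX2).comp tendsto_log_natCast_atTop
  have hgrow2 : Tendsto (fun n : ℕ => ENNReal.ofReal (w (L * c ^ (β : ℝ))) *
      ENNReal.ofReal (1 - Real.exp (-(k / (D * c) ^ d / 2 * Real.exp
        (κ * (Real.log n - Real.log (Real.log n)) +
          (-(X * Real.log n) / 2 - Real.sqrt (X * Real.log n))))))) atTop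
      (𝓝 (ENNReal.ofReal (w (L * c ^ (β : ℝ))) * ENNReal.ofReal (1 - 0))) := by
    refine ENNReal.Tendsto.const_mul (ENNReal.tendsto_ofReal (tendsto_const_nhds.sub ?_))
      (Or.inr ENNReal.ofReal_ne_top)
    refine Real.tendsto_exp_neg_atTop_nhds_zero.comp ?_
    exact (Real.tendsto_exp_atTop.comp hgrow).const_mul_atTop (by positivity)
  rw [sub_zero, ENNReal.ofReal_one, mul_one] at hgrow2
  filter_upwards [hgrow2.eventually_const_lt hy, hs, hscale.eventually hnet,
    eventually_ge_atTop 2] with n hn1 hn2 hn3 hn4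
  obtain ⟨Z, hZ, hZcard⟩ := hn3
  have hhn := bandwidth_pos (d := d) (β := β) hn4
  have hψ : 0 < rate d β n := by rw [rate_eq_bandwidth_rpow hn4]; positivity
  have hn' : (1 : ℝ) < n := by exact_mod_cast hn4
  have hn0 : (0 : ℝ) < n := by linarith
  have hl := Real.log_pos hn'
  have hrβ : (c * bandwidth d β n) ^ (β : ℝ) = c ^ (β : ℝ) * rate d β n := by
    rw [Real.mul_rpow hc.le hhn.le, rate_eq_bandwidth_rpow hn4]
  have hbound := le_supNormMinimaxRisk (w := w) hβ hβ1 hL hσ hψ (r := c * bandwidth d β n)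
    (by positivity) (x n) hZ (s := X * Real.log n) (by
      intro z _
      have hz := hn2 z
      rw [← mul_bandwidth_pow_mul_rate_sq hβ' hn4 (d := d)]
      calc ∑ i, (L * (c * bandwidth d β n) ^ (β : ℝ) *
            bump β (c * bandwidth d β n) (edist (x n i) z)) ^ 2 / σ ^ 2
          = K * rate d β n ^ 2 *
            ∑ i, bump β (c * bandwidth d β n) (edist (x n i) z) ^ 2 := by
            rw [Finset.mul_sum]
            refine Finset.sum_congr rfl fun i _ => ?_
            rw [hrβ, hK]; field_simp
        _ = K * rate d β n ^ 2 *
            (2 * ∑ i, bump β (c * bandwidth d β n) (edist (x n i) z) -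
              ∑ i, bump (2 * β) (c * bandwidth d β n) (edist (x n i) z)) := by
            simp only [bump_sq (mul_pos hc hhn)]
            rw [Finset.sum_sub_distrib, Finset.mul_sum]
        _ = K * (2 * ((∑ i, bump β (c * bandwidth d β n) (edist (x n i) z)) /
              (n * bandwidth d β n ^ d)) -
              (∑ i, bump (2 * β) (c * bandwidth d β n) (edist (x n i) z)) /
              (n * bandwidth d β n ^ d)) * (n * bandwidth d β n ^ d * rate d β n ^ 2) := by
            field_simp
        _ ≤ _ := by gcongr)
  refine hn1.trans_le (le_trans ?_ hbound)
  have e1 : (rate d β n)⁻¹ * (L * (c * bandwidth d β n) ^ (β : ℝ)) = L * c ^ (β : ℝ) := by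
    rw [hrβ]; field_simp
  rw [e1]
  refine mul_le_mul_right (ENNReal.ofReal_le_ofReal (sub_le_sub_left
    (Real.exp_le_exp.2 (neg_le_neg ?_)) _)) _
  rw [Real.exp_add, ← mul_assoc]
  refine mul_le_mul_of_nonneg_right ?_ (Real.exp_pos _).le
  have hbd := bandwidth_pow_eq_exp (d := d) (β := β) hn4
  rw [← hκ, Real.exp_neg] at hbd
  have hE : Real.exp (κ * (Real.log n - Real.log (Real.log n))) = (bandwidth d β n ^ d)⁻¹ := by
    rw [hbd, inv_inv]
  rw [hE]
  calc k / (D * c) ^ d / 2 * (bandwidth d β n ^ d)⁻¹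
      = k / (D * (c * bandwidth d β n)) ^ d / 2 := by
        rw [← mul_assoc, mul_pow _ (bandwidth d β n)]; field_simp
    _ ≤ Z.card / 2 := by
        gcongr
        rw [div_le_iff₀ (by positivity)]
        exact hZcard

/-- Above the critical radius, the risk is asymptotically at most the loss of any number larger
than a bump's height. -/
theorem eventually_supNormMinimaxRisk_lt [BorelSpace M] [Nonempty M] (hd : 0 < d) (hβ : 0 < β)
    (hL : 0 < L) (hσ : 0 < σ) (ha : 0 < a)
    (hx : ∀ c : ℝ, 0 < c → TendstoUniformly
      (fun (n : ℕ) (z : M) =>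
        ({i : Fin n | edist (x n i) z ≤ ENNReal.ofReal (c * bandwidth d β n)}.ncard : ℝ) /
          (n * bandwidth d β n ^ d)) (fun _ => a * c ^ d) atTop)
    {k : ℝ} (hk : 0 < k) (hnet : ∀ᶠ s in 𝓝[>] (0 : ℝ), ∃ Z : Finset M,
      (∀ y, ∃ z ∈ Z, edist y z ≤ ENNReal.ofReal s) ∧ Z.card * s ^ d ≤ k)
    (hw_mono : MonotoneOn w (Set.Ici 0)) (hw_growth : ∃ p : ℝ, w =O[atTop] fun u : ℝ => u ^ p)
    {c : ℝ} (hc : 0 < c)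
    (hcrit : σ ^ 2 * d * (d + β) < L ^ 2 * a * β ^ 2 * ((c ^ (β : ℝ)) ^ 2 * c ^ d))
    {C : ℝ} (hC : L * c ^ (β : ℝ) < C) {y : ℝ≥0∞} (hy : ENNReal.ofReal (w C) < y) :
    ∀ᶠ n in atTop, supNormMinimaxRisk w β L σ (rate d β n) (x n) < y := by
  have hβ' : (0 : ℝ) < β := by exact_mod_cast hβ
  have hL' : (0 : ℝ) < L := by exact_mod_cast hL
  have hσ' : (0 : ℝ) < σ := by exact_mod_cast hσ
  have hd' : (0 : ℝ) < d := by exact_mod_cast hd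
  have hh := tendsto_bandwidth (d := d) hβ'
  have hhpos := (tendsto_nhdsWithin_iff.1 hh).2
  set κ : ℝ := d / (2 * β + d) with hκ
  have hκ0 : 0 < κ := by positivity
  set B := a * c ^ d with hB
  have hB0 : 0 < B := by positivity
  set H := L * c ^ (β : ℝ) with hH
  have hH0 : 0 < H := by positivity
  -- The height `H` is split into the noise level `t` and the limiting bias bound `H d/(d + 2β)`.
  set t := H * (2 * β / (d + 2 * β)) with ht
  have ht0 : 0 < t := by positivity
  -- The bias budget gets the whole gap `C - H`, which also has to pay for the mesh of the net.
  set b := C - t with hb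
  have hbH : H * (d / (d + 2 * β)) < b := by
    have : H * (d / (d + 2 * β)) + t = H := by rw [ht]; field_simp
    linarith
  have hb0 : 0 ≤ b := le_trans (by positivity) hbH.le
  obtain ⟨A, hA⟩ := exists_exp_bound hw_mono hw_growth hb0
  have h1 := tendstoUniformly_sum_bump ha.le hhpos hx hβ' hc
  have h2 := tendstoUniformly_sum_bump ha.le hhpos hx (γ := 2 * β) (by positivity) hc
  set A₁ := B * (β / (d + β)) with hA₁
  set A₂ := B * (2 * β / (d + 2 * β)) with hA₂
  have hA₁0 : 0 < A₁ := by positivity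
  have hbias : H * ((A₂ - A₁) / A₁) < b := by
    convert hbH using 2
    rw [hA₁, hA₂]; field_simp; ring
  -- The left side is the limit of the normalised noise variance times `log n`. The condition
  -- `hcrit` puts it below `t ^ 2 / (2 * κ)`, the largest variance that a union bound over `n^κ`
  -- points tolerates.
  have hvar : (2 * A₁ - A₂) * σ ^ 2 / A₁ ^ 2 < t ^ 2 / (2 * κ) := by
    have e : (2 * A₁ - A₂) * σ ^ 2 / A₁ ^ 2 = σ ^ 2 * d * (d + β) /
        (L ^ 2 * a * β ^ 2 * ((c ^ (β : ℝ)) ^ 2 * c ^ d)) * (t ^ 2 / (2 * κ)) := by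
      rw [hA₁, hA₂, hB, ht, hH, hκ]; field_simp; ring
    rw [e]
    exact mul_lt_of_lt_one_left (by positivity) ((div_lt_one (by positivity)).2 hcrit)
  -- The maximum with `0` makes `Y` positive without a sign computation for the variance.
  obtain ⟨Y, hY1, hY2⟩ := exists_between (max_lt hvar (by positivity : 0 < t ^ 2 / (2 * κ)))
  have hY0 : 0 < Y := (le_max_right _ _).trans_lt hY1
  obtain ⟨δ, hδ, hδ0⟩ : ∃ δ : ℝ, H * ((A₂ - A₁) / A₁) + L * δ ^ (β : ℝ) < b ∧ 0 < δ := by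
    have hcont : Tendsto (fun δ : ℝ => H * ((A₂ - A₁) / A₁) + L * δ ^ (β : ℝ)) (𝓝[>] 0)
        (𝓝 (H * ((A₂ - A₁) / A₁) + L * 0 ^ (β : ℝ))) :=
      ((((Real.continuous_rpow_const hβ'.le).tendsto 0).const_mul _).const_add _).mono_left
        nhdsWithin_le_nhds
    rw [Real.zero_rpow hβ'.ne', mul_zero, add_zero] at hcont
    exact ((hcont.eventually_lt_const hbias).and self_mem_nhdsWithin).exists
  have hfst : Tendsto (fun q : ℝ × ℝ => q.1) (𝓝 (A₁, A₂)) (𝓝 A₁) := continuous_fst.tendsto _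
  have hsnd : Tendsto (fun q : ℝ × ℝ => q.2) (𝓝 (A₁, A₂)) (𝓝 A₂) := continuous_snd.tendsto _
  have hev := h1.eventually_forall_pair h2 (p := fun q => 0 < q.1 ∧
      H * ((q.2 - q.1) / q.1) + L * δ ^ (β : ℝ) < b ∧ (2 * q.1 - q.2) * σ ^ 2 / q.1 ^ 2 < Y)
    ((hfst.eventually_const_lt hA₁0).and
      ((((((hsnd.sub hfst).div hfst hA₁0.ne').const_mul H).add_const _).eventually_lt_const hδ).and
      (((((hfst.const_mul 2).sub hsnd).mul_const _).div (hfst.pow 2)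
        (pow_ne_zero 2 hA₁0.ne')).eventually_lt_const ((le_max_left _ _).trans_lt hY1))))
  have hscale : Tendsto (fun n => δ * bandwidth d β n) atTop (𝓝[>] 0) := by
    refine tendsto_nhdsWithin_iff.2 ⟨?_, ?_⟩
    · simpa using (tendsto_nhdsWithin_iff.1 hh).1.const_mul δ
    · filter_upwards [hhpos] with n hn using mul_pos hδ0 hn
  have hdecay : Tendsto (fun n : ℕ => ENNReal.ofReal (w C) + ENNReal.ofReal
      (k / δ ^ d * (2 * max A 0 * Real.exp t) *
        Real.exp (-((t ^ 2 / (2 * Y) - κ) * Real.log n)))) atTop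
      (𝓝 (ENNReal.ofReal (w C) + ENNReal.ofReal (k / δ ^ d * (2 * max A 0 * Real.exp t) * 0))) := by
    refine tendsto_const_nhds.add (ENNReal.tendsto_ofReal (Tendsto.const_mul _ ?_))
    refine Real.tendsto_exp_neg_atTop_nhds_zero.comp
      (tendsto_log_natCast_atTop.const_mul_atTop ?_)
    rw [sub_pos, lt_div_iff₀ (by positivity)]
    rw [lt_div_iff₀ (by positivity)] at hY2
    linarith
  rw [mul_zero, ENNReal.ofReal_zero, add_zero] at hdecay
  filter_upwards [hdecay.eventually_lt_const hy, hev, hscale.eventually hnet,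
    eventually_ge_atTop 2, tendsto_log_natCast_atTop.eventually_ge_atTop 1,
    tendsto_log_natCast_atTop.eventually_ge_atTop (Y / t)] with n hn1 hn2 hn3 hn4 hn5 hn6
  obtain ⟨Z, hZ, hZcard⟩ := hn3
  have hhn := bandwidth_pos (d := d) (β := β) hn4
  have hψ : 0 < rate d β n := by rw [rate_eq_bandwidth_rpow hn4]; positivity
  have hn' : (1 : ℝ) < n := by exact_mod_cast hn4
  have hn0 : (0 : ℝ) < n := by linarith
  have hl := Real.log_pos hn'
  have hrβ : ∀ c : ℝ, 0 ≤ c → (c * bandwidth d β n) ^ (β : ℝ) = c ^ (β : ℝ) * rate d β n := by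
    intro c hc
    rw [Real.mul_rpow hc hhn.le, rate_eq_bandwidth_rpow hn4]
  have hZne : Z.Nonempty := by
    obtain ⟨p⟩ := ‹Nonempty M›
    obtain ⟨z, hz, _⟩ := hZ p
    exact ⟨z, hz⟩
  have hDn : 0 < n * bandwidth d β n ^ d := by positivity
  have hrisk := supNormMinimaxRisk_le hw_mono (σ := σ) (L := L) (β := β) hψ
    (r := c * bandwidth d β n) (mul_pos hc hhn) (δ := δ * bandwidth d β n) (by positivity) ht0.le
    (s := Y / Real.log n) (by positivity) (by
      rw [div_le_iff₀ ht0] at hn6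
      rw [div_le_iff₀ hl]; linarith) hb0 (x n) hZne hZ
    (fun z _ => (div_pos_iff_of_pos_right hDn).1 (hn2 z).1) (by
      intro z _
      obtain ⟨hz1, hz2, -⟩ := hn2 z
      have hS := (div_pos_iff_of_pos_right hDn).1 hz1
      refine le_trans (le_of_eq ?_) hz2.le
      rw [hrβ c hc.le, hrβ δ hδ0.le, Finset.sum_sub_distrib, hH]
      field_simp) (by
      intro z _
      obtain ⟨hz1, -, hz3⟩ := hn2 z
      have hS := (div_pos_iff_of_pos_right hDn).1 hz1
      rw [le_div_iff₀ hl, ← mul_bandwidth_pow_mul_rate_sq hβ' hn4 (d := d)]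
      refine le_trans (le_of_eq ?_) hz3.le
      simp only [bump_sq (mul_pos hc hhn)]
      rw [Finset.sum_sub_distrib, ← Finset.mul_sum]
      field_simp) hA
  rw [show b + t = C by rw [hb]; ring] at hrisk
  refine (hrisk.trans ?_).trans_lt hn1
  refine add_le_add le_rfl (ENNReal.ofReal_le_ofReal ?_)
  have hbd := bandwidth_pow_eq_exp (d := d) (β := β) hn4
  rw [← hκ, Real.exp_neg] at hbd
  have hE : Real.exp (κ * (Real.log n - Real.log (Real.log n))) = (bandwidth d β n ^ d)⁻¹ := by
    rw [hbd, inv_inv]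
  have hcard : (Z.card : ℝ) ≤ k / δ ^ d * Real.exp (κ * Real.log n) := by
    calc (Z.card : ℝ) ≤ k / (δ * bandwidth d β n) ^ d := by
          rw [le_div_iff₀ (by positivity)]; exact hZcard
      _ = k / δ ^ d * Real.exp (κ * (Real.log n - Real.log (Real.log n))) := by
          rw [hE, mul_pow]; field_simp
      _ ≤ _ := by
          gcongr
          linarith [Real.log_nonneg hn5]
  have hA0 : 0 ≤ max A 0 := le_max_right _ _
  calc Z.card * (2 * max A 0 * Real.exp (t - t ^ 2 / (2 * (Y / Real.log n))))
      ≤ k / δ ^ d * Real.exp (κ * Real.log n) *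
        (2 * max A 0 * Real.exp (t - t ^ 2 / (2 * (Y / Real.log n)))) := by gcongr
    _ = k / δ ^ d * (2 * max A 0 * Real.exp t) *
        (Real.exp (κ * Real.log n) * Real.exp (-(t ^ 2 / (2 * (Y / Real.log n))))) := by
        rw [sub_eq_add_neg, Real.exp_add]; ring
    _ = _ := by
        rw [← Real.exp_add]
        congr 2
        field_simp
        ring

end Asymptotics

/-! ### The critical radius and the constant -/

section CriticalRadius

variable {d : ℕ} {β L σ V : ℝ}

/-- The ratio of the bandwidth that balances bias and noise to `(log n / n)^(1/(2β+d))`. -/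
def criticalRadius (d : ℕ) (β L σ V : ℝ) : ℝ :=
  (σ ^ 2 * V * (β + d) * (d : ℝ) ^ 2 / (sphereVolume d * β ^ 2) / L ^ 2) ^ (1 / (2 * β + d))

theorem sphereVolume_pos (hd : 0 < d) : 0 < sphereVolume d := by
  have : 0 < Real.Gamma ((d : ℝ) / 2) := Real.Gamma_pos_of_pos (by positivity)
  unfold sphereVolume
  positivity

theorem criticalRadius_pos (hd : 0 < d) (hβ : 0 < β) (hL : 0 < L) (hσ : 0 < σ) (hV : 0 < V) :
    0 < criticalRadius d β L σ V := by
  have := sphereVolume_pos hd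
  unfold criticalRadius
  positivity

theorem mul_criticalRadius_rpow (hd : 0 < d) (hβ : 0 < β) (hL : 0 < L) (hσ : 0 < σ)
    (hV : 0 < V) : L * criticalRadius d β L σ V ^ β = minimaxConst d β L σ V := by
  have := sphereVolume_pos hd
  rw [criticalRadius, minimaxConst]
  set Q := σ ^ 2 * V * (β + d) * (d : ℝ) ^ 2 / (sphereVolume d * β ^ 2) with hQ
  have hQ0 : 0 ≤ Q := by positivity
  have hs : 0 < 2 * β + d := by positivity
  rw [← Real.rpow_mul (by positivity), Real.div_rpow hQ0 (by positivity), ← Real.rpow_natCast L 2,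
    ← Real.rpow_mul hL.le, show 1 / (2 * β + d) * β = β / (2 * β + d) by ring]
  have e : L ^ ((d : ℝ) / (2 * β + d)) * L ^ (((2 : ℕ) : ℝ) * (β / (2 * β + d))) = L := by
    rw [← Real.rpow_add hL]
    convert Real.rpow_one L using 2
    push_cast
    field_simp
    ring
  have : L ^ (((2 : ℕ) : ℝ) * (β / (2 * β + d))) ≠ 0 := (Real.rpow_pos_of_pos hL _).ne'
  rw [← mul_div_assoc, div_eq_iff this, mul_right_comm, e]

/-- The equality case of `hcrit` in both asymptotic bounds, so strict monotonicity in `c` puts every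
smaller radius in the first and every larger one in the second. -/
theorem criticalRadius_rpow_sq_mul_pow (hd : 0 < d) (hβ : 0 < β) (hL : 0 < L) (hσ : 0 < σ)
    (hV : 0 < V) :
    L ^ 2 * (unitBallVol d / V) * β ^ 2 *
      ((criticalRadius d β L σ V ^ β) ^ 2 * criticalRadius d β L σ V ^ d) =
      σ ^ 2 * d * (d + β) := by
  have hS := sphereVolume_pos hd
  have hc := criticalRadius_pos hd hβ hL hσ hV
  have hs : 0 < 2 * β + d := by positivity
  have hd' : (0 : ℝ) < d := by exact_mod_cast hd
  have e : (criticalRadius d β L σ V ^ β) ^ 2 * criticalRadius d β L σ V ^ d =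
      σ ^ 2 * V * (β + d) * (d : ℝ) ^ 2 / (sphereVolume d * β ^ 2) / L ^ 2 := by
    rw [← Real.rpow_natCast _ 2, ← Real.rpow_mul hc.le, ← Real.rpow_natCast _ d,
      ← Real.rpow_add hc, criticalRadius, ← Real.rpow_mul (by positivity)]
    convert Real.rpow_one _ using 2
    push_cast
    field_simp
  rw [e, unitBallVol_eq hd]
  field_simp
  ring

theorem rpow_sq_mul_pow_lt {c c' : ℝ} (hβ : 0 < β) (hc : 0 < c) (h : c < c') :
    (c ^ β) ^ 2 * c ^ d < (c' ^ β) ^ 2 * c' ^ d := by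
  have := Real.rpow_lt_rpow hc.le h hβ
  have := pow_lt_pow_left₀ this (by positivity) two_ne_zero
  exact mul_lt_mul this (pow_le_pow_left₀ hc.le h.le d) (by positivity) (by positivity)

end CriticalRadius

end

/-! ### The limit of the minimax risk -/

theorem theorem2
    {d : ℕ} (hd : 0 < d)
    {M : Type*} [EMetricSpace M] [CompactSpace M]
    [ChartedSpace (EuclideanSpace ℝ (Fin d)) M] [IsManifold (𝓡 d) ∞ M]
    [RiemannianBundle (fun x : M => TangentSpace (𝓡 d) x)]
    [IsContMDiffRiemannianBundle (𝓡 d) ∞ (EuclideanSpace ℝ (Fin d))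
      (fun x : M => TangentSpace (𝓡 d) x)]
    [IsRiemannianManifold (𝓡 d) M]
    [MeasurableSpace M] [BorelSpace M]
    (β L σ : ℝ≥0) (hβ : 0 < β) (hβ1 : β ≤ 1) (hL : 0 < L) (hσ : 0 < σ)
    (w : ℝ → ℝ) (hw0 : w 0 = 0) (hw_cont : ContinuousOn w (Set.Ici 0))
    (hw_mono : MonotoneOn w (Set.Ici 0)) (hw_growth : ∃ p : ℝ, w =O[atTop] fun u : ℝ => u ^ p)
    (x : (n : ℕ) → Fin n → M) (hx : IsAsympUniform d x (bandwidth d β)) :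
    Tendsto (fun n : ℕ => supNormMinimaxRisk w β L σ (rate d β n) (x n)) atTop
      (𝓝 (ENNReal.ofReal
        (w (minimaxConst d β L σ ((riemannianVolume d M).real Set.univ))))) := by
  -- A design with one point already provides a point of `M`.
  have : Nonempty M := ⟨x 1 0⟩
  have hβ' : (0 : ℝ) < β := by exact_mod_cast hβ
  have hL' : (0 : ℝ) < L := by exact_mod_cast hL
  have hσ' : (0 : ℝ) < σ := by exact_mod_cast hσ
  have hV : 0 < (riemannianVolume d M).real Set.univ := riemannianVolume_real_univ_pos hd
  set V := (riemannianVolume d M).real Set.univ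
  have hω := unitBallVol_pos d
  have ha : 0 < unitBallVol d / V := by positivity
  have hunif := fun (c : ℝ) (hc : 0 < c) =>
    hx.tendstoUniformly_ncard hd (tendsto_bandwidth hβ') hc
  obtain ⟨k, hk, K, hK, hnet⟩ := exists_net (M := M) hd
  rw [← mul_criticalRadius_rpow hd hβ' hL' hσ' hV]
  have heq := criticalRadius_rpow_sq_mul_pow hd hβ' hL' hσ' hV
  have hc₀ := criticalRadius_pos hd hβ' hL' hσ' hV
  set c₀ := criticalRadius d β L σ V
  have hcoef : 0 < (L : ℝ) ^ 2 * (unitBallVol d / V) * β ^ 2 := by positivity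
  have hheight : Tendsto (fun c : ℝ => L * c ^ (β : ℝ)) (𝓝 c₀) (𝓝 (L * c₀ ^ (β : ℝ))) :=
    ((Real.continuous_rpow_const hβ'.le).tendsto c₀).const_mul _
  have hH₀ : 0 < L * c₀ ^ (β : ℝ) := by positivity
  have hloss : Tendsto (fun u => ENNReal.ofReal (w u)) (𝓝 (L * c₀ ^ (β : ℝ)))
      (𝓝 (ENNReal.ofReal (w (L * c₀ ^ (β : ℝ))))) :=
    ENNReal.tendsto_ofReal (hw_cont.continuousAt (Ici_mem_nhds hH₀))
  refine tendsto_order.2 ⟨fun y hy => ?_, fun y hy => ?_⟩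
  -- By continuity of `w`, a radius slightly below `c₀` still has bump height with loss above `y`.
  · obtain ⟨c, ⟨hyc, hc⟩, hlt⟩ :=
      ((((hloss.comp hheight).eventually_const_lt hy).and (lt_mem_nhds hc₀)).filter_mono
        (nhdsWithin_le_nhds (s := Set.Iio c₀))).and self_mem_nhdsWithin |>.exists
    refine eventually_lt_supNormMinimaxRisk hd hβ hβ1 hL hσ ha hunif hk
      (hnet.mono fun s ⟨Z, h1, _, h2, _⟩ => ⟨Z, h1, h2⟩) hc ?_ hyc
    rw [← heq]
    exact mul_lt_mul_of_pos_left (rpow_sq_mul_pow_lt hβ' hc hlt) hcoef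
  -- First a level `C` above `L c₀^β` with loss below `y`, then a radius above `c₀` whose bump
  -- height is still below `C`; the gap is the bias slack.
  · obtain ⟨C, hyC, hC⟩ := ((hloss.eventually_lt_const hy).filter_mono
      (nhdsWithin_le_nhds (s := Set.Ioi (L * c₀ ^ (β : ℝ))))).and self_mem_nhdsWithin |>.exists
    obtain ⟨c, hcC, hlt⟩ := ((hheight.eventually_lt_const hC).filter_mono
      (nhdsWithin_le_nhds (s := Set.Ioi c₀))).and self_mem_nhdsWithin |>.exists
    refine eventually_supNormMinimaxRisk_lt hd hβ hL hσ ha hunif hK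
      (hnet.mono fun s ⟨Z, _, h1, _, h2⟩ => ⟨Z, h1, h2⟩) hw_mono hw_growth
      (hc₀.trans hlt) ?_ hcC hyC
    rw [← heq]
    exact mul_lt_mul_of_pos_left (rpow_sq_mul_pow_lt hβ' hc₀ hlt) hcoef
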